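/- **Setting.** Let $d\ge 2$, $m\ge 1$; write $B_r$ for the open ball of radius $r$ at $0$. Let $\Lambda\subset\mathbb R^d$, ${\sf A}\in\mathbb R^{d\times d}$ invertible and $R_{\rm def}>0$ be such that $\Lambda\cap B_{R_{\rm def}}$ is finite and $\Lambda\setminus B_{R_{\rm def}}={\sf A}\mathbb Z^d\setminus B_{R_{\rm def}}$; put $\Lambda^{\rm hom}={\sf A}\mathbb Z^d$. For a cutoff $r_{\rm cut}>0$ let $\mathcal R_\ell=\{n-\ell: n\in\Lambda\}\cap B_{r_{\rm cut}}$ for $\ell\in\Lambda$, and $\mathcal R=\Lambda^{\rm hom}\cap B_{r_{\rm cut}}$. Assume that ${\rm span}\,\mathcal R_\ell=\mathbb R^d$ for all $\ell\in\Lambda$, and that the graphs with vertices $\Lambda$ and edges $(\ell,\ell+\rho)$, $\rho\in\mathcal R_\ell$, and with vertices $\Lambda^{\rm hom}$ and edges $(\ell,\ell+\rho)$, $\rho\in\mathcal R$, are connected. For a displacement $u$ let $Du(\ell)=(u(\ell+\rho)-u(\ell))_{\rho\in\mathcal R_\ell}$ and, on $\Lambda^{\rm hom}$, $D^{\rm h}u(\ell)=(u(\ell+\rho)-u(\ell))_{\rho\in\mathcal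 R}$, with Euclidean norms and inner products of these vectors. Let $\dot{\mathcal W}^{1,2}$ be the space of all $u:\Lambda\to\mathbb R^m$ with $\|Du\|_{\ell^2(\Lambda)}<\infty$, and $\dot{\mathcal W}^{1,2}(\Lambda^{\rm hom})$ its analogue on $\Lambda^{\rm hom}$ with $D^{\rm h}$. Let $V_\ell\in C^4((\mathbb R^m)^{\mathcal R_\ell})$ with $V_\ell(0)=0$, and let $V:(\mathbb R^m)^{\mathcal R}\to\mathbb R$ be such that $V_\ell=V$ whenever $|\ell|>r_{\rm cut}+R_{\rm def}$ and $V(g)=V((-g_{-\rho})_{\rho\in\mathcal R})$ for all $g$. For $u,v,w\in\dot{\mathcal W}^{1,2}$ put $$\langle\delta^2\mathcal E(u)v,w\rangle=\sum_{\ell\in\Lambda}\nabla^2V_\ell(Du(\ell))[Dv(\ell),Dw(\ell)].$$ Assume phonon stability: for some $c_0>0$, $$\sum_{\ell\in\Lambda^{\rm hom}}\nabla^2V(0)[D^{\rm h}v(\ell),D^{\rm h}v(\ell)]\ge c_0\|D^{\rm h}v\|^2_{\ell^2(\Lambda^{\rm hom})}\qquad\forall v\in\dot{\mathcal W}^{1,2}(\Lambda^{\rm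 hom}).$$ **Supercells.** Let ${\sf B}\in\mathbb R^{d\times d}$ be invertible with columns in ${\sf A}\mathbb Z^d$. For $N\in\mathbb N$ let $Q_N={\sf B}(-N,N]^d$, and $Q_r=Q_{\lceil r\rceil}$ for real $r$; $\Lambda_r=\Lambda\cap Q_r$; $\Lambda_N^{\rm per}=\bigcup_{\alpha\in2N\mathbb Z^d}({\sf B}\alpha+\Lambda_N)$; and let $\mathcal W^{\rm per}_N$ be the space of all $u:\Lambda_N^{\rm per}\to\mathbb R^m$ with $u(\ell+{\sf B}\alpha)=u(\ell)$ for $\alpha\in2N\mathbb Z^d$. For $u\in\mathcal W_N^{\rm per}$ (and $N$ large) let $\mathcal E_N(u)=\sum_{\ell\in\Lambda_N}V_\ell(Du(\ell))$, with second variation $\langle\delta^2\mathcal E_N(u)v,w\rangle=\sum_{\ell\in\Lambda_N}\nabla^2V_\ell(Du(\ell))[Dv(\ell),Dw(\ell)]$; the norm on $\mathcal W_N^{\rm per}$ is $\|Dv\|_{\ell^2(\Lambda_N)}$. Fix cut-off functions $\eta_N\in C^2(\mathbb R^d;[0,1])$, for all large $N$, with $\eta_N=1$ on $Q_{4N/6}$,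 $\eta_N=0$ outside $Q_{5N/6}$ and $|\nabla^j\eta_N|\le KN^{-j}$ ($j=1,2$, $K$ independent of $N$). For $u:\Lambda\to\mathbb R^m$ let $T_N^{\rm per}u\in\mathcal W_N^{\rm per}$ be the periodic extension of $\eta_N(u-\langle u\rangle_{A_N})|_{\Lambda_N}$, where $\langle u\rangle_{A_N}$ is the average of $u$ over $A_N=\Lambda_{5N/6+r_{\rm cut}}\setminus\Lambda_{4N/6-r_{\rm cut}}$. **Splitting constants.** For $u\in\dot{\mathcal W}^{1,2}$, call $c_1>0$ a *splitting constant* of $\delta^2\mathcal E(u)$ if the quotient of $\dot{\mathcal W}^{1,2}$ by the constant functions, with inner product $(Dv,Dw)_{\ell^2(\Lambda)}$, has an orthogonal decomposition $W_-\oplus W_+$ with $\dim W_-<\infty$ and $\pm\langle\delta^2\mathcal E(u)v,v\rangle\ge c_1\|Dv\|_{\ell^2}^2$ for all $v\in W_\pm$. **Lemma.** Let $u\in\dot{\mathcal W}^{1,2}$ be inf-sup stable, i.e. $$\inf_{v\in\dot{\mathcal W}^{1,2},\,\|Dv\|_{\ell^2}=1}\ \sup_{w\in\dot{\mathcal W}^{1,2},\,\|Dw\|_{\ell^2}=1}\langle\delta^2\mathcal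 E(u)v,w\rangle>0 .$$ Then $\delta^2\mathcal E(u)$ has a splitting constant, and for every splitting constant $c_1$ of $\delta^2\mathcal E(u)$ there is $N_0$ such that for all $N\ge N_0$ $$\inf_{v\in\mathcal W_N^{\rm per},\,\|Dv\|_{\ell^2(\Lambda_N)}=1}\ \sup_{w\in\mathcal W_N^{\rm per},\,\|Dw\|_{\ell^2(\Lambda_N)}=1}\langle\delta^2\mathcal E_N(T_N^{\rm per}u)v,w\rangle\ \ge\ \min(c_0/8,\,c_1/4).$$ -/

import Mathlib

open scoped Matrix

noncomputable section

namespace PointDefect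

/-- Physical space `ℝ^d` and range space `ℝ^m`, both with the Euclidean norm. -/
abbrev Eu (n : ℕ) : Type := EuclideanSpace ℝ (Fin n)

/-- The product `M y` of a square matrix and a vector. -/
def mulE {d : ℕ} (M : Matrix (Fin d) (Fin d) ℝ) (y : Fin d → ℝ) : Eu d :=
  WithLp.toLp 2 (M *ᵥ y)

/-- The lattice `A ℤ^d`. -/
def latticePts {d : ℕ} (A : Matrix (Fin d) (Fin d) ℝ) : Set (Eu d) :=
  Set.range fun z : Fin d → ℤ => mulE A fun i => (z i : ℝ)

/-- The interaction range `{n - x | n ∈ S} ∩ B_r` at the point `x`. -/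
def interactionRange {d : ℕ} (S : Set (Eu d)) (r : ℝ) (x : Eu d) : Set (Eu d) :=
  {ρ | ∃ n ∈ S, ρ = n - x} ∩ Metric.ball 0 r

/-- The graph with vertex set `S` and edges `(x, x + ρ)`, `ρ` in the interaction range at `x`. -/
def interactionGraph {d : ℕ} (S : Set (Eu d)) (r : ℝ) : SimpleGraph S :=
  SimpleGraph.fromRel fun x y : S => (y : Eu d) - x ∈ interactionRange S r x

/-- The reference configuration of a point defect in a homogeneous host crystal, with an
interaction cutoff radius. -/
structure DefectLattice (d : ℕ) where
  /-- the set of sites -/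
  pts : Set (Eu d)
  /-- the matrix that generates the host lattice -/
  A : Matrix (Fin d) (Fin d) ℝ
  Rdef : ℝ
  rcut : ℝ
  det_ne_zero : A.det ≠ 0
  Rdef_pos : 0 < Rdef
  rcut_pos : 0 < rcut
  finite_core : (pts ∩ Metric.ball 0 Rdef).Finite
  pts_diff : pts \ Metric.ball 0 Rdef = latticePts A \ Metric.ball 0 Rdef
  span_range : ∀ x ∈ pts, Submodule.span ℝ (interactionRange pts rcut x) = ⊤
  connected : (interactionGraph pts rcut).Connected
  /-- the homogeneous lattice satisfies the connectivity condition too -/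
  connected_hom : (interactionGraph (latticePts A) rcut).Connected

theorem mulE_inj {d : ℕ} {M : Matrix (Fin d) (Fin d) ℝ} (hM : M.det ≠ 0) {y y' : Fin d → ℝ}
    (h : mulE M y = mulE M y') : y = y' := by
  have h2 : M *ᵥ y = M *ᵥ y' := by simpa [mulE] using h
  have hu : IsUnit M.det := isUnit_iff_ne_zero.mpr hM
  have h3 := congrArg (fun w => M⁻¹ *ᵥ w) h2
  simpa [Matrix.mulVec_mulVec, Matrix.nonsing_inv_mul M hu] using h3

theorem finite_latticePts_inter {d : ℕ} {A : Matrix (Fin d) (Fin d) ℝ} (hA : A.det ≠ 0)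
    {s : Set (Eu d)} (hs : Bornology.IsBounded s) : (latticePts A ∩ s).Finite := by
  have hu : IsUnit A.det := isUnit_iff_ne_zero.mpr hA
  have hcont : Continuous fun x : Eu d => A⁻¹ *ᵥ (WithLp.ofLp x) := by fun_prop
  obtain ⟨K, hK⟩ : ∃ K : ℝ, ∀ x ∈ s, ‖A⁻¹ *ᵥ (WithLp.ofLp x)‖ ≤ K := by
    have hc : IsCompact (closure s) := hs.isCompact_closure
    obtain ⟨K, hK⟩ := hc.exists_bound_of_continuousOn hcont.continuousOn
    exact ⟨K, fun x hx => hK x (subset_closure hx)⟩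
  refine ((Set.finite_Icc (fun _ : Fin d => -⌈K⌉) (fun _ => ⌈K⌉)).image
    (fun z : Fin d → ℤ => mulE A fun i => (z i : ℝ))).subset ?_
  rintro x ⟨⟨z, rfl⟩, hx⟩
  refine ⟨z, ?_, rfl⟩
  have h1 : ∀ i, |(z i : ℝ)| ≤ K := by
    intro i
    have h2 := hK _ hx
    simp only [mulE, Matrix.mulVec_mulVec, Matrix.nonsing_inv_mul A hu, Matrix.one_mulVec] at h2
    exact (norm_le_pi_norm (fun i => (z i : ℝ)) i).trans h2
  constructor <;> intro i
  · have h3 := (abs_le.mp (h1 i)).1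
    have h4 : -(⌈K⌉ : ℝ) ≤ (z i : ℝ) := by linarith [Int.le_ceil K]
    exact_mod_cast h4
  · have h3 := (abs_le.mp (h1 i)).2
    have h4 : (z i : ℝ) ≤ (⌈K⌉ : ℝ) := by linarith [Int.le_ceil K]
    exact_mod_cast h4

namespace DefectLattice

variable {d : ℕ} (L : DefectLattice d)

theorem finite_inter {s : Set (Eu d)} (hs : Bornology.IsBounded s) : (L.pts ∩ s).Finite := by
  refine (L.finite_core.union (finite_latticePts_inter L.det_ne_zero hs)).subset ?_
  rintro x ⟨hx, hxs⟩
  by_cases hb : x ∈ Metric.ball (0 : Eu d) L.Rdef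
  · exact Or.inl ⟨hx, hb⟩
  · have h : x ∈ latticePts L.A \ Metric.ball 0 L.Rdef := L.pts_diff ▸ ⟨hx, hb⟩
    exact Or.inr ⟨h.1, hxs⟩

end DefectLattice

theorem finite_interactionRange {d : ℕ} {S : Set (Eu d)}
    (hS : ∀ s : Set (Eu d), Bornology.IsBounded s → (S ∩ s).Finite) (r : ℝ) (x : Eu d) :
    (interactionRange S r x).Finite := by
  refine ((hS (Metric.ball x r) Metric.isBounded_ball).image (fun n => n - x)).subset ?_
  rintro ρ ⟨⟨n, hn, rfl⟩, hb⟩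
  refine ⟨n, ⟨hn, ?_⟩, rfl⟩
  simpa [dist_eq_norm] using hb

namespace DefectLattice

variable {d : ℕ} (L : DefectLattice d)

/-- The homogeneous background lattice. -/
abbrev hom : Set (Eu d) := latticePts L.A

/-- The interaction range at a site of the defective lattice, as a finite set. -/
def range (x : Eu d) : Finset (Eu d) :=
  (finite_interactionRange (fun _ hs => L.finite_inter hs) L.rcut x).toFinset

/-- The interaction range of the homogeneous lattice (the same at each site), as a finite set. -/
def rangeHom : Finset (Eu d) :=
  (finite_interactionRange (fun _ hs => finite_latticePts_inter L.det_ne_zero hs)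
    L.rcut 0).toFinset

end DefectLattice

/-- The finite difference stencil `(u(x + ρ) - u(x))_{ρ ∈ R}` of a function on the set `S`. In all
uses below `x + ρ` belongs to `S` (on periodic supercells: as soon as the cell is large), so that
the value `0` in the other case plays no role. -/
def stencil {d m : ℕ} (S : Set (Eu d)) (u : S → Eu m) (x : S) (R : Finset (Eu d)) : R → Eu m := by
  classical
  exact fun ρ => if h : (x : Eu d) + ρ ∈ S then u ⟨(x : Eu d) + ρ, h⟩ - u x else 0

theorem stencil_add {d m : ℕ} (S : Set (Eu d)) (u v : S → Eu m) (x : S) (R : Finset (Eu d)) :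
    stencil S (u + v) x R = stencil S u x R + stencil S v x R := by
  funext ρ
  by_cases h : (x : Eu d) + ρ ∈ S
  · simp [stencil, h]; abel
  · simp [stencil, h]

theorem stencil_smul {d m : ℕ} (S : Set (Eu d)) (c : ℝ) (u : S → Eu m) (x : S)
    (R : Finset (Eu d)) : stencil S (c • u) x R = c • stencil S u x R := by
  funext ρ
  by_cases h : (x : Eu d) + ρ ∈ S
  · simp [stencil, h, smul_sub]
  · simp [stencil, h]

/-- The Euclidean inner product on `(ℝ^m)^R`. -/
def dot {d m : ℕ} {R : Finset (Eu d)} (g h : R → Eu m) : ℝ := ∑ ρ, inner ℝ (g ρ) (h ρ)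

/-- The squared Euclidean norm on `(ℝ^m)^R`. -/
def normSq {d m : ℕ} {R : Finset (Eu d)} (g : R → Eu m) : ℝ := ∑ ρ, ‖g ρ‖ ^ 2

/-- The second derivative `∇²V(g)[h, k]`. -/
def hessian {d m : ℕ} {R : Finset (Eu d)} (V : (R → Eu m) → ℝ) (g h k : R → Eu m) : ℝ :=
  fderiv ℝ (fderiv ℝ V) g h k

/-- The space `𝒲^{1,2}(S)` of functions on `S` with square-summable finite differences, where
`R x` is the interaction range at `x`. -/
def W12 {d : ℕ} (m : ℕ) (S : Set (Eu d)) (R : S → Finset (Eu d)) : Submodule ℝ (S → Eu m) where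
  carrier := {u | Summable fun x => normSq (stencil S u x (R x))}
  zero_mem' := by
    have h : ∀ x, normSq (stencil S (0 : S → Eu m) x (R x)) = 0 := by
      intro x; simp [normSq, stencil]
    simp only [Set.mem_ofPred_eq, h]
    exact summable_zero
  add_mem' := by
    intro u v hu hv
    refine Summable.of_nonneg_of_le (fun x => Finset.sum_nonneg fun _ _ => sq_nonneg _) (fun x => ?_)
      ((hu.add hv).mul_left 2)
    simp only [normSq, stencil_add, ← Finset.sum_add_distrib, Finset.mul_sum]
    refine Finset.sum_le_sum fun ρ _ => ?_
    have h1 := norm_add_le (stencil S u x (R x) ρ) (stencil S v x (R x) ρ)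
    have h2 : ‖(stencil S u x (R x) + stencil S v x (R x)) ρ‖ ^ 2 ≤
        (‖stencil S u x (R x) ρ‖ + ‖stencil S v x (R x) ρ‖) ^ 2 :=
      pow_le_pow_left₀ (norm_nonneg _) h1 2
    nlinarith [sq_nonneg (‖stencil S u x (R x) ρ‖ - ‖stencil S v x (R x) ρ‖)]
  smul_mem' := by
    intro c u hu
    have h : ∀ x, normSq (stencil S (c • u) x (R x)) = c ^ 2 * normSq (stencil S u x (R x)) := by
      intro x
      simp [normSq, stencil_smul, norm_smul, mul_pow, Finset.mul_sum]
    simp only [Set.mem_ofPred_eq, h]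
    exact hu.mul_left _

/-- The interaction: site energies `V_ℓ` on the defective lattice and the homogeneous site energy
`V`. Stencils are written as restrictions of functions on `ℝ^d`, since the index sets of `V_ℓ` and
`V`, equal far from the defect, are different types. -/
structure SiteEnergies {d : ℕ} (L : DefectLattice d) (m : ℕ) where
  V : ∀ x : L.pts, (L.range x → Eu m) → ℝ
  Vhom : (L.rangeHom → Eu m) → ℝ
  contDiff : ∀ x, ContDiff ℝ 4 (V x)
  V_zero : ∀ x, V x 0 = 0
  /-- `V_ℓ = V` away from the defect -/
  homogeneous : ∀ x : L.pts, L.rcut + L.Rdef < ‖(x : Eu d)‖ → ∀ g : Eu d → Eu m,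
    V x (fun ρ => g ρ) = Vhom fun ρ => g ρ
  /-- `V(A) = V((-A_{-ρ})_ρ)` -/
  point_symmetric : ∀ g : Eu d → Eu m, Vhom (fun ρ => g ρ) = Vhom fun ρ => -g (-(ρ : Eu d))

section Infinite

variable {d m : ℕ} {L : DefectLattice d}

/-- The space of finite-energy displacements of the defective lattice. -/
abbrev W12def (L : DefectLattice d) (m : ℕ) : Submodule ℝ (L.pts → Eu m) :=
  W12 m L.pts fun x => L.range x

/-- The space of finite-energy displacements of the homogeneous lattice. -/
abbrev W12hom (L : DefectLattice d) (m : ℕ) : Submodule ℝ (L.hom → Eu m) :=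
  W12 m L.hom fun _ => L.rangeHom

/-- `Du(ℓ)` for a displacement of the defective lattice. -/
def grad (u : L.pts → Eu m) (x : L.pts) : L.range x → Eu m := stencil L.pts u x (L.range x)

/-- `Dʰu(ℓ)` for a displacement of the homogeneous lattice. -/
def gradHom (u : L.hom → Eu m) (x : L.hom) : L.rangeHom → Eu m := stencil L.hom u x L.rangeHom

/-- `‖Du‖_{ℓ²(Λ)}`. -/
def energyNorm (u : L.pts → Eu m) : ℝ := Real.sqrt (∑' x : L.pts, normSq (grad u x))

/-- `(Dv, Dw)_{ℓ²(Λ)}`. -/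
def energyInner (v w : L.pts → Eu m) : ℝ := ∑' x : L.pts, dot (grad v x) (grad w x)

/-- `⟨δ²ℰ(u) v, w⟩ = ∑_ℓ ∇²V_ℓ(Du(ℓ))[Dv(ℓ), Dw(ℓ)]`. -/
def hess (P : SiteEnergies L m) (u v w : L.pts → Eu m) : ℝ :=
  ∑' x : L.pts, hessian (P.V x) (grad u x) (grad v x) (grad w x)

/-- Phonon stability of the homogeneous lattice with constant `c₀`. -/
def PhononStable (P : SiteEnergies L m) (c₀ : ℝ) : Prop :=
  ∀ v ∈ W12hom L m, c₀ * ∑' x : L.hom, normSq (gradHom v x) ≤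
    ∑' x : L.hom, hessian P.Vhom 0 (gradHom v x) (gradHom v x)

/-- Inf-sup stability: `inf_v sup_w ⟨δ²ℰ(u) v, w⟩ > 0` over `v, w ∈ 𝒲^{1,2}` with
`‖Dv‖ = ‖Dw‖ = 1`. -/
def InfSupStable (P : SiteEnergies L m) (u : L.pts → Eu m) : Prop :=
  (0 : EReal) < ⨅ v : {v : W12def L m // energyNorm v.1 = 1},
    ⨆ w : {w : W12def L m // energyNorm w.1 = 1}, ((hess P u v.1 w.1 : ℝ) : EReal)

/-- The constant displacements, as a subspace of `𝒲^{1,2}(Λ)`. -/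
def constants (L : DefectLattice d) (m : ℕ) : Submodule ℝ (W12def L m) where
  carrier := {v | ∃ a : Eu m, ∀ x, v.1 x = a}
  zero_mem' := ⟨0, fun _ => rfl⟩
  add_mem' := by
    rintro v w ⟨a, ha⟩ ⟨b, hb⟩
    exact ⟨a + b, fun x => by simp [ha, hb]⟩
  smul_mem' := by
    rintro c v ⟨a, ha⟩
    exact ⟨c • a, fun x => by simp [ha]⟩

/-- `c₁` is a splitting constant of `δ²ℰ(u)`: the quotient of `𝒲^{1,2}` by the constants is the
orthogonal direct sum of a finite-dimensional `W₋` and of `W₊`, with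
`±⟨δ²ℰ(u) v, v⟩ ≥ c₁ ‖Dv‖²` on `W_±`. The subspaces of the quotient are represented by their
preimages in `𝒲^{1,2}`; as the constants are finite-dimensional, `W₋` is finite-dimensional in the
quotient if and only if its preimage is. -/
def IsSplittingConstant (P : SiteEnergies L m) (u : L.pts → Eu m) (c₁ : ℝ) : Prop :=
  0 < c₁ ∧ ∃ Wneg Wpos : Submodule ℝ (W12def L m),
    Wneg ⊓ Wpos = constants L m ∧ Wneg ⊔ Wpos = ⊤ ∧
    FiniteDimensional ℝ Wneg ∧
    (∀ v ∈ Wneg, ∀ w ∈ Wpos, energyInner v.1 w.1 = 0) ∧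
    (∀ v ∈ Wneg, c₁ * energyNorm v.1 ^ 2 ≤ -hess P u v.1 v.1) ∧
    (∀ v ∈ Wpos, c₁ * energyNorm v.1 ^ 2 ≤ hess P u v.1 v.1)

end Infinite

/-- A periodic cell shape: an invertible matrix whose columns are vectors of the host lattice. -/
structure Supercell {d : ℕ} (L : DefectLattice d) where
  B : Matrix (Fin d) (Fin d) ℝ
  det_ne_zero : B.det ≠ 0
  col_mem : ∀ j, (WithLp.toLp 2 (fun i => B i j) : Eu d) ∈ L.hom

section Periodic

variable {d m : ℕ} {L : DefectLattice d} (C : Supercell L)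

/-- The cell `Q_n = B (-n, n]^d`. -/
def cell (n : ℕ) : Set (Eu d) := mulE C.B '' {y | ∀ i, y i ∈ Set.Ioc (-(n : ℝ)) n}

/-- `Q_r = Q_⌈r⌉` for real `r`. -/
def cellR (r : ℝ) : Set (Eu d) := cell C ⌈r⌉₊

theorem isBounded_cell (n : ℕ) : Bornology.IsBounded (cell C n) := by
  have hc : IsCompact (mulE C.B '' Set.Icc (fun _ : Fin d => -(n : ℝ)) fun _ => (n : ℝ)) := by
    refine isCompact_Icc.image ?_
    unfold mulE
    fun_prop
  refine hc.isBounded.subset (Set.image_mono ?_)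
  intro y hy
  exact ⟨fun i => (hy i).1.le, fun i => (hy i).2⟩

/-- `Λ_N = Λ ∩ Q_N`, as a finite set. -/
def cellPts (N : ℕ) : Finset (Eu d) := (L.finite_inter (isBounded_cell C N)).toFinset

theorem mem_cellPts {N : ℕ} {x : Eu d} : x ∈ cellPts C N ↔ x ∈ L.pts ∧ x ∈ cell C N := by
  simp [cellPts]

/-- The vector `B α` with `α = 2 N z ∈ 2 N ℤ^d`. -/
def shift (N : ℕ) (z : Fin d → ℤ) : Eu d := mulE C.B fun i => 2 * (N : ℝ) * (z i : ℝ)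

/-- The periodic lattice `⋃_{α ∈ 2 N ℤ^d} (B α + Λ_N)`. -/
def perPts (N : ℕ) : Set (Eu d) := {x | ∃ y ∈ cellPts C N, ∃ z, x = shift C N z + y}

/-- The space of periodic displacements. -/
def Wper (m N : ℕ) : Submodule ℝ (perPts C N → Eu m) where
  carrier := {u | ∀ (x y : perPts C N) (z : Fin d → ℤ), (y : Eu d) = x + shift C N z → u y = u x}
  zero_mem' := fun _ _ _ _ => rfl
  add_mem' := by
    intro u v hu hv x y z h
    simp [hu x y z h, hv x y z h]
  smul_mem' := by
    intro c u hu x y z h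
    simp [hu x y z h]

theorem shift_add (N : ℕ) (z z' : Fin d → ℤ) :
    shift C N (z + z') = shift C N z + shift C N z' := by
  simp only [shift, mulE]
  rw [← WithLp.toLp_add, ← Matrix.mulVec_add]
  congr 2
  funext i
  simp [mul_add]

theorem cell_unique {N : ℕ} {x y : Eu d} {z : Fin d → ℤ} (hx : x ∈ cell C N) (hy : y ∈ cell C N)
    (h : y = x + shift C N z) : y = x := by
  obtain ⟨a, ha, rfl⟩ := hx
  obtain ⟨b, hb, rfl⟩ := hy
  have h1 : b = fun i => a i + 2 * (N : ℝ) * (z i : ℝ) := by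
    refine mulE_inj C.det_ne_zero ?_
    rw [h]
    simp only [shift, mulE]
    rw [← WithLp.toLp_add, ← Matrix.mulVec_add]
    rfl
  have h2 : b = a := by
    funext i
    have h3 := congrFun h1 i
    obtain ⟨a1, a2⟩ := ha i
    obtain ⟨b1, b2⟩ := hb i
    have hN : (0 : ℝ) < N := by linarith
    have hz1 : (z i : ℝ) < 1 := by
      by_contra hcon
      have : (1 : ℝ) ≤ z i := not_lt.mp hcon
      nlinarith
    have hz2 : (-1 : ℝ) < z i := by
      by_contra hcon
      have : (z i : ℝ) ≤ -1 := not_lt.mp hcon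
      nlinarith
    have hz : z i = 0 := by
      have e1 : z i < 1 := by exact_mod_cast hz1
      have e2 : -1 < z i := by exact_mod_cast hz2
      omega
    simp [h3, hz]
  rw [h2]

/-- The site of `Λ_N` that is equivalent to a given site of the periodic lattice. -/
def cellRep {N : ℕ} (x : perPts C N) : L.pts :=
  ⟨x.2.choose, ((mem_cellPts C).mp x.2.choose_spec.1).1⟩

theorem cellRep_periodic {N : ℕ} (x y : perPts C N) (z : Fin d → ℤ)
    (h : (y : Eu d) = x + shift C N z) : cellRep C y = cellRep C x := by
  obtain ⟨a, ha⟩ := x.2.choose_spec.2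
  obtain ⟨b, hb⟩ := y.2.choose_spec.2
  refine Subtype.ext ?_
  refine cell_unique C (z := a + z - b) ((mem_cellPts C).mp x.2.choose_spec.1).2
    ((mem_cellPts C).mp y.2.choose_spec.1).2 ?_
  have e : shift C N (a + z - b) + shift C N b = shift C N a + shift C N z := by
    rw [← shift_add, ← shift_add]; congr 1; abel
  have e1 : y.2.choose = shift C N a + shift C N z - shift C N b + x.2.choose := by
    have e2 : shift C N b + y.2.choose = shift C N a + x.2.choose + shift C N z := by
      rw [← hb, ← ha, h]
    rw [eq_sub_of_add_eq' e2]; abel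
  show y.2.choose = x.2.choose + shift C N (a + z - b)
  rw [e1, ← e]; abel

/-- A family of cut-off functions `η_R`, for large `R`, with values in `[0, 1]`, equal to `1` on
`Q_{4R/6}` and to `0` outside `Q_{5R/6}`, and with `|∇^j η_R| ≤ K R^{-j}` for `j = 1, 2`. -/
def IsCutoffFamily (η : ℕ → Eu d → ℝ) : Prop :=
  ∃ (K : ℝ) (R₀ : ℕ), ∀ R ≥ R₀,
    ContDiff ℝ 2 (η R) ∧ (∀ x, η R x ∈ Set.Icc (0 : ℝ) 1) ∧
    (∀ x ∈ cellR C (4 * (R : ℝ) / 6), η R x = 1) ∧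
    (∀ x, x ∉ cellR C (5 * (R : ℝ) / 6) → η R x = 0) ∧
    (∀ j ∈ ({1, 2} : Set ℕ), ∀ x, ‖iteratedFDeriv ℝ j (η R) x‖ ≤ K * ((R : ℝ) ^ j)⁻¹)

theorem finite_annulus (N : ℕ) :
    (L.pts ∩ (cellR C (5 * (N : ℝ) / 6 + L.rcut) \ cellR C (4 * (N : ℝ) / 6 - L.rcut))).Finite :=
  L.finite_inter ((isBounded_cell C _).subset Set.sdiff_subset)

/-- The lattice annulus `A_N = Λ_{5N/6 + r_cut} \ Λ_{4N/6 - r_cut}`. -/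
def annulus (N : ℕ) : Finset (Eu d) := (finite_annulus C N).toFinset

/-- The average of `u` over the annulus `A_N`. -/
def annulusMean (N : ℕ) (u : L.pts → Eu m) : Eu m :=
  ((annulus C N).card : ℝ)⁻¹ •
    ∑ x : annulus C N, u ⟨x, ((finite_annulus C N).mem_toFinset.mp x.2).1⟩

/-- The truncation `T_N u`. -/
def trunc (η : ℕ → Eu d → ℝ) (N : ℕ) (u : L.pts → Eu m) : L.pts → Eu m := by
  classical
  exact fun x => if (x : Eu d) ∈ cellPts C N then η N x • (u x - annulusMean C N u) else 0

/-- The periodic truncation `T_N^per u`: the periodic extension of `T_N u` from `Λ_N`. -/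
def perTrunc (η : ℕ → Eu d → ℝ) (N : ℕ) (u : L.pts → Eu m) : Wper C m N :=
  ⟨fun x => trunc C η N u (cellRep C x), fun x y z h =>
    congrArg (trunc C η N u) (cellRep_periodic C x y z h)⟩

theorem cellPts_subset_perPts {N : ℕ} (x : cellPts C N) : (x : Eu d) ∈ perPts C N :=
  ⟨x, x.2, 0, by simp [shift, mulE, funext_iff, Matrix.mulVec, dotProduct]⟩

/-- A site of `Λ_N` as a site of `Λ`. -/
def toSite {N : ℕ} (x : cellPts C N) : L.pts := ⟨x, ((mem_cellPts C).mp x.2).1⟩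

/-- `Du(ℓ)` for a displacement `u` of the periodic lattice and `ℓ ∈ Λ_N`. -/
def gradPer {N : ℕ} (u : perPts C N → Eu m) (x : cellPts C N) : L.range (toSite C x) → Eu m :=
  stencil (perPts C N) u ⟨x, cellPts_subset_perPts C x⟩ (L.range (toSite C x))

/-- `‖Du‖_{ℓ²(Λ_N)}`. -/
def energyNormPer {N : ℕ} (u : perPts C N → Eu m) : ℝ :=
  Real.sqrt (∑ x : cellPts C N, normSq (gradPer C u x))

/-- The supercell energy `ℰ_N(u) = ∑_{ℓ ∈ Λ_N} V_ℓ(Du(ℓ))`. -/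
def energyPer (P : SiteEnergies L m) {N : ℕ} (u : perPts C N → Eu m) : ℝ :=
  ∑ x : cellPts C N, P.V (toSite C x) (gradPer C u x)

/-- `⟨δ²ℰ_N(u) v, w⟩ = ∑_{ℓ ∈ Λ_N} ∇²V_ℓ(Du(ℓ))[Dv(ℓ), Dw(ℓ)]`. -/
def hessPer (P : SiteEnergies L m) {N : ℕ} (u v w : perPts C N → Eu m) : ℝ :=
  ∑ x : cellPts C N, hessian (P.V (toSite C x)) (gradPer C u x) (gradPer C v x) (gradPer C w x)

/-- `hessPer` is the second derivative of `energyPer`. -/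
theorem hessPer_eq_deriv (P : SiteEnergies L m) {N : ℕ} (u v w : perPts C N → Eu m) :
    hessPer C P u v w =
      deriv (fun s : ℝ => deriv (fun t : ℝ => energyPer C P (u + s • v + t • w)) 0) 0 := by
  have hg : ∀ (x : cellPts C N) (s t : ℝ), gradPer C (u + s • v + t • w) x =
      gradPer C u x + s • gradPer C v x + t • gradPer C w x := by
    intro x s t
    simp only [gradPer, stencil_add, stencil_smul]
  have hin : ∀ s : ℝ, deriv (fun t : ℝ => energyPer C P (u + s • v + t • w)) 0 =
      ∑ x : cellPts C N, fderiv ℝ (P.V (toSite C x)) (gradPer C u x + s • gradPer C v x)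
        (gradPer C w x) := by
    intro s
    simp only [energyPer, hg]
    refine HasDerivAt.deriv (HasDerivAt.fun_sum fun x _ => ?_)
    have hd : HasFDerivAt (P.V (toSite C x))
        (fderiv ℝ (P.V (toSite C x)) (gradPer C u x + s • gradPer C v x))
        (gradPer C u x + s • gradPer C v x + (0 : ℝ) • gradPer C w x) := by
      simpa using ((P.contDiff (toSite C x)).differentiable (by norm_num) _).hasFDerivAt
    have hl : HasDerivAt (fun t : ℝ => gradPer C u x + s • gradPer C v x + t • gradPer C w x)
        (gradPer C w x) 0 := by
      simpa using ((hasDerivAt_id (0 : ℝ)).smul_const (gradPer C w x)).const_add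
        (gradPer C u x + s • gradPer C v x)
    exact hd.comp_hasDerivAt (0 : ℝ) hl
  simp only [hin, hessPer, hessian]
  symm
  refine HasDerivAt.deriv (HasDerivAt.fun_sum fun x _ => ?_)
  have hc : ContDiff ℝ 3 (fderiv ℝ (P.V (toSite C x))) :=
    (P.contDiff (toSite C x)).fderiv_right (by norm_num)
  have hd : HasFDerivAt (fderiv ℝ (P.V (toSite C x)))
      (fderiv ℝ (fderiv ℝ (P.V (toSite C x))) (gradPer C u x))
      (gradPer C u x + (0 : ℝ) • gradPer C v x) := by
    simpa using (hc.differentiable (by norm_num) _).hasFDerivAt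
  have hl : HasDerivAt (fun s : ℝ => gradPer C u x + s • gradPer C v x) (gradPer C v x) 0 := by
    simpa using ((hasDerivAt_id (0 : ℝ)).smul_const (gradPer C v x)).const_add (gradPer C u x)
  exact ((ContinuousLinearMap.apply ℝ ℝ (gradPer C w x)).hasFDerivAt).comp_hasDerivAt (0 : ℝ)
    (hd.comp_hasDerivAt (0 : ℝ) hl)

end Periodic

end PointDefect

end

/-!
Finite-energy displacements modulo constants are identified with their gradients, which form a
closed subspace `S` (`isClosed_range_gradMap`) of the Hilbert space `X` of square-summable families
of finite-difference stencils. Gradients of supercell displacements, restricted to `Λ_N` and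
extended by zero, form subspaces `X_N` of the same space `X`, and the second variation at `u` is a
bounded symmetric form `B` on all of `X`. The theorem thus becomes a statement about one form `B` on
`X`, the subspace `S` and the approximating subspaces `X_N`. Three facts about them carry the proof.

* Approximation. Gradients of compactly supported displacements lie in `X_N` for large `N`
  (`eventually_mem_range_perGradMap`) and are dense in `S` (`dense_compactSupp`). The density rests
  on a discrete Poincaré inequality; it also shows that finite-energy displacements grow
  sublinearly (`exists_sublinear_growth`).
* Consistency. A weak limit of elements of `X_N` belongs to `S` (`mem_range_of_weak_limit`), because
  being a gradient is a condition on finitely many sites at a time and the interaction graph is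
  connected.
* Coercivity up to finite rank. On `X_N`, the form `B` is bounded below by `(c₀ - ε) ‖·‖²` minus a
  finite-rank form, uniformly in `N` (`eventually_coercive_up_to_finite`). Far from the defect `B`
  has the site energies of the host lattice at almost zero strain. Phonon stability passes with the
  same constant from square-summable to periodic displacements (`excess_sum_nonneg_of_periodic`),
  and redefining a displacement in the core costs only finitely many differences. By density the
  same inequality holds on `S`.

An inf-sup stable form on `S` that is coercive up to finite rank has a finite-dimensional negative
spectral subspace and is positive definite on its complement (`exists_splitting`): this is the
existence of a splitting constant. Conversely, let a splitting with constant `c₁` be given, and let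
`Y ⊆ X_N` approximate its negative part. If `B` were not bounded below by `min c₀ c₁ / 2` on
`X_N ∩ Yᗮ` for large `N`, normalized counterexamples would have a weak limit `q ∈ S` orthogonal to
`Y`. Splitting off `q`, coercivity up to finite rank applies to the remainder, which converges
weakly to zero, and `B q q` is bounded below by the positive part of the splitting; this is a
contradiction. Flipping the sign of the component in `Y` gives the test displacement for the inf-sup
condition (`eventually_infSup`).

Finally `B` differs from the supercell second variation at the truncation of `u` by a form of small
norm (`IsHessForm.eventually_abs_hessPer_sub_le`), since `η_N` has slope `O(1/N)` while `u` varies by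
`o(N)` on `Q_N`.
-/

noncomputable section

namespace PointDefect

open Filter Topology

/-! ### Bounded symmetric forms on a Hilbert space -/

section Hilbert

variable {X : Type*} [NormedAddCommGroup X] [InnerProductSpace ℝ X]

/-- Weak compactness of balls, with limits along an ultrafilter. -/
theorem exists_weak_limit [CompleteSpace X] {ι : Type*} (U : Ultrafilter ι) (g : ι → X) (K : ℝ)
    (hg : ∀ᶠ i in (U : Filter ι), ‖g i‖ ≤ K) :
    ∃ q : X, ∀ l : X →L[ℝ] ℝ, Tendsto (fun i => l (g i)) U (𝓝 (l q)) := by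
  have hlim : ∀ h : X, ∃ t ∈ Set.Icc (-(K * ‖h‖)) (K * ‖h‖),
      Tendsto (fun i => inner ℝ (g i) h) U (𝓝 t) := by
    intro h
    have hmem : ∀ᶠ i in (U : Filter ι), inner ℝ (g i) h ∈ Set.Icc (-(K * ‖h‖)) (K * ‖h‖) := by
      filter_upwards [hg] with i hi
      have h1 := abs_real_inner_le_norm (g i) h
      have h2 : ‖g i‖ * ‖h‖ ≤ K * ‖h‖ := mul_le_mul_of_nonneg_right hi (norm_nonneg _)
      exact abs_le.mp (h1.trans h2)
    obtain ⟨t, ht, hle⟩ := (isCompact_Icc (a := -(K * ‖h‖)) (b := K * ‖h‖)).ultrafilter_le_nhds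
      (U.map fun i => inner ℝ (g i) h) (le_principal_iff.mpr hmem)
    exact ⟨t, ht, hle⟩
  choose φ hφm hφ using hlim
  let f : X →ₗ[ℝ] ℝ :=
    { toFun := φ
      map_add' := fun a b => tendsto_nhds_unique (hφ (a + b))
        (by simpa only [inner_add_right] using (hφ a).add (hφ b))
      map_smul' := fun c a => tendsto_nhds_unique (hφ (c • a))
        (by simpa only [inner_smul_right, smul_eq_mul, RingHom.id_apply] using
          (hφ a).const_mul c) }
  let F : X →L[ℝ] ℝ := f.mkContinuous K fun h => by
    rw [Real.norm_eq_abs]; exact abs_le.mpr (hφm h)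
  refine ⟨(InnerProductSpace.toDual ℝ X).symm F, fun l => ?_⟩
  set y := (InnerProductSpace.toDual ℝ X).symm l with hy
  have e : ∀ z, l z = inner ℝ z y := by
    intro z
    rw [real_inner_comm, hy, InnerProductSpace.toDual_symm_apply]
  simp only [e]
  rw [InnerProductSpace.toDual_symm_apply]
  exact hφ y

/-- The Cauchy–Schwarz inequality for a symmetric form that is nonnegative on a subspace. -/
theorem sq_le_mul_of_nonneg (B : X →L[ℝ] X →L[ℝ] ℝ) (hB : ∀ v w, B v w = B w v)
    (S : Submodule ℝ X) (hS : ∀ v ∈ S, 0 ≤ B v v) {v w : X} (hv : v ∈ S) (hw : w ∈ S) :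
    B v w ^ 2 ≤ B v v * B w w := by
  have h : ∀ t : ℝ, 0 ≤ B w w * (t * t) + 2 * B v w * t + B v v := by
    intro t
    have h1 := hS _ (S.add_mem hv (S.smul_mem t hw))
    have h2 : B (v + t • w) (v + t • w) = B w w * (t * t) + 2 * B v w * t + B v v := by
      simp only [map_add, map_smul, add_apply, smul_apply,
        smul_eq_mul, hB w v]
      ring
    rwa [h2] at h1
  have h3 := discrim_le_zero h
  rw [discrim] at h3
  nlinarith

theorem abs_form_le (B : X →L[ℝ] X →L[ℝ] ℝ) (v w : X) : |B v w| ≤ ‖B‖ * ‖v‖ * ‖w‖ := by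
  simpa using B.le_opNorm₂ v w

/-- A symmetric form that is coercive up to finite rank and takes a negative value attains its
minimum on the unit sphere, at an eigenvector. -/
theorem exists_eigenvector_neg [CompleteSpace X] (B : X →L[ℝ] X →L[ℝ] ℝ)
    (hB : ∀ v w, B v w = B w v) {ι : Type*} [Fintype ι] (l : ι → X →L[ℝ] ℝ) {a : ℝ} (ha : 0 < a)
    (hG : ∀ v, a * ‖v‖ ^ 2 - ∑ i, l i v ^ 2 ≤ B v v) (hneg : ∃ v, B v v < 0) :
    ∃ (e : X) (μ : ℝ), μ < 0 ∧ ‖e‖ = 1 ∧ ∀ w, B e w = μ * inner ℝ e w := by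
  set A : Set ℝ := {t | ∃ v : X, ‖v‖ = 1 ∧ B v v = t} with hA
  have hscale : ∀ v : X, v ≠ 0 → ∃ t ∈ A, B v v = t * ‖v‖ ^ 2 := by
    intro v hv
    have hn : ‖v‖ ≠ 0 := norm_ne_zero_iff.mpr hv
    refine ⟨B (‖v‖⁻¹ • v) (‖v‖⁻¹ • v), ⟨‖v‖⁻¹ • v, ?_, rfl⟩, ?_⟩
    · rw [norm_smul, norm_inv, norm_norm, inv_mul_cancel₀ hn]
    · simp only [map_smul, smul_apply, smul_eq_mul]
      field_simp
  have hbdd : BddBelow A := by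
    refine ⟨-‖B‖, ?_⟩
    rintro t ⟨v, hv, rfl⟩
    have := abs_form_le B v v
    rw [hv] at this
    linarith [(abs_le.mp this).1]
  obtain ⟨v₀, hv₀⟩ := hneg
  have hv₀' : v₀ ≠ 0 := by rintro rfl; simp at hv₀
  obtain ⟨t₀, ht₀, ht₀'⟩ := hscale v₀ hv₀'
  have ht₀n : t₀ < 0 := by
    by_contra hcon
    have : 0 ≤ t₀ * ‖v₀‖ ^ 2 := mul_nonneg (not_lt.mp hcon) (sq_nonneg _)
    linarith
  set μ := sInf A with hμ
  have hμn : μ < 0 := (csInf_le hbdd ht₀).trans_lt ht₀n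
  -- the shifted form, nonnegative by the choice of `μ`
  set q : X →L[ℝ] X →L[ℝ] ℝ := B - μ • (innerₗ X).mkContinuous₂ 1
    (fun v w => by simpa using norm_inner_le_norm (𝕜 := ℝ) v w) with hq
  have hqa : ∀ v w, q v w = B v w - μ * inner ℝ v w := by
    intro v w; simp [hq]
  have hqs : ∀ v w, q v w = q w v := by
    intro v w; rw [hqa, hqa, hB v w, real_inner_comm]
  have hq0 : ∀ v, 0 ≤ q v v := by
    intro v
    by_cases hv : v = 0
    · simp [hv]
    · obtain ⟨t, ht, hte⟩ := hscale v hv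
      rw [hqa, hte, real_inner_self_eq_norm_sq]
      have := csInf_le hbdd ht
      nlinarith [sq_nonneg ‖v‖]
  have hseq : ∃ v : ℕ → X, (∀ n, ‖v n‖ = 1) ∧ Tendsto (fun n => B (v n) (v n)) atTop (𝓝 μ) := by
    obtain ⟨s, -, hs, hsA⟩ := exists_seq_tendsto_sInf ⟨t₀, ht₀⟩ hbdd
    choose v hv hv' using hsA
    exact ⟨v, hv, by simpa only [hv'] using hs⟩
  obtain ⟨v, hv1, hvl⟩ := hseq
  set U := hyperfilter ℕ
  have hU : (U : Filter ℕ) ≤ atTop := Nat.hyperfilter_le_atTop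
  obtain ⟨p, hp⟩ := exists_weak_limit U v 1 (Eventually.of_forall fun n => (hv1 n).le)
  -- the defect of a minimizing sequence in the parallelogram identity for `q`, plus the finite-rank
  -- term; it controls distances, so that the minimizing sequence converges strongly
  set Ψ : X → ℝ := fun x => 2 * q x x + 2 * ∑ i, (l i x - l i p) ^ 2 with hΨ
  have hΨl : Tendsto (fun n => Ψ (v n)) U (𝓝 0) := by
    have h1 : Tendsto (fun n => q (v n) (v n)) U (𝓝 0) := by
      have : Tendsto (fun n => B (v n) (v n) - μ) U (𝓝 (μ - μ)) := (hvl.mono_left hU).sub_const μ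
      rw [sub_self] at this
      refine this.congr fun n => ?_
      rw [hqa, real_inner_self_eq_norm_sq, hv1]; ring
    have h2 : Tendsto (fun n => ∑ i, (l i (v n) - l i p) ^ 2) U (𝓝 0) := by
      have : Tendsto (fun n => ∑ i, (l i (v n) - l i p) ^ 2) U
          (𝓝 (∑ i, (l i p - l i p) ^ 2)) :=
        tendsto_finsetSum _ fun i _ => ((hp (l i)).sub_const _).pow 2
      simpa using this
    have := (h1.const_mul 2).add (h2.const_mul 2)
    simpa [hΨ] using this
  have hdist : ∀ x y, a * ‖x - y‖ ^ 2 ≤ Ψ x + Ψ y := by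
    intro x y
    have h1 := hG (x - y)
    have h2 := hq0 (x + y)
    have h3 : q (x + y) (x + y) + q (x - y) (x - y) = 2 * q x x + 2 * q y y := by
      simp only [map_add, map_sub, add_apply, sub_apply]
      ring
    have h4 : B (x - y) (x - y) ≤ q (x - y) (x - y) := by
      rw [hqa, real_inner_self_eq_norm_sq]; nlinarith [sq_nonneg ‖x - y‖]
    have h5 : ∑ i, l i (x - y) ^ 2 ≤
        2 * ∑ i, (l i x - l i p) ^ 2 + 2 * ∑ i, (l i y - l i p) ^ 2 := by
      rw [Finset.mul_sum, Finset.mul_sum, ← Finset.sum_add_distrib]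
      refine Finset.sum_le_sum fun i _ => ?_
      rw [map_sub]
      nlinarith [sq_nonneg ((l i x - l i p) + (l i y - l i p))]
    simp only [hΨ]; linarith
  have hcauchy : Cauchy (map v (U : Filter ℕ)) := by
    rw [Metric.cauchy_iff]
    refine ⟨inferInstance, fun ε hε => ?_⟩
    refine ⟨{x | Ψ x < a * ε ^ 2 / 2}, ?_, ?_⟩
    · exact hΨl.eventually (gt_mem_nhds (by positivity))
    · intro x hx y hy
      have := hdist x y
      rw [dist_eq_norm]
      have h1 : a * ‖x - y‖ ^ 2 < a * ε ^ 2 := by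
        simp only [Set.mem_ofPred_eq] at hx hy; linarith
      exact lt_of_pow_lt_pow_left₀ 2 hε.le (lt_of_mul_lt_mul_left h1 ha.le)
  obtain ⟨e, he⟩ := CompleteSpace.complete hcauchy
  have he' : Tendsto v U (𝓝 e) := he
  have hen : ‖e‖ = 1 := by
    refine tendsto_nhds_unique he'.norm ?_
    simp only [hv1]; exact tendsto_const_nhds
  have hqe : q e e = 0 := by
    have h1 : Tendsto (fun n => B (v n) (v n)) U (𝓝 (B e e)) :=
      (B.continuous₂.tendsto (e, e)).comp (he'.prodMk_nhds he')
    have h2 := tendsto_nhds_unique h1 (hvl.mono_left hU)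
    rw [hqa, h2, real_inner_self_eq_norm_sq, hen]; ring
  refine ⟨e, μ, hμn, hen, fun w => ?_⟩
  have h1 := sq_le_mul_of_nonneg q hqs ⊤ (fun v _ => hq0 v) (v := e) (w := w) trivial trivial
  rw [hqe, zero_mul] at h1
  have h2 : q e w = 0 := by
    have := le_antisymm h1 (sq_nonneg _)
    exact pow_eq_zero_iff (two_ne_zero) |>.mp this
  rw [hqa] at h2; linarith

/-- A nonnegative symmetric form on a subspace is coercive there if it is inf-sup stable. -/
theorem coercive_of_infSup (B : X →L[ℝ] X →L[ℝ] ℝ) (hB : ∀ v w, B v w = B w v)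
    (S : Submodule ℝ X) (hS : ∀ v ∈ S, 0 ≤ B v v) {c : ℝ} (hc : 0 < c)
    (hinf : ∀ v ∈ S, ∃ w ∈ S, ‖w‖ ≤ 1 ∧ c * ‖v‖ ≤ B v w) {v : X} (hv : v ∈ S) :
    c ^ 2 / (‖B‖ + 1) * ‖v‖ ^ 2 ≤ B v v := by
  obtain ⟨w, hw, hw1, hcw⟩ := hinf v hv
  have h1 := sq_le_mul_of_nonneg B hB S hS hv hw
  have h2 : B w w ≤ ‖B‖ + 1 := by
    have h3 := (le_abs_self _).trans (abs_form_le B w w)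
    have : ‖B‖ * ‖w‖ * ‖w‖ ≤ ‖B‖ := by
      rw [mul_assoc]
      exact mul_le_of_le_one_right (by positivity) (mul_le_one₀ hw1 (norm_nonneg _) hw1)
    linarith
  have h4 : (c * ‖v‖) ^ 2 ≤ B v w ^ 2 := pow_le_pow_left₀ (by positivity) hcw 2
  have h5 : B v v * B w w ≤ B v v * (‖B‖ + 1) := mul_le_mul_of_nonneg_left h2 (hS v hv)
  have h6 : 0 < ‖B‖ + 1 := by positivity
  rw [div_mul_eq_mul_div, div_le_iff₀ h6]
  nlinarith

/-- The negative spectral subspace: a symmetric form that is coercive up to finite rank and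
inf-sup stable is definite on a finite-dimensional subspace and on its orthogonal complement. -/
theorem exists_splitting [CompleteSpace X] (B : X →L[ℝ] X →L[ℝ] ℝ)
    (hB : ∀ v w, B v w = B w v) {ι : Type*} [Fintype ι] (l : ι → X →L[ℝ] ℝ) {a : ℝ} (ha : 0 < a)
    (hG : ∀ v, a * ‖v‖ ^ 2 - ∑ i, l i v ^ 2 ≤ B v v) {c : ℝ} (hc : 0 < c)
    (hinf : ∀ v, ∃ w, ‖w‖ ≤ 1 ∧ c * ‖v‖ ≤ B v w) :
    ∃ c₁ : ℝ, 0 < c₁ ∧ ∃ W : Submodule ℝ X, FiniteDimensional ℝ W ∧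
      (∀ v ∈ W, c₁ * ‖v‖ ^ 2 ≤ -B v v) ∧ ∀ v ∈ Wᗮ, c₁ * ‖v‖ ^ 2 ≤ B v v := by
  let good : Submodule ℝ X → Prop := fun W => FiniteDimensional ℝ W ∧
    (∀ w ∈ W, w ≠ 0 → B w w < 0) ∧ ∀ w ∈ W, ∀ v ∈ Wᗮ, B w v = 0
  -- the functionals `l i` separate the points of a negative definite subspace
  have hdim : ∀ W, good W → Module.finrank ℝ W ≤ Fintype.card ι := by
    rintro W ⟨hf, hn, -⟩
    let f : W →ₗ[ℝ] (ι → ℝ) := LinearMap.pi fun i => (l i).toLinearMap ∘ₗ W.subtype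
    have hinj : Function.Injective f := by
      rw [← LinearMap.ker_eq_bot, LinearMap.ker_eq_bot']
      intro w hw
      by_contra hne
      have h1 := hn w w.2 (by simpa using hne)
      have h2 := hG w
      have h3 : ∀ i, l i w = 0 := fun i => congrFun hw i
      simp only [h3] at h2
      have : 0 ≤ a * ‖(w : X)‖ ^ 2 := by positivity
      simp at h2
      linarith
    simpa using LinearMap.finrank_le_finrank_of_injective hinj
  -- as long as the form takes a negative value on the complement, an eigenvector can be added
  have hmax : ∃ W, good W ∧ ∀ v ∈ Wᗮ, 0 ≤ B v v := by
    by_contra hcon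
    push Not at hcon
    have key : ∀ n : ℕ, ∃ W, good W ∧ Module.finrank ℝ W = n := by
      intro n
      induction n with
      | zero =>
        exact ⟨⊥, ⟨inferInstance, by simp +contextual, by simp +contextual⟩, by simp⟩
      | succ n ih =>
        obtain ⟨W, hW, hWn⟩ := ih
        obtain ⟨v, hv, hvn⟩ := hcon W hW
        obtain ⟨hf, hn, ho⟩ := hW
        let J := Wᗮ.subtypeL
        let B' : Wᗮ →L[ℝ] Wᗮ →L[ℝ] ℝ := B.bilinearComp J J
        have hB' : ∀ x y : Wᗮ, B' x y = B x y := fun x y => rfl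
        obtain ⟨e, μ, hμ, he1, he⟩ := exists_eigenvector_neg B' (fun x y => hB x y)
          (fun i => (l i).comp J) ha (fun x => hG x) ⟨⟨v, hv⟩, hvn⟩
        have he0 : (e : X) ≠ 0 := by
          intro h0
          have : e = 0 := by ext; simpa using h0
          simp [this] at he1
        have he1' : ‖(e : X)‖ = 1 := he1
        have hee : ∀ w ∈ W, inner ℝ w (e : X) = 0 := fun w hw => e.2 w hw
        have hBe : ∀ x, B e x = μ * inner ℝ (e : X) x := by
          intro x
          obtain ⟨y, hy, z, hz, rfl⟩ := W.exists_add_mem_mem_orthogonal x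
          rw [map_add, inner_add_right, hB, ho y hy e e.2, real_inner_comm, hee y hy]
          have := he ⟨z, hz⟩
          rw [hB'] at this
          simp only [Submodule.coe_inner] at this
          rw [this]; ring
        refine ⟨W ⊔ ℝ ∙ (e : X), ⟨inferInstance, ?_, ?_⟩, ?_⟩
        · intro x hx hx0
          obtain ⟨w, hw, y, hy, rfl⟩ := Submodule.mem_sup.mp hx
          obtain ⟨t, rfl⟩ := Submodule.mem_span_singleton.mp hy
          have h1 : B (w + t • (e : X)) (w + t • (e : X)) = B w w + μ * t ^ 2 := by
            simp only [map_add, map_smul, add_apply,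
              smul_apply, smul_eq_mul, hBe, hB w e, real_inner_comm w (e : X),
              hee w hw, real_inner_self_eq_norm_sq, he1']
            ring
          rw [h1]
          by_cases hw0 : w = 0
          · have ht : t ≠ 0 := by rintro rfl; simp [hw0] at hx0
            have : 0 < t ^ 2 := by positivity
            simp only [hw0, map_zero]
            nlinarith
          · have := hn w hw hw0
            nlinarith [sq_nonneg t]
        · intro x hx y hy
          rw [← Submodule.inf_orthogonal] at hy
          obtain ⟨hy1, hy2⟩ := hy
          obtain ⟨w, hw, z, hz, rfl⟩ := Submodule.mem_sup.mp hx
          obtain ⟨t, rfl⟩ := Submodule.mem_span_singleton.mp hz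
          have h2 : inner ℝ (e : X) y = 0 := hy2 e (Submodule.mem_span_singleton_self _)
          simp [hBe, h2, ho w hw y hy1]
        · have hdisj : W ⊓ ℝ ∙ (e : X) = ⊥ := by
            rw [eq_bot_iff]
            rintro x ⟨hx1, hx2⟩
            obtain ⟨t, rfl⟩ := Submodule.mem_span_singleton.mp hx2
            have := hee _ hx1
            rw [inner_smul_left, real_inner_self_eq_norm_sq, he1'] at this
            simp at this
            simp [this]
          have := Submodule.finrank_sup_add_finrank_inf_eq W (ℝ ∙ (e : X))
          rw [hdisj, finrank_bot, finrank_span_singleton he0, hWn] at this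
          simpa using this
    obtain ⟨W, hW, hn⟩ := key (Fintype.card ι + 1)
    have := hdim W hW
    omega
  obtain ⟨W, ⟨hf, hn, ho⟩, hp⟩ := hmax
  refine ⟨c ^ 2 / (‖B‖ + 1), by positivity, W, hf, fun v hv => ?_, fun v hv => ?_⟩
  · have hneg : ‖-B‖ = ‖B‖ := norm_neg B
    have h := coercive_of_infSup (-B) (fun v w => by simp [hB v w]) W (fun v hv => ?_) hc ?_ hv
    · rw [hneg] at h; simpa using h
    · by_cases h0 : v = 0
      · simp [h0]
      · simpa using (hn v hv h0).le
    · intro v hv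
      obtain ⟨w, hw1, hw⟩ := hinf v
      obtain ⟨y, hy, z, hz, rfl⟩ := W.exists_add_mem_mem_orthogonal w
      refine ⟨-y, W.neg_mem hy, ?_, ?_⟩
      · have : inner ℝ y z = 0 := hz y hy
        have h3 := norm_add_sq_eq_norm_sq_add_norm_sq_of_inner_eq_zero y z this
        rw [norm_neg]
        nlinarith [norm_nonneg y, norm_nonneg z, norm_nonneg (y + z)]
      · rw [map_add, ho v hv z hz] at hw
        simpa using hw
  · refine coercive_of_infSup B hB Wᗮ hp hc ?_ hv
    intro v hv
    obtain ⟨w, hw1, hw⟩ := hinf v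
    obtain ⟨y, hy, z, hz, rfl⟩ := W.exists_add_mem_mem_orthogonal w
    refine ⟨z, hz, ?_, ?_⟩
    · have : inner ℝ y z = 0 := hz y hy
      have h3 := norm_add_sq_eq_norm_sq_add_norm_sq_of_inner_eq_zero y z this
      nlinarith [norm_nonneg y, norm_nonneg z, norm_nonneg (y + z)]
    · rw [map_add, hB v y, ho y hy v hv] at hw
      simpa using hw

end Hilbert

/-! ### Inf-sup stability along approximating subspaces -/

section Hilbert

variable {X : Type*} [NormedAddCommGroup X] [InnerProductSpace ℝ X]

/-- A finite-dimensional subspace of the closure of `D` is moved into `D` by a linear map that is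
close to the identity. -/
theorem exists_linear_approx (W D : Submodule ℝ X) [FiniteDimensional ℝ W]
    (hW : ∀ w ∈ W, w ∈ closure (D : Set X)) {δ : ℝ} (hδ : 0 < δ) :
    ∃ (n : ℕ) (y : Fin n → X) (S : W →ₗ[ℝ] X), (∀ i, y i ∈ D) ∧
      (∀ w, S w ∈ Submodule.span ℝ (Set.range y)) ∧ (∀ i, ∃ w, S w = y i) ∧
      ∀ w : W, ‖S w - w‖ ≤ δ * ‖(w : X)‖ := by
  set n := Module.finrank ℝ W
  let b := stdOrthonormalBasis ℝ W
  have hpos : 0 < δ / (n + 1) := by positivity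
  have hy : ∀ i, ∃ y ∈ D, ‖((b i : W) : X) - y‖ < δ / (n + 1) := by
    intro i
    obtain ⟨y, hy, hd⟩ := Metric.mem_closure_iff.mp (hW _ (b i).2) _ hpos
    exact ⟨y, hy, by rwa [← dist_eq_norm]⟩
  choose y hyD hyd using hy
  refine ⟨n, y, b.toBasis.constr ℝ y, hyD, fun w => ?_, fun i => ⟨b i, ?_⟩, fun w => ?_⟩
  · rw [Module.Basis.constr_apply_fintype]
    exact Submodule.sum_mem _ fun i _ =>
      Submodule.smul_mem _ _ (Submodule.subset_span (Set.mem_range_self i))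
  · simp
  · have h1 : ((w : W) : X) = ∑ i, inner ℝ (b i) w • ((b i : W) : X) := by
      conv_lhs => rw [← b.sum_repr' w]
      simp
    rw [Module.Basis.constr_apply_fintype]
    have h2 : ∑ i, b.toBasis.equivFun w i • y i - (w : X) =
        ∑ i, inner ℝ (b i) w • (y i - ((b i : W) : X)) := by
      conv_lhs => rw [h1]
      rw [← Finset.sum_sub_distrib]
      refine Finset.sum_congr rfl fun i _ => ?_
      rw [smul_sub]
      simp [b.repr_apply_apply]
    rw [h2]
    calc ‖∑ i, inner ℝ (b i) w • (y i - ((b i : W) : X))‖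
        ≤ ∑ i : Fin n, ‖(w : X)‖ * (δ / (n + 1)) := by
          refine norm_sum_le_of_le _ fun i _ => ?_
          rw [norm_smul]
          refine mul_le_mul ?_ ?_ (norm_nonneg _) (norm_nonneg _)
          · have := norm_inner_le_norm (𝕜 := ℝ) (b i) w
            rwa [b.norm_eq_one, one_mul] at this
          · rw [norm_sub_rev]; exact (hyd i).le
      _ ≤ δ * ‖(w : X)‖ := by
          rw [Finset.sum_const, Finset.card_univ, Fintype.card_fin, nsmul_eq_mul]
          have : (n : ℝ) * (‖(w : X)‖ * (δ / (n + 1))) = δ * ‖(w : X)‖ * (n / (n + 1)) := by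
            field_simp
          rw [this]
          refine mul_le_of_le_one_right (by positivity) ?_
          rw [div_le_one (by positivity)]; linarith

/-- Error of a quadratic form under a perturbation of its argument. -/
theorem abs_form_sub_le (B : X →L[ℝ] X →L[ℝ] ℝ) (v w : X) :
    |B v v - B w w| ≤ ‖B‖ * ‖v - w‖ * (‖v‖ + ‖w‖) := by
  have h : B v v - B w w = B (v - w) v + B w (v - w) := by
    simp only [map_sub, sub_apply]; ring
  rw [h]
  refine (abs_add_le _ _).trans ?_
  have h1 := abs_form_le B (v - w) v
  have h2 := abs_form_le B w (v - w)
  calc _ ≤ ‖B‖ * ‖v - w‖ * ‖v‖ + ‖B‖ * ‖w‖ * ‖v - w‖ := add_le_add h1 h2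
    _ = _ := by ring

/-- Transfer of the inf-sup constant to a sequence of approximating subspaces `XN N`: the
definiteness on `Wn ⊕ Wp` and the coercivity up to finite rank on `XN N` combine to inf-sup
stability on `XN N` for large `N`. -/
theorem eventually_infSup [CompleteSpace X] (B : X →L[ℝ] X →L[ℝ] ℝ) (hB : ∀ v w, B v w = B w v)
    (S D Wn Wp : Submodule ℝ X) (XN : ℕ → Submodule ℝ X)
    (hD : ∀ g ∈ S, g ∈ closure (D : Set X))
    (hDN : ∀ p ∈ D, ∀ᶠ N in atTop, p ∈ XN N)
    (hlim : ∀ (U : Ultrafilter ℕ), (U : Filter ℕ) ≤ atTop → ∀ (g : ℕ → X) (q : X),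
      (∀ᶠ n in (U : Filter ℕ), g n ∈ XN n) →
      (∀ l : X →L[ℝ] ℝ, Tendsto (fun n => l (g n)) U (𝓝 (l q))) → q ∈ S)
    {c₀ c₁ : ℝ} (hc₀ : 0 < c₀) (hc₁ : 0 < c₁) {ι : Type*} [Fintype ι] (l : ι → X →L[ℝ] ℝ)
    (hG : ∀ᶠ N in atTop, ∀ g ∈ XN N, 3 / 4 * c₀ * ‖g‖ ^ 2 - ∑ i, l i g ^ 2 ≤ B g g)
    (hsup : Wn ⊔ Wp = S) (hfin : FiniteDimensional ℝ Wn)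
    (horth : ∀ v ∈ Wn, ∀ w ∈ Wp, inner ℝ v w = 0)
    (hneg : ∀ v ∈ Wn, c₁ * ‖v‖ ^ 2 ≤ -B v v) (hpos : ∀ v ∈ Wp, c₁ * ‖v‖ ^ 2 ≤ B v v) :
    ∀ᶠ N in atTop, ∀ g ∈ XN N, ∃ w ∈ XN N, ‖w‖ = ‖g‖ ∧
      min (c₀ / 2) (c₁ / 2) * ‖g‖ ^ 2 ≤ B g w := by
  set κ := min (c₀ / 2) (c₁ / 2) with hκ
  set δ := min (1 / 4) (c₁ / (16 * (‖B‖ + 1))) with hδ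
  have hM : 0 < ‖B‖ + 1 := by positivity
  have hδ0 : 0 < δ := by rw [hδ]; positivity
  have hδ1 : δ ≤ 1 / 4 := min_le_left _ _
  have hδ2 : ‖B‖ * δ ≤ c₁ / 16 := by
    have h1 : δ ≤ c₁ / (16 * (‖B‖ + 1)) := min_le_right _ _
    rw [le_div_iff₀ (by positivity)] at h1
    nlinarith
  have hWnS : ∀ w ∈ Wn, w ∈ S := fun w hw => hsup ▸ Submodule.mem_sup_left hw
  obtain ⟨n, y, A, hyD, hAspan, hAy, hA⟩ :=
    exists_linear_approx Wn D (fun w hw => hD w (hWnS w hw)) hδ0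
  set Y := Submodule.span ℝ (Set.range y) with hY
  have hYfin : FiniteDimensional ℝ Y := FiniteDimensional.span_of_finite ℝ (Set.finite_range y)
  have hYA : ∀ p ∈ Y, ∃ w, A w = p := by
    intro p hp
    have : Y ≤ LinearMap.range A := by
      rw [hY, Submodule.span_le]
      rintro _ ⟨i, rfl⟩
      exact hAy i
    exact this hp
  -- the form is negative definite on the approximant `Y` of `Wn`
  have hYneg : ∀ p ∈ Y, κ * ‖p‖ ^ 2 ≤ -B p p := by
    intro p hp
    obtain ⟨w, rfl⟩ := hYA p hp
    have h1 := hA w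
    have h2 := hneg w w.2
    have h3 : ‖A w‖ ≤ 5 / 4 * ‖(w : X)‖ := by
      have : ‖A w‖ ≤ ‖A w - w‖ + ‖(w : X)‖ := by
        simpa using norm_add_le (A w - w) (w : X)
      nlinarith [norm_nonneg (w : X)]
    have h4 := (abs_le.mp (abs_form_sub_le B (A w) w)).2
    have h5 : ‖B‖ * ‖A w - w‖ * (‖A w‖ + ‖(w : X)‖) ≤ c₁ / 16 * (9 / 4) * ‖(w : X)‖ ^ 2 := by
      have e1 : ‖B‖ * ‖A w - w‖ ≤ c₁ / 16 * ‖(w : X)‖ := by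
        calc ‖B‖ * ‖A w - w‖ ≤ ‖B‖ * (δ * ‖(w : X)‖) :=
              mul_le_mul_of_nonneg_left h1 (by positivity)
          _ = ‖B‖ * δ * ‖(w : X)‖ := by ring
          _ ≤ _ := mul_le_mul_of_nonneg_right hδ2 (norm_nonneg _)
      have e2 : ‖A w‖ + ‖(w : X)‖ ≤ 9 / 4 * ‖(w : X)‖ := by linarith
      calc _ ≤ c₁ / 16 * ‖(w : X)‖ * (9 / 4 * ‖(w : X)‖) :=
            mul_le_mul e1 e2 (by positivity) (by positivity)
        _ = _ := by ring
    have h6 : ‖A w‖ ^ 2 ≤ 25 / 16 * ‖(w : X)‖ ^ 2 := by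
      have := pow_le_pow_left₀ (norm_nonneg _) h3 2
      nlinarith
    have h7 : κ * ‖A w‖ ^ 2 ≤ c₁ / 2 * ‖A w‖ ^ 2 :=
      mul_le_mul_of_nonneg_right (min_le_right _ _) (sq_nonneg _)
    nlinarith [sq_nonneg ‖(w : X)‖, mul_nonneg hc₁.le (sq_nonneg ‖(w : X)‖)]
  -- and positive definite on the complement of `Y` in `XN N`, by a compactness argument
  have hYpos : ∀ᶠ N in atTop, ∀ g ∈ XN N, g ∈ Yᗮ → κ * ‖g‖ ^ 2 ≤ B g g := by
    by_contra hcon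
    have hfreq : ∃ᶠ N in atTop, ∃ g ∈ XN N, g ∈ Yᗮ ∧ ‖g‖ = 1 ∧ B g g ≤ κ := by
      refine (not_eventually.mp hcon).mono fun N hN => ?_
      push Not at hN
      obtain ⟨g, hg, hgY, hlt⟩ := hN
      have hg0 : g ≠ 0 := by rintro rfl; simp at hlt
      have hn : ‖g‖ ≠ 0 := norm_ne_zero_iff.mpr hg0
      refine ⟨‖g‖⁻¹ • g, Submodule.smul_mem _ _ hg, Submodule.smul_mem _ _ hgY, ?_, ?_⟩
      · rw [norm_smul, norm_inv, norm_norm, inv_mul_cancel₀ hn]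
      · simp only [map_smul, smul_apply, smul_eq_mul]
        have h1 : ‖g‖⁻¹ * (‖g‖⁻¹ * B g g) = B g g / ‖g‖ ^ 2 := by field_simp
        rw [h1, div_le_iff₀ (by positivity)]
        exact hlt.le
    have : (atTop ⊓ 𝓟 {N | ∃ g ∈ XN N, g ∈ Yᗮ ∧ ‖g‖ = 1 ∧ B g g ≤ κ}).NeBot :=
      frequently_mem_iff_neBot.mp hfreq
    set U := Ultrafilter.of (atTop ⊓ 𝓟 {N | ∃ g ∈ XN N, g ∈ Yᗮ ∧ ‖g‖ = 1 ∧ B g g ≤ κ})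
    have hUle : (U : Filter ℕ) ≤ _ := Ultrafilter.of_le _
    have hUat : (U : Filter ℕ) ≤ atTop := hUle.trans inf_le_left
    have hUp : ∀ᶠ N in (U : Filter ℕ), ∃ g, g ∈ XN N ∧ g ∈ Yᗮ ∧ ‖g‖ = 1 ∧ B g g ≤ κ := by
      have := le_principal_iff.mp (hUle.trans inf_le_right)
      filter_upwards [this] with N hN
      obtain ⟨g, h⟩ := hN
      exact ⟨g, h⟩
    obtain ⟨g, hg⟩ := hUp.choice
    obtain ⟨q, hq⟩ := exists_weak_limit U g 1 (hg.mono fun n h => h.2.2.1.le)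
    have hqS : q ∈ S := hlim U hUat g q (hg.mono fun n h => h.1) hq
    have hinner : ∀ p, Tendsto (fun n => inner ℝ p (g n)) U (𝓝 (inner ℝ p q)) := fun p =>
      hq (innerSL ℝ p)
    have hq1 : ‖q‖ ≤ 1 := by
      have h1 : inner ℝ q q ≤ ‖q‖ := by
        refine le_of_tendsto (hinner q) (hg.mono fun n h => ?_)
        have := real_inner_le_norm q (g n)
        rwa [h.2.2.1, mul_one] at this
      rw [real_inner_self_eq_norm_sq] at h1
      by_contra hcon
      nlinarith [norm_nonneg q]
    have hqY : ∀ p ∈ Y, inner ℝ p q = 0 := by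
      intro p hp
      refine tendsto_nhds_unique (hinner p) (tendsto_const_nhds.congr' ?_)
      exact hg.mono fun n h => (h.2.1 p hp).symm
    -- the weak limit is almost orthogonal to `Wn`
    have hqB : 3 / 4 * c₁ * ‖q‖ ^ 2 ≤ B q q := by
      obtain ⟨w, hw, r, hr, hqwr⟩ := Submodule.mem_sup.mp (hsup.symm ▸ hqS : q ∈ Wn ⊔ Wp)
      have hwr := horth w hw r hr
      have hnq : ‖q‖ ^ 2 = ‖w‖ ^ 2 + ‖r‖ ^ 2 := by
        rw [← hqwr]
        have := norm_add_sq_eq_norm_sq_add_norm_sq_of_inner_eq_zero w r hwr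
        nlinarith
      have h1 : ‖w‖ ^ 2 ≤ δ * ‖w‖ * ‖q‖ := by
        have e1 : inner ℝ w q = ‖w‖ ^ 2 := by
          rw [← hqwr, inner_add_right, hwr, add_zero, real_inner_self_eq_norm_sq]
        have e2 : inner ℝ (w - A ⟨w, hw⟩) q = ‖w‖ ^ 2 := by
          rw [inner_sub_left, hqY _ (hAspan _), sub_zero, e1]
        rw [← e2]
        refine (real_inner_le_norm _ _).trans (mul_le_mul_of_nonneg_right ?_ (norm_nonneg _))
        rw [norm_sub_rev]
        exact hA ⟨w, hw⟩
      have h2 : ‖w‖ ≤ δ * ‖q‖ := by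
        by_cases hw0 : ‖w‖ = 0
        · rw [hw0]; positivity
        · have : 0 < ‖w‖ := lt_of_le_of_ne (norm_nonneg _) (Ne.symm hw0)
          nlinarith
      have h3 := (abs_le.mp (abs_form_sub_le B q r)).1
      have hqr : q - r = w := by rw [← hqwr]; abel
      rw [hqr] at h3
      have h4 : ‖r‖ ≤ ‖q‖ := by
        refine le_of_sq_le_sq ?_ (norm_nonneg _)
        nlinarith [sq_nonneg ‖w‖]
      have h5 : ‖B‖ * ‖w‖ * (‖q‖ + ‖r‖) ≤ c₁ / 16 * 2 * ‖q‖ ^ 2 := by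
        have e1 : ‖B‖ * ‖w‖ ≤ c₁ / 16 * ‖q‖ := by
          calc ‖B‖ * ‖w‖ ≤ ‖B‖ * (δ * ‖q‖) := mul_le_mul_of_nonneg_left h2 (by positivity)
            _ = ‖B‖ * δ * ‖q‖ := by ring
            _ ≤ _ := mul_le_mul_of_nonneg_right hδ2 (norm_nonneg _)
        calc _ ≤ c₁ / 16 * ‖q‖ * (2 * ‖q‖) :=
              mul_le_mul e1 (by linarith) (by positivity) (by positivity)
          _ = _ := by ring
      have h6 := hpos r hr
      have h7 : ‖w‖ ^ 2 ≤ 1 / 16 * ‖q‖ ^ 2 := by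
        have : ‖w‖ ≤ 1 / 4 * ‖q‖ := h2.trans (mul_le_mul_of_nonneg_right hδ1 (norm_nonneg _))
        have := pow_le_pow_left₀ (norm_nonneg _) this 2
        nlinarith
      nlinarith [mul_nonneg hc₁.le (sq_nonneg ‖q‖)]
    -- the limit of the coercivity estimate for `g n - p`, with `p ∈ D` arbitrary
    have hineq : ∀ p ∈ (D : Set X), B p p + 2 * B p (q - p) +
        3 / 4 * c₀ * (1 - 2 * inner ℝ p q + ‖p‖ ^ 2) - ∑ i, l i (q - p) ^ 2 ≤ κ := by
      intro p hp
      have hev : ∀ᶠ n in (U : Filter ℕ), B p p + 2 * B p (g n - p) +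
          3 / 4 * c₀ * (1 - 2 * inner ℝ p (g n) + ‖p‖ ^ 2) - ∑ i, l i (g n - p) ^ 2 ≤ κ := by
        filter_upwards [hg, hUat (hDN p hp), hUat hG] with n hn hpn hGn
        have h1 := hGn _ (Submodule.sub_mem _ hn.1 hpn)
        have h2 : ‖g n - p‖ ^ 2 = 1 - 2 * inner ℝ p (g n) + ‖p‖ ^ 2 := by
          rw [norm_sub_sq_real, hn.2.2.1, real_inner_comm]; ring
        have h3 : B (g n) (g n) = B p p + 2 * B p (g n - p) + B (g n - p) (g n - p) := by
          simp only [map_sub, sub_apply, hB (g n) p]; ring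
        have h4 := hn.2.2.2
        rw [h2] at h1
        linarith
      refine le_of_tendsto ?_ hev
      refine Tendsto.sub (Tendsto.add ?_ ?_) ?_
      · have := hq (B p)
        simp only [map_sub]
        exact ((this.sub_const _).const_mul 2).const_add _
      · exact ((((hinner p).const_mul 2).const_sub 1).add_const _).const_mul _
      · simp only [map_sub]
        exact tendsto_finsetSum _ fun i _ => ((hq (l i)).sub_const _).pow 2
    have hclosed : IsClosed {p : X | B p p + 2 * B p (q - p) +
        3 / 4 * c₀ * (1 - 2 * inner ℝ p q + ‖p‖ ^ 2) - ∑ i, l i (q - p) ^ 2 ≤ κ} := by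
      refine isClosed_le ?_ continuous_const
      have := B.continuous₂
      fun_prop
    have hqle : B q q + 2 * B q (q - q) +
        3 / 4 * c₀ * (1 - 2 * inner ℝ q q + ‖q‖ ^ 2) - ∑ i, l i (q - q) ^ 2 ≤ κ :=
      closure_minimal hineq hclosed (hD q hqS)
    simp only [sub_self, map_zero, real_inner_self_eq_norm_sq] at hqle
    have hsum : ∑ i : ι, (0 : ℝ) ^ 2 = 0 := by simp
    rw [hsum] at hqle
    have hκ0 : κ ≤ c₀ / 2 := min_le_left _ _
    have hκ1 : κ ≤ c₁ / 2 := min_le_right _ _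
    have hκp : 0 < κ := by rw [hκ]; positivity
    have hq2 : ‖q‖ ^ 2 ≤ 1 := by nlinarith [norm_nonneg q]
    nlinarith [sq_nonneg ‖q‖, mul_nonneg (sub_nonneg.mpr hκ1) (sq_nonneg ‖q‖),
      mul_nonneg (sub_nonneg.mpr hκ0) (sub_nonneg.mpr hq2)]
  have hYN : ∀ᶠ N in atTop, ∀ i, y i ∈ XN N := by
    rw [eventually_all]; exact fun i => hDN _ (hyD i)
  filter_upwards [hYpos, hYN] with N hNpos hNY g hg
  have hYle : Y ≤ XN N := by
    rw [hY, Submodule.span_le]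
    rintro _ ⟨i, rfl⟩
    exact hNY i
  obtain ⟨p, hp, r, hr, rfl⟩ := Y.exists_add_mem_mem_orthogonal g
  have hrN : r ∈ XN N := by
    have := Submodule.sub_mem _ hg (hYle hp)
    simpa using this
  have hpr : inner ℝ p r = 0 := hr p hp
  refine ⟨r - p, Submodule.sub_mem _ hrN (hYle hp), ?_, ?_⟩
  · rw [norm_sub_eq_norm_add hpr, add_comm]
  · -- the cross terms cancel by symmetry
    have h1 : B (p + r) (r - p) = B r r - B p p := by
      simp only [map_add, map_sub, add_apply, hB r p]; ring
    have h2 := norm_add_sq_eq_norm_sq_add_norm_sq_of_inner_eq_zero p r hpr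
    have h3 := hNpos r hrN hr
    have h4 := hYneg p hp
    have h5 : ‖p + r‖ ^ 2 = ‖p‖ ^ 2 + ‖r‖ ^ 2 := by linarith
    rw [h1, h5, mul_add]
    linarith

end Hilbert

/-! ### Lattices, interaction ranges and potentials -/

section Linear

variable {d : ℕ}

theorem mulE_add (M : Matrix (Fin d) (Fin d) ℝ) (y z : Fin d → ℝ) :
    mulE M (y + z) = mulE M y + mulE M z := by
  simp [mulE, Matrix.mulVec_add]

theorem mulE_sub (M : Matrix (Fin d) (Fin d) ℝ) (y z : Fin d → ℝ) :
    mulE M (y - z) = mulE M y - mulE M z := by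
  simp [mulE, Matrix.mulVec_sub]

theorem mulE_inv {M : Matrix (Fin d) (Fin d) ℝ} (hM : M.det ≠ 0) (x : Eu d) :
    mulE M (M⁻¹ *ᵥ x.ofLp) = x := by
  have hu : IsUnit M.det := isUnit_iff_ne_zero.mpr hM
  simp [mulE, Matrix.mulVec_mulVec, Matrix.mul_nonsing_inv M hu]

theorem exists_norm_mulE_le (M : Matrix (Fin d) (Fin d) ℝ) :
    ∃ K : ℝ, 0 < K ∧ ∀ y, ‖mulE M y‖ ≤ K * ‖y‖ := by
  let f : (Fin d → ℝ) →L[ℝ] Eu d :=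
    ((WithLp.linearEquiv 2 ℝ (Fin d → ℝ)).symm.toLinearMap ∘ₗ M.mulVecLin).toContinuousLinearMap
  refine ⟨‖f‖ + 1, by positivity, fun y => ?_⟩
  have h := f.le_opNorm y
  have : f y = mulE M y := rfl
  rw [this] at h
  nlinarith [norm_nonneg y]

theorem exists_norm_inv_mulVec_le (M : Matrix (Fin d) (Fin d) ℝ) :
    ∃ K : ℝ, 0 < K ∧ ∀ x : Eu d, ‖M⁻¹ *ᵥ x.ofLp‖ ≤ K * ‖x‖ := by
  let f : Eu d →L[ℝ] (Fin d → ℝ) :=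
    (M⁻¹.mulVecLin ∘ₗ (WithLp.linearEquiv 2 ℝ (Fin d → ℝ)).toLinearMap).toContinuousLinearMap
  refine ⟨‖f‖ + 1, by positivity, fun y => ?_⟩
  have h := f.le_opNorm y
  have : f y = M⁻¹ *ᵥ y.ofLp := rfl
  rw [this] at h
  nlinarith [norm_nonneg y]

theorem inv_mulVec_mulE {M : Matrix (Fin d) (Fin d) ℝ} (hM : M.det ≠ 0) (y : Fin d → ℝ) :
    M⁻¹ *ᵥ (mulE M y).ofLp = y :=
  mulE_inj hM (mulE_inv hM _)

theorem add_mem_latticePts {A : Matrix (Fin d) (Fin d) ℝ} {x y : Eu d} (hx : x ∈ latticePts A)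
    (hy : y ∈ latticePts A) : x + y ∈ latticePts A := by
  obtain ⟨z, rfl⟩ := hx
  obtain ⟨w, rfl⟩ := hy
  refine ⟨z + w, ?_⟩
  simp only [← mulE_add]
  congr 1; ext i; simp

theorem sub_mem_latticePts {A : Matrix (Fin d) (Fin d) ℝ} {x y : Eu d} (hx : x ∈ latticePts A)
    (hy : y ∈ latticePts A) : x - y ∈ latticePts A := by
  obtain ⟨z, rfl⟩ := hx
  obtain ⟨w, rfl⟩ := hy
  refine ⟨z - w, ?_⟩
  simp only [← mulE_sub]
  congr 1; ext i; simp

theorem zero_mem_latticePts (A : Matrix (Fin d) (Fin d) ℝ) : (0 : Eu d) ∈ latticePts A :=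
  ⟨0, by simp [mulE, funext_iff, Matrix.mulVec, dotProduct]⟩

end Linear

section Range

variable {d m : ℕ} {L : DefectLattice d}

theorem mem_pts_iff {x : Eu d} (hx : L.Rdef ≤ ‖x‖) : x ∈ L.pts ↔ x ∈ L.hom := by
  have hb : x ∉ Metric.ball (0 : Eu d) L.Rdef := by simpa using hx
  constructor
  · intro h
    have h1 : x ∈ latticePts L.A \ Metric.ball 0 L.Rdef := L.pts_diff ▸ ⟨h, hb⟩
    exact h1.1
  · intro h
    have h1 : x ∈ L.pts \ Metric.ball 0 L.Rdef := L.pts_diff.symm ▸ ⟨h, hb⟩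
    exact h1.1

theorem mem_range {x ρ : Eu d} : ρ ∈ L.range x ↔ x + ρ ∈ L.pts ∧ ‖ρ‖ < L.rcut := by
  simp only [DefectLattice.range, interactionRange, Set.Finite.mem_toFinset, Set.mem_inter_iff,
    Set.mem_ofPred_eq, mem_ball_zero_iff]
  refine and_congr_left fun _ => ⟨?_, fun h => ⟨_, h, by abel⟩⟩
  rintro ⟨n, hn, rfl⟩
  simpa using hn

theorem mem_rangeHom {ρ : Eu d} : ρ ∈ L.rangeHom ↔ ρ ∈ L.hom ∧ ‖ρ‖ < L.rcut := by
  simp [DefectLattice.rangeHom, interactionRange]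

theorem range_eq_rangeHom {x : Eu d} (hx : x ∈ L.pts) (hfar : L.rcut + L.Rdef < ‖x‖) :
    L.range x = L.rangeHom := by
  ext ρ
  rw [mem_range, mem_rangeHom]
  refine and_congr_left fun hρ => ?_
  have hxl : x ∈ L.hom := (mem_pts_iff (by linarith [L.rcut_pos])).mp hx
  have h1 : L.Rdef ≤ ‖x + ρ‖ := by
    have := norm_sub_le (x + ρ) ρ
    rw [add_sub_cancel_right] at this
    linarith
  rw [mem_pts_iff h1]
  refine ⟨fun h => ?_, fun h => add_mem_latticePts hxl h⟩
  have := sub_mem_latticePts h hxl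
  rwa [add_sub_cancel_left] at this

/-- The extension by zero of a function on a set of sites to the whole space. -/
def extend (S : Set (Eu d)) (v : S → Eu m) : Eu d → Eu m := by
  classical
  exact fun x => if h : x ∈ S then v ⟨x, h⟩ else 0

theorem extend_coe (S : Set (Eu d)) (v : S → Eu m) (x : S) : extend S v x = v x := by
  simp [extend]

theorem extend_of_mem {S : Set (Eu d)} (v : S → Eu m) {x : Eu d} (hx : x ∈ S) :
    extend S v x = v ⟨x, hx⟩ := by
  simp [extend, hx]

theorem stencil_eq_extend (S : Set (Eu d)) (v : S → Eu m) (x : S) (R : Finset (Eu d))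
    (hR : ∀ ρ ∈ R, (x : Eu d) + ρ ∈ S) :
    stencil S v x R = fun ρ : R => extend S v (x + ρ) - extend S v x := by
  funext ρ
  have h := hR ρ ρ.2
  simp [stencil, extend, h]

theorem grad_eq (v : L.pts → Eu m) (x : L.pts) :
    grad v x = fun ρ : L.range x => extend L.pts v (x + ρ) - extend L.pts v x :=
  stencil_eq_extend _ _ _ _ fun _ hρ => (mem_range.mp hρ).1

theorem gradHom_eq (v : L.hom → Eu m) (x : L.hom) :
    gradHom v x = fun ρ : L.rangeHom => extend L.hom v (x + ρ) - extend L.hom v x :=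
  stencil_eq_extend _ _ _ _ fun _ hρ => add_mem_latticePts x.2 (mem_rangeHom.mp hρ).1

theorem normSq_nonneg {R : Finset (Eu d)} (g : R → Eu m) : 0 ≤ normSq g :=
  Finset.sum_nonneg fun _ _ => sq_nonneg _

theorem sq_norm_le_normSq {R : Finset (Eu d)} (g : R → Eu m) (ρ : R) : ‖g ρ‖ ^ 2 ≤ normSq g :=
  Finset.single_le_sum (f := fun ρ => ‖g ρ‖ ^ 2) (fun _ _ => sq_nonneg _) (Finset.mem_univ ρ)

/-- The norm on the left is the supremum norm, in which derivatives of site energies are measured. -/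
theorem sq_norm_le_normSq' {R : Finset (Eu d)} (g : R → Eu m) : ‖g‖ ^ 2 ≤ normSq g := by
  have h : ‖g‖ ≤ Real.sqrt (normSq g) := by
    refine (pi_norm_le_iff_of_nonneg (Real.sqrt_nonneg _)).mpr fun ρ => ?_
    exact Real.le_sqrt_of_sq_le (sq_norm_le_normSq g ρ)
  calc ‖g‖ ^ 2 ≤ Real.sqrt (normSq g) ^ 2 := pow_le_pow_left₀ (norm_nonneg _) h 2
    _ = _ := Real.sq_sqrt (normSq_nonneg g)

end Range

section Connected

variable {d m : ℕ}

/-- Induction along the edges of a connected interaction graph. -/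
theorem connected_induction {S : Set (Eu d)} {r : ℝ} (hc : (interactionGraph S r).Connected)
    {p : S → Prop} (x₀ : S) (h₀ : p x₀)
    (step : ∀ x y : S, p x → ‖(y : Eu d) - x‖ < r → p y) (y : S) : p y := by
  have h := (SimpleGraph.reachable_iff_reflTransGen x₀ y).mp (hc.preconnected x₀ y)
  induction h with
  | refl => exact h₀
  | tail _ hadj ih =>
    refine step _ _ ih ?_
    rw [interactionGraph, SimpleGraph.fromRel_adj] at hadj
    rcases hadj.2 with h | h
    · simpa using h.2
    · rw [norm_sub_rev]; simpa using h.2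

/-- The oscillation of a function on a finite set of sites is controlled by finitely many
differences along edges. -/
theorem exists_osc_bound {S : Set (Eu d)} {r : ℝ} (hc : (interactionGraph S r).Connected)
    (x₀ : S) (Y : Finset S) : ∃ (Z : Finset S) (K : ℝ), 0 ≤ K ∧ ∀ (w : Eu d → Eu m) (M : ℝ), 0 ≤ M →
      (∀ x ∈ Z, ∀ y : S, ‖(y : Eu d) - x‖ < r → ‖w y - w x‖ ≤ M) →
      ∀ y ∈ Y, ‖w y - w x₀‖ ≤ K * M := by
  classical
  have hone : ∀ y : S, ∃ (Z : Finset S) (K : ℕ), ∀ (w : Eu d → Eu m) (M : ℝ),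
      (∀ x ∈ Z, ∀ y : S, ‖(y : Eu d) - x‖ < r → ‖w y - w x‖ ≤ M) → ‖w y - w x₀‖ ≤ K * M := by
    refine connected_induction hc x₀ ⟨∅, 0, by simp⟩ ?_
    rintro x y ⟨Z, K, hZ⟩ hxy
    refine ⟨insert x Z, K + 1, fun w M hM => ?_⟩
    have h1 := hZ w M fun x' hx' => hM x' (Finset.mem_insert_of_mem hx')
    have h2 := hM x (Finset.mem_insert_self _ _) y hxy
    have h3 := norm_add_le (w y - w x) (w x - w x₀)
    rw [sub_add_sub_cancel] at h3
    push_cast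
    linarith
  choose Z K hZK using hone
  refine ⟨insert x₀ (Y.biUnion Z), ∑ y ∈ Y, (K y : ℝ), by positivity, fun w M hM0 hM y hy => ?_⟩
  have h1 := hZK y w M fun x hx =>
    hM x (Finset.mem_insert_of_mem (Finset.mem_biUnion.mpr ⟨y, hy, hx⟩))
  have h2 : (K y : ℝ) ≤ ∑ y ∈ Y, (K y : ℝ) :=
    Finset.single_le_sum (f := fun y => (K y : ℝ)) (fun _ _ => by positivity) hy
  exact h1.trans (mul_le_mul_of_nonneg_right h2 hM0)

end Connected

section Limit

variable {d m : ℕ} {L : DefectLattice d}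

/-- A pointwise limit of gradient fields is a gradient field. -/
theorem exists_potential {ι : Type*} {l : Filter ι} [l.NeBot]
    (g : ∀ x : L.pts, L.range x → Eu m) (v : ι → Eu d → Eu m)
    (h : ∀ (x : L.pts) (ρ : L.range x),
      Tendsto (fun i => v i ((x : Eu d) + ρ) - v i x) l (𝓝 (g x ρ))) :
    ∃ f : L.pts → Eu m, ∀ x, grad f x = g x := by
  obtain ⟨x₀⟩ := L.connected.nonempty
  have hlim : ∀ y : L.pts, ∃ t, Tendsto (fun i => v i y - v i x₀) l (𝓝 t) := by
    refine connected_induction L.connected x₀ ⟨0, by simp⟩ ?_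
    rintro x y ⟨t, ht⟩ hxy
    have hmem : (y : Eu d) - x ∈ L.range x := mem_range.mpr ⟨by simp, hxy⟩
    refine ⟨t + g x ⟨_, hmem⟩, ?_⟩
    refine (ht.add (h x ⟨_, hmem⟩)).congr fun i => ?_
    simp
  choose f hf using hlim
  refine ⟨f, fun x => ?_⟩
  funext ρ
  have hy : (x : Eu d) + ρ ∈ L.pts := (mem_range.mp ρ.2).1
  have h1 := (hf ⟨_, hy⟩).sub (hf x)
  have h2 := h x ρ
  simp only [sub_sub_sub_cancel_right] at h1
  rw [grad_eq]
  simp only [extend_coe, extend_of_mem f hy]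
  exact tendsto_nhds_unique h1 h2

end Limit

/-! ### The Hilbert space of stencils and the second derivatives of the site energies -/

section GradientSpace

variable {d m : ℕ} {L : DefectLattice d}

/-- The Hilbert space of square-summable families of finite-difference stencils on the defective
lattice. Gradients of finite-energy displacements, and gradients on a supercell extended by zero,
are elements of this one space. -/
abbrev StencilSpace (L : DefectLattice d) (m : ℕ) : Type :=
  lp (fun x : L.pts => PiLp 2 fun _ : L.range x => Eu m) 2

theorem normSq_eq {R : Finset (Eu d)} (g : R → Eu m) :
    normSq g = ‖(WithLp.toLp 2 g : PiLp 2 fun _ : R => Eu m)‖ ^ 2 := by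
  rw [PiLp.norm_sq_eq_of_L2]; rfl

theorem dot_eq {R : Finset (Eu d)} (g h : R → Eu m) :
    dot g h = inner ℝ (WithLp.toLp 2 g : PiLp 2 fun _ : R => Eu m) (WithLp.toLp 2 h) := by
  rw [PiLp.inner_apply]; rfl

theorem norm_ofLp_le {R : Finset (Eu d)} (g : PiLp 2 fun _ : R => Eu m) : ‖g.ofLp‖ ≤ ‖g‖ :=
  (pi_norm_le_iff_of_nonneg (norm_nonneg _)).mpr fun ρ => PiLp.norm_apply_le g ρ

/-- A family of stencils with summable squared norms, as an element of the stencil space. -/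
def ofSummable (g : ∀ x : L.pts, L.range x → Eu m) (h : Summable fun x => normSq (g x)) :
    StencilSpace L m :=
  ⟨fun x => WithLp.toLp 2 (g x), by
    refine memℓp_gen ?_
    simpa [normSq_eq] using h⟩

theorem summable_normSq (g : StencilSpace L m) : Summable fun x => normSq (g x).ofLp := by
  have := (lp.memℓp g).summable (by norm_num)
  simpa [normSq_eq] using this

theorem norm_sq_eq_tsum (g : StencilSpace L m) : ‖g‖ ^ 2 = ∑' x, normSq (g x).ofLp := by
  rw [← real_inner_self_eq_norm_sq, lp.inner_eq_tsum]
  refine tsum_congr fun x => ?_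
  rw [real_inner_self_eq_norm_sq, normSq_eq]

/-- The gradient as a linear map into the stencil space. -/
def gradMap (L : DefectLattice d) (m : ℕ) : W12def L m →ₗ[ℝ] StencilSpace L m where
  toFun v := ofSummable (grad v.1) v.2
  map_add' v w := by
    refine Subtype.ext (funext fun x => ?_)
    exact congrArg (WithLp.toLp 2) (stencil_add _ _ _ _ _)
  map_smul' c v := by
    refine Subtype.ext (funext fun x => ?_)
    exact congrArg (WithLp.toLp 2) (stencil_smul _ _ _ _ _)

theorem gradMap_apply (v : W12def L m) (x : L.pts) :
    gradMap L m v x = WithLp.toLp 2 (grad v.1 x) := rfl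

theorem energyNorm_eq (v : W12def L m) : energyNorm v.1 = ‖gradMap L m v‖ := by
  rw [energyNorm, ← Real.sqrt_sq (norm_nonneg (gradMap L m v)), norm_sq_eq_tsum]
  rfl

theorem energyInner_eq (v w : W12def L m) :
    energyInner v.1 w.1 = inner ℝ (gradMap L m v) (gradMap L m w) := by
  rw [energyInner, lp.inner_eq_tsum]
  exact tsum_congr fun x => dot_eq _ _

theorem mem_W12def_of_grad_eq {f : L.pts → Eu m} {g : StencilSpace L m}
    (h : ∀ x, grad f x = (g x).ofLp) : ∃ hf : f ∈ W12def L m, gradMap L m ⟨f, hf⟩ = g := by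
  have hs : Summable fun x => normSq (grad f x) := by
    simpa only [h] using summable_normSq g
  refine ⟨hs, ?_⟩
  ext x : 2
  rw [gradMap_apply]
  simp [h]

/-- The differences along the edges, as continuous functionals, detect coordinatewise limits. -/
theorem tendsto_coord {ι : Type*} {l : Filter ι} {g : ι → StencilSpace L m} {q : StencilSpace L m}
    (h : ∀ f : StencilSpace L m →L[ℝ] ℝ, Tendsto (fun i => f (g i)) l (𝓝 (f q)))
    (x : L.pts) (ρ : L.range x) : Tendsto (fun i => (g i x).ofLp ρ) l (𝓝 ((q x).ofLp ρ)) := by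
  have hcont : Continuous fun y : Fin m → ℝ => (WithLp.toLp 2 y : Eu m) := by fun_prop
  have h1 : Tendsto (fun i => ((g i x).ofLp ρ).ofLp) l (𝓝 ((q x).ofLp ρ).ofLp) := by
    rw [tendsto_pi_nhds]
    intro j
    let f : StencilSpace L m →L[ℝ] ℝ := (EuclideanSpace.proj j).comp
      ((PiLp.proj 2 (fun _ : L.range x => Eu m) ρ).comp (lp.evalCLM ℝ _ 2 x))
    exact h f
  exact (hcont.tendsto _).comp h1

theorem isClosed_range_gradMap :
    IsClosed (LinearMap.range (gradMap L m) : Set (StencilSpace L m)) := by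
  refine isClosed_of_closure_subset fun q hq => ?_
  obtain ⟨g, hg, hl⟩ := mem_closure_iff_seq_limit.mp hq
  choose v hv using hg
  obtain ⟨f, hf⟩ := exists_potential (l := atTop) (fun x => (q x).ofLp)
    (fun n => extend L.pts (v n).1) (fun x ρ => by
      have := tendsto_coord (fun f => (f.continuous.tendsto q).comp hl) x ρ
      refine this.congr fun n => ?_
      rw [← hv n, gradMap_apply, grad_eq])
  obtain ⟨hf', he⟩ := mem_W12def_of_grad_eq hf
  exact ⟨⟨f, hf'⟩, he⟩

/-- The bounded bilinear form with a uniformly bounded family of blocks. -/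
theorem exists_blockForm
    (b : ∀ x : L.pts, (L.range x → Eu m) →L[ℝ] (L.range x → Eu m) →L[ℝ] ℝ) {M : ℝ}
    (hb : ∀ x, ‖b x‖ ≤ M) :
    ∃ B : StencilSpace L m →L[ℝ] StencilSpace L m →L[ℝ] ℝ,
      ∀ g h, HasSum (fun x => b x (g x).ofLp (h x).ofLp) (B g h) := by
  have hbd : ∀ (g h : StencilSpace L m) x, ‖b x (g x).ofLp (h x).ofLp‖ ≤ M * (‖g x‖ * ‖h x‖) := by
    intro g h x
    refine ((b x).le_opNorm₂ _ _).trans ?_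
    rw [mul_assoc]
    exact mul_le_mul (hb x) (mul_le_mul (norm_ofLp_le _) (norm_ofLp_le _) (norm_nonneg _)
      (norm_nonneg _)) (by positivity) ((b x).opNorm_nonneg.trans (hb x))
  have hprod : ∀ g h : StencilSpace L m, Summable (fun x => ‖g x‖ * ‖h x‖) ∧
      ∑' x, ‖g x‖ * ‖h x‖ ≤ ‖g‖ * ‖h‖ := fun g h => by
    have := lp.tsum_mul_le_mul_norm (p := 2) (q := 2)
      (by simpa using Real.HolderConjugate.two_two) g h
    exact this
  have hsum : ∀ g h : StencilSpace L m, Summable fun x => b x (g x).ofLp (h x).ofLp :=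
    fun g h => Summable.of_norm_bounded ((hprod g h).1.mul_left M) (hbd g h)
  let B₀ : StencilSpace L m →ₗ[ℝ] StencilSpace L m →ₗ[ℝ] ℝ :=
    LinearMap.mk₂ ℝ (fun g h => ∑' x, b x (g x).ofLp (h x).ofLp)
      (fun g g' h => by
        rw [← (hsum g h).tsum_add (hsum g' h)]
        refine tsum_congr fun x => ?_
        simp [map_add])
      (fun c g h => by
        rw [smul_eq_mul, ← tsum_mul_left]
        refine tsum_congr fun x => ?_
        simp)
      (fun g h h' => by
        rw [← (hsum g h).tsum_add (hsum g h')]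
        refine tsum_congr fun x => ?_
        simp [map_add])
      (fun c g h => by
        rw [smul_eq_mul, ← tsum_mul_left]
        refine tsum_congr fun x => ?_
        simp)
  refine ⟨B₀.mkContinuous₂ (max M 0) fun g h => ?_, fun g h => ?_⟩
  · have h1 : ‖B₀ g h‖ ≤ ∑' x, M * (‖g x‖ * ‖h x‖) :=
      tsum_of_norm_bounded ((hprod g h).1.mul_left M).hasSum (hbd g h)
    rw [tsum_mul_left] at h1
    have h2 : 0 ≤ ∑' x, ‖g x‖ * ‖h x‖ := tsum_nonneg fun x => by positivity
    calc ‖B₀ g h‖ ≤ M * ∑' x, ‖g x‖ * ‖h x‖ := h1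
      _ ≤ max M 0 * ∑' x, ‖g x‖ * ‖h x‖ := mul_le_mul_of_nonneg_right (le_max_left _ _) h2
      _ ≤ max M 0 * (‖g‖ * ‖h‖) := mul_le_mul_of_nonneg_left (hprod g h).2 (le_max_right _ _)
      _ = _ := by ring
  · exact (hsum g h).hasSum

end GradientSpace

section Hessian

variable {d m : ℕ} {L : DefectLattice d}

theorem exists_extension {R : Finset (Eu d)} (g : R → Eu m) :
    ∃ g' : Eu d → Eu m, (fun ρ : R => g' ρ) = g := by
  classical
  exact ⟨fun x => if h : x ∈ R then g ⟨x, h⟩ else 0, by funext ρ; simp⟩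

theorem hessian_congr {R R' : Finset (Eu d)} (hR : R = R') {V : (R → Eu m) → ℝ}
    {V' : (R' → Eu m) → ℝ} (hV : ∀ g : Eu d → Eu m, V (fun ρ => g ρ) = V' fun ρ => g ρ)
    (a b c : Eu d → Eu m) :
    hessian V (fun ρ => a ρ) (fun ρ => b ρ) (fun ρ => c ρ) =
      hessian V' (fun ρ => a ρ) (fun ρ => b ρ) (fun ρ => c ρ) := by
  subst hR
  have : V = V' := by
    funext g
    obtain ⟨g', rfl⟩ := exists_extension g
    exact hV g'
  rw [this]

theorem normSq_congr {R R' : Finset (Eu d)} (hR : R = R') (a : Eu d → Eu m) :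
    normSq (fun ρ : R => a ρ) = normSq fun ρ : R' => a ρ := by
  subst hR; rfl

theorem hessian_modulus_congr {R R' : Finset (Eu d)} (hR : R = R') {V : (R → Eu m) → ℝ}
    {V' : (R' → Eu m) → ℝ} (hV : ∀ g : Eu d → Eu m, V (fun ρ => g ρ) = V' fun ρ => g ρ) {ε δ : ℝ}
    (h : ∀ g : R' → Eu m, ‖g‖ ≤ δ → ‖fderiv ℝ (fderiv ℝ V') g - fderiv ℝ (fderiv ℝ V') 0‖ ≤ ε)
    (g : R → Eu m) (hg : ‖g‖ ≤ δ) : ‖fderiv ℝ (fderiv ℝ V) g - fderiv ℝ (fderiv ℝ V) 0‖ ≤ ε := by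
  subst hR
  have : V = V' := by
    funext g
    obtain ⟨g', rfl⟩ := exists_extension g
    exact hV g'
  rw [this]
  exact h g hg

variable (P : SiteEnergies L m)

theorem hessian_symm (x : L.pts) (g h k : L.range x → Eu m) :
    hessian (P.V x) g h k = hessian (P.V x) g k h := by
  have h1 : IsSymmSndFDerivAt ℝ (P.V x) g :=
    ((P.contDiff x).contDiffAt).isSymmSndFDerivAt (by simp; norm_num)
  exact h1 h k

theorem exists_norm_sub_le {E F : Type*} [NormedAddCommGroup E] [NormedAddCommGroup F] {f : E → F}
    (hf : Continuous f) {ε : ℝ} (hε : 0 < ε) : ∃ δ > 0, ∀ g : E, ‖g‖ ≤ δ → ‖f g - f 0‖ ≤ ε := by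
  obtain ⟨δ, hδ, h⟩ := Metric.continuousAt_iff.mp (hf.continuousAt (x := 0)) ε hε
  refine ⟨δ / 2, by positivity, fun g hg => ?_⟩
  have := h (x := g) (by rw [dist_zero_right]; linarith)
  rw [dist_eq_norm] at this
  exact this.le

theorem exists_modulus_snd_fderiv {E : Type*} [NormedAddCommGroup E] [NormedSpace ℝ E] {V : E → ℝ}
    (hV : ContDiff ℝ 4 V) {ε : ℝ} (hε : 0 < ε) : ∃ δ > 0, ∀ g : E, ‖g‖ ≤ δ →
      ‖fderiv ℝ (fderiv ℝ V) g - fderiv ℝ (fderiv ℝ V) 0‖ ≤ ε := by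
  have h1 : ContDiff ℝ 3 (fderiv ℝ V) := hV.fderiv_right (by norm_num)
  have h2 : Continuous (fderiv ℝ (fderiv ℝ V)) := h1.continuous_fderiv (by norm_num)
  exact exists_norm_sub_le (F := E →L[ℝ] E →L[ℝ] ℝ) h2 hε

/-- The hessians of the site energies are continuous at the origin, uniformly away from the
defect. -/
theorem exists_hessian_modulus {ε : ℝ} (hε : 0 < ε) :
    ∃ δ > 0, ∀ x : L.pts, L.rcut + L.Rdef < ‖(x : Eu d)‖ → ∀ g : L.range x → Eu m, ‖g‖ ≤ δ →
      ‖fderiv ℝ (fderiv ℝ (P.V x)) g - fderiv ℝ (fderiv ℝ (P.V x)) 0‖ ≤ ε := by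
  by_cases hex : ∃ x : L.pts, L.rcut + L.Rdef < ‖(x : Eu d)‖
  · obtain ⟨x₀, hx₀⟩ := hex
    obtain ⟨δ, hδ, h⟩ := exists_modulus_snd_fderiv (P.contDiff x₀) hε
    refine ⟨δ, hδ, fun x hx => ?_⟩
    have hR := (range_eq_rangeHom x.2 hx).trans (range_eq_rangeHom x₀.2 hx₀).symm
    refine hessian_modulus_congr hR (V := P.V x) (V' := P.V x₀)
      (fun g => (P.homogeneous x hx g).trans (P.homogeneous x₀ hx₀ g).symm) h
  · push Not at hex
    exact ⟨1, one_pos, fun x hx => absurd (hex x) (not_le.mpr hx)⟩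

/-- Far sites share the second derivative at the origin, so it is bounded uniformly. -/
theorem exists_hessian_zero_bound : ∃ M : ℝ, 0 ≤ M ∧ ∀ x : L.pts,
    L.rcut + L.Rdef < ‖(x : Eu d)‖ → ‖fderiv ℝ (fderiv ℝ (P.V x)) 0‖ ≤ M := by
  refine ⟨‖fderiv ℝ (fderiv ℝ P.Vhom) 0‖, ContinuousLinearMap.opNorm_nonneg _, fun x hx => ?_⟩
  have hR := range_eq_rangeHom x.2 hx
  have key : ∀ (R : Finset (Eu d)) (V : (R → Eu m) → ℝ), R = L.rangeHom →
      (∀ g : Eu d → Eu m, V (fun ρ => g ρ) = P.Vhom fun ρ => g ρ) →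
      ‖fderiv ℝ (fderiv ℝ V) 0‖ ≤ ‖fderiv ℝ (fderiv ℝ P.Vhom) 0‖ := by
    rintro R V rfl hV
    have : V = P.Vhom := by
      funext g
      obtain ⟨g', rfl⟩ := exists_extension g
      exact hV g'
    rw [this]
  exact key _ _ hR (P.homogeneous x hx)

theorem finite_sites_norm_le (r : ℝ) : {x : L.pts | ‖(x : Eu d)‖ ≤ r}.Finite := by
  have h := L.finite_inter (Metric.isBounded_closedBall (x := (0 : Eu d)) (r := r))
  refine Set.Finite.of_finite_image (h.subset ?_) Subtype.val_injective.injOn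
  rintro _ ⟨x, hx, rfl⟩
  exact ⟨x.2, by simpa using hx⟩

/-- Small gradients far away: the stencils of a square-summable family tend to zero. -/
theorem exists_norm_le_of_far (g : StencilSpace L m) {δ : ℝ} (hδ : 0 < δ) :
    ∃ S : ℝ, ∀ x : L.pts, S < ‖(x : Eu d)‖ → ‖(g x).ofLp‖ ≤ δ := by
  have h := (summable_normSq g).tendsto_cofinite_zero.eventually (gt_mem_nhds (pow_pos hδ 2))
  have hf : {x : L.pts | ¬ normSq (g x).ofLp < δ ^ 2}.Finite := h
  obtain ⟨S, hS⟩ := (hf.image fun x : L.pts => ‖(x : Eu d)‖).bddAbove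
  refine ⟨S, fun x hx => ?_⟩
  by_contra hcon
  have h1 : x ∈ {x : L.pts | ¬ normSq (g x).ofLp < δ ^ 2} := by
    intro h2
    have := sq_norm_le_normSq' (g x).ofLp
    exact hcon (abs_le_of_sq_le_sq' (this.trans h2.le) hδ.le).2
  exact absurd (hS ⟨x, h1, rfl⟩) (not_le.mpr hx)

theorem exists_hessian_bound (g : StencilSpace L m) :
    ∃ M : ℝ, ∀ x : L.pts, ‖fderiv ℝ (fderiv ℝ (P.V x)) (g x).ofLp‖ ≤ M := by
  obtain ⟨δ, hδ, h1⟩ := exists_hessian_modulus P one_pos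
  obtain ⟨M, -, h2⟩ := exists_hessian_zero_bound P
  obtain ⟨S, h3⟩ := exists_norm_le_of_far g hδ
  obtain ⟨M', hM'⟩ := ((finite_sites_norm_le (L := L) (max S (L.rcut + L.Rdef))).image
    fun x => ‖fderiv ℝ (fderiv ℝ (P.V x)) (g x).ofLp‖).bddAbove
  refine ⟨max M' (M + 1), fun x => ?_⟩
  by_cases hx : ‖(x : Eu d)‖ ≤ max S (L.rcut + L.Rdef)
  · exact (hM' ⟨x, hx, rfl⟩).trans (le_max_left _ _)
  · have hx' := max_lt_iff.mp (not_le.mp hx)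
    have h4 := h1 x hx'.2 _ (h3 x hx'.1)
    have h5 := norm_le_norm_add_norm_sub' (fderiv ℝ (fderiv ℝ (P.V x)) (g x).ofLp)
      (fderiv ℝ (fderiv ℝ (P.V x)) 0)
    have h6 := h2 x hx'.2
    exact (by linarith : _ ≤ M + 1).trans (le_max_right _ _)

end Hessian

/-! ### Translation bounds and a discrete Poincaré inequality -/

theorem sum_le_sum_of_injOn {α β : Type*} [DecidableEq β] (s : Finset α) (t : Finset β) (i : α → β)
    (hi : ∀ a ∈ s, i a ∈ t) (hinj : Set.InjOn i s) (F : α → ℝ) (G : β → ℝ)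
    (hFG : ∀ a ∈ s, F a ≤ G (i a)) (hG : ∀ b ∈ t, 0 ≤ G b) : ∑ a ∈ s, F a ≤ ∑ b ∈ t, G b := by
  calc ∑ a ∈ s, F a ≤ ∑ a ∈ s, G (i a) := Finset.sum_le_sum hFG
    _ = ∑ b ∈ s.image i, G b := (Finset.sum_image hinj).symm
    _ ≤ ∑ b ∈ t, G b := by
      refine Finset.sum_le_sum_of_subset_of_nonneg ?_ fun b hb _ => hG b hb
      exact Finset.image_subset_iff.mpr hi

section Translation

variable {d m : ℕ}

/-- The `ℓ²` norm of the difference of `f` and its translate by `h` is at most `K`. -/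
def TransBound (f : (Fin d → ℤ) → Eu m) (h : Fin d → ℤ) (K : ℝ) : Prop :=
  ∀ Z : Finset (Fin d → ℤ), Real.sqrt (∑ z ∈ Z, ‖f (z + h) - f z‖ ^ 2) ≤ K

theorem sqrt_sum_add_le {ι : Type*} (Z : Finset ι) (a b c : ι → ℝ)
    (hc : ∀ i, 0 ≤ c i) (habc : ∀ i, c i ≤ a i + b i) :
    Real.sqrt (∑ i ∈ Z, c i ^ 2) ≤
      Real.sqrt (∑ i ∈ Z, a i ^ 2) + Real.sqrt (∑ i ∈ Z, b i ^ 2) := by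
  have hn : ∀ w : ι → ℝ, Real.sqrt (∑ i ∈ Z, w i ^ 2) =
      ‖(WithLp.toLp 2 fun i : Z => w i : EuclideanSpace ℝ Z)‖ := by
    intro w
    rw [EuclideanSpace.norm_eq, ← Finset.sum_coe_sort Z fun i => w i ^ 2]
    simp
  have h1 : Real.sqrt (∑ i ∈ Z, c i ^ 2) ≤ Real.sqrt (∑ i ∈ Z, (a i + b i) ^ 2) :=
    Real.sqrt_le_sqrt (Finset.sum_le_sum fun i _ => pow_le_pow_left₀ (hc i) (habc i) 2)
  refine h1.trans ?_
  rw [hn, hn, hn]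
  exact norm_add_le (WithLp.toLp 2 fun i : Z => a i : EuclideanSpace ℝ Z)
    (WithLp.toLp 2 fun i : Z => b i)

theorem TransBound.nonneg {f : (Fin d → ℤ) → Eu m} {h : Fin d → ℤ} {K : ℝ}
    (hf : TransBound f h K) : 0 ≤ K := (Real.sqrt_nonneg _).trans (hf ∅)

theorem TransBound.zero (f : (Fin d → ℤ) → Eu m) : TransBound f 0 0 := by
  intro Z; simp

theorem TransBound.mono {f : (Fin d → ℤ) → Eu m} {h : Fin d → ℤ} {K K' : ℝ}
    (hf : TransBound f h K) (hK : K ≤ K') : TransBound f h K' := fun Z => (hf Z).trans hK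

theorem TransBound.sum_le {f : (Fin d → ℤ) → Eu m} {h : Fin d → ℤ} {K : ℝ}
    (hf : TransBound f h K) (Z : Finset (Fin d → ℤ)) : ∑ z ∈ Z, ‖f (z + h) - f z‖ ^ 2 ≤ K ^ 2 :=
  (Real.sqrt_le_left hf.nonneg).mp (hf Z)

theorem TransBound.add {f : (Fin d → ℤ) → Eu m} {h h' : Fin d → ℤ} {K K' : ℝ}
    (hf : TransBound f h K) (hf' : TransBound f h' K') : TransBound f (h + h') (K + K') := by
  intro Z
  have h1 := sqrt_sum_add_le Z (fun z => ‖f (z + h + h') - f (z + h)‖) (fun z => ‖f (z + h) - f z‖)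
    (fun z => ‖f (z + (h + h')) - f z‖) (fun _ => norm_nonneg _)
    fun z => by
      have := norm_add_le (f (z + h + h') - f (z + h)) (f (z + h) - f z)
      rw [sub_add_sub_cancel] at this
      rwa [← add_assoc]
  have h2 := hf' (Z.map (addRightEmbedding h))
  rw [Finset.sum_map] at h2
  simp only [addRightEmbedding_apply] at h2
  linarith [hf Z]

theorem TransBound.neg {f : (Fin d → ℤ) → Eu m} {h : Fin d → ℤ} {K : ℝ}
    (hf : TransBound f h K) : TransBound f (-h) K := by
  intro Z
  have h2 := hf (Z.map (addRightEmbedding (-h)))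
  rw [Finset.sum_map] at h2
  simp only [addRightEmbedding_apply, neg_add_cancel_right] at h2
  simpa only [norm_sub_rev] using h2

theorem TransBound.zsmul {f : (Fin d → ℤ) → Eu m} {h : Fin d → ℤ} {K : ℝ}
    (hf : TransBound f h K) (n : ℤ) : TransBound f (n • h) (|(n : ℝ)| * K) := by
  have hnat : ∀ n : ℕ, TransBound f (n • h) (n * K) := by
    intro n
    induction n with
    | zero => simpa using TransBound.zero f
    | succ n ih =>
      have := ih.add hf
      rw [succ_nsmul]
      push_cast
      rwa [add_mul, one_mul]
  obtain ⟨k, rfl | rfl⟩ := n.eq_nat_or_neg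
  · simpa using hnat k
  · have := (hnat k).neg
    simpa using this

theorem TransBound.sum {f : (Fin d → ℤ) → Eu m} {ι : Type*} (s : Finset ι) (h : ι → Fin d → ℤ)
    (K : ι → ℝ) (hf : ∀ i ∈ s, TransBound f (h i) (K i)) :
    TransBound f (∑ i ∈ s, h i) (∑ i ∈ s, K i) := by
  classical
  induction s using Finset.induction_on with
  | empty => simpa using TransBound.zero f
  | insert i s hi ih =>
    rw [Finset.sum_insert hi, Finset.sum_insert hi]
    exact (hf i (Finset.mem_insert_self _ _)).add
      (ih fun j hj => hf j (Finset.mem_insert_of_mem hj))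

/-- Bounds for the unit translations give bounds for all translations. -/
theorem TransBound.of_single {f : (Fin d → ℤ) → Eu m} {K : ℝ}
    (hf : ∀ i, TransBound f (Pi.single i 1) K) (h : Fin d → ℤ) : TransBound f h (d * K * ‖h‖) := by
  rcases Nat.eq_zero_or_pos d with rfl | hd
  · rw [Subsingleton.elim h 0]; simpa using TransBound.zero f
  have hK : 0 ≤ K := (hf ⟨0, hd⟩).nonneg
  have h1 := TransBound.sum (f := f) Finset.univ (fun i => h i • Pi.single (M := fun _ => ℤ) i 1)
    (fun i => |(h i : ℝ)| * K) fun i _ => (hf i).zsmul _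
  have h2 : ∑ i, h i • Pi.single (M := fun _ => ℤ) i 1 = h := by
    conv_rhs => rw [← Finset.univ_sum_single h]
    refine Finset.sum_congr rfl fun i _ => ?_
    rw [← Pi.single_smul]; simp
  rw [h2] at h1
  refine h1.mono ?_
  have h3 : ∀ i ∈ Finset.univ, |(h i : ℝ)| * K ≤ ‖h‖ * K := fun i _ => by
    refine mul_le_mul_of_nonneg_right ?_ hK
    simpa [Int.norm_eq_abs] using norm_le_pi_norm h i
  refine (Finset.sum_le_sum h3).trans ?_
  simp only [Finset.sum_const, Finset.card_univ, Fintype.card_fin, nsmul_eq_mul]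
  exact le_of_eq (by ring)

/-- The box `{-k, …, k}^d`. -/
def box (d k : ℕ) : Finset (Fin d → ℤ) := Finset.Icc (fun _ => -(k : ℤ)) fun _ => (k : ℤ)

theorem mem_box {k : ℕ} {z : Fin d → ℤ} : z ∈ box d k ↔ ‖z‖ ≤ k := by
  rw [box, Finset.mem_Icc, pi_norm_le_iff_of_nonneg (Nat.cast_nonneg k), Pi.le_def, Pi.le_def,
    ← forall_and]
  refine forall_congr' fun i => ?_
  rw [← abs_le, Int.norm_eq_abs, ← Int.cast_abs]
  exact_mod_cast Iff.rfl

theorem card_box (d k : ℕ) : (box d k).card = (2 * k + 1) ^ d := by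
  rw [box, Pi.card_Icc]
  simp only [Int.card_Icc, Finset.prod_const, Finset.card_univ, Fintype.card_fin]
  congr 1; omega

/-- The Poincaré inequality on boxes, by averaging over translations. -/
theorem exists_mean_bound {f : (Fin d → ℤ) → Eu m} {K : ℝ}
    (hf : ∀ h, TransBound f h (K * ‖h‖)) (k : ℕ) :
    ∃ a : Eu m, ∑ z ∈ box d k, ‖f z - a‖ ^ 2 ≤ 2 ^ d * (K * (2 * k)) ^ 2 := by
  set Q := box d k with hQ
  set n : ℝ := (Q.card : ℝ) with hn
  have hn1 : n = (2 * k + 1 : ℝ) ^ d := by rw [hn, hQ, card_box]; push_cast; rfl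
  have hn0 : 0 < n := by rw [hn1]; positivity
  refine ⟨n⁻¹ • ∑ z' ∈ Q, f z', ?_⟩
  have h1 : ∀ z, ‖f z - n⁻¹ • ∑ z' ∈ Q, f z'‖ ^ 2 ≤ n⁻¹ * ∑ z' ∈ Q, ‖f z' - f z‖ ^ 2 := by
    intro z
    have e1 : f z - n⁻¹ • ∑ z' ∈ Q, f z' = n⁻¹ • ∑ z' ∈ Q, (f z - f z') := by
      rw [Finset.sum_sub_distrib, Finset.sum_const, smul_sub, ← Nat.cast_smul_eq_nsmul ℝ, smul_smul,
        inv_mul_cancel₀ hn0.ne', one_smul]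
    rw [e1, norm_smul, mul_pow, norm_inv, Real.norm_of_nonneg hn0.le]
    have e2 : ‖∑ z' ∈ Q, (f z - f z')‖ ^ 2 ≤ n * ∑ z' ∈ Q, ‖f z' - f z‖ ^ 2 := by
      calc _ ≤ (∑ z' ∈ Q, ‖f z' - f z‖) ^ 2 := by
            refine pow_le_pow_left₀ (norm_nonneg _) ?_ 2
            refine (norm_sum_le _ _).trans (le_of_eq ?_)
            simp only [norm_sub_rev]
        _ ≤ _ := sq_sum_le_card_mul_sum_sq
    calc n⁻¹ ^ 2 * ‖∑ z' ∈ Q, (f z - f z')‖ ^ 2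
        ≤ n⁻¹ ^ 2 * (n * ∑ z' ∈ Q, ‖f z' - f z‖ ^ 2) :=
          mul_le_mul_of_nonneg_left e2 (by positivity)
      _ = _ := by field_simp
  have h2 : ∀ z ∈ Q, ∑ z' ∈ Q, ‖f z' - f z‖ ^ 2 ≤ ∑ h ∈ box d (2 * k), ‖f (z + h) - f z‖ ^ 2 := by
    intro z hz
    refine sum_le_sum_of_injOn _ _ (fun z' => z' - z) (fun z' hz' => ?_)
      (fun a _ b _ hab => by simpa using hab) _ _ (fun z' _ => by simp) fun _ _ => sq_nonneg _
    rw [mem_box]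
    refine (norm_sub_le _ _).trans ?_
    have e1 := mem_box.mp hz
    have e2 := mem_box.mp hz'
    push_cast; linarith
  calc ∑ z ∈ Q, ‖f z - n⁻¹ • ∑ z' ∈ Q, f z'‖ ^ 2
      ≤ ∑ z ∈ Q, n⁻¹ * ∑ h ∈ box d (2 * k), ‖f (z + h) - f z‖ ^ 2 :=
        Finset.sum_le_sum fun z hz =>
          (h1 z).trans (mul_le_mul_of_nonneg_left (h2 z hz) (by positivity))
    _ = n⁻¹ * ∑ h ∈ box d (2 * k), ∑ z ∈ Q, ‖f (z + h) - f z‖ ^ 2 := by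
        rw [← Finset.mul_sum, Finset.sum_comm]
    _ ≤ n⁻¹ * ∑ h ∈ box d (2 * k), (K * (2 * k)) ^ 2 := by
        refine mul_le_mul_of_nonneg_left (Finset.sum_le_sum fun h hh => ?_) (by positivity)
        have e1 := mem_box.mp hh
        push_cast at e1
        have e2 := (hf h).sum_le Q
        by_cases hK : 0 ≤ K
        · exact e2.trans (pow_le_pow_left₀ (hf h).nonneg (mul_le_mul_of_nonneg_left e1 hK) 2)
        · have e3 := (hf h).nonneg
          have e4 : ‖h‖ = 0 := by
            by_contra hne
            have : 0 < ‖h‖ := lt_of_le_of_ne (norm_nonneg _) (Ne.symm hne)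
            nlinarith
          rw [e4, mul_zero] at e2
          refine e2.trans ?_
          simpa using sq_nonneg (K * (2 * (k : ℝ)))
    _ ≤ 2 ^ d * (K * (2 * k)) ^ 2 := by
        rw [Finset.sum_const, card_box, nsmul_eq_mul, ← mul_assoc]
        refine mul_le_mul_of_nonneg_right ?_ (sq_nonneg _)
        rw [inv_mul_le_iff₀ hn0, hn1, ← mul_pow]
        push_cast
        refine pow_le_pow_left₀ (by positivity) ?_ d
        linarith

end Translation

/-! ### Density of compactly supported displacements -/

section Density

variable {d m : ℕ} {L : DefectLattice d}

/-- The point of the host lattice with given integer coordinates. -/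
def latPt (L : DefectLattice d) (z : Fin d → ℤ) : Eu d := mulE L.A fun i => (z i : ℝ)

theorem latPt_mem (z : Fin d → ℤ) : latPt L z ∈ L.hom := ⟨z, rfl⟩

theorem latPt_add (z w : Fin d → ℤ) : latPt L (z + w) = latPt L z + latPt L w := by
  simp only [latPt, ← mulE_add]; congr 1; ext i; simp

theorem latPt_sub (z w : Fin d → ℤ) : latPt L (z - w) = latPt L z - latPt L w := by
  simp only [latPt, ← mulE_sub]; congr 1; ext i; simp

theorem latPt_zero : latPt L 0 = 0 := by
  have := latPt_sub (L := L) 0 0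
  rwa [sub_self, sub_self] at this

theorem latPt_injective : Function.Injective (latPt L) := by
  intro z w h
  have := mulE_inj L.det_ne_zero h
  ext i
  exact_mod_cast congrFun this i

theorem norm_inv_latPt (z : Fin d → ℤ) : ‖L.A⁻¹ *ᵥ (latPt L z).ofLp‖ = ‖z‖ := by
  rw [latPt, inv_mulVec_mulE L.det_ne_zero, Pi.norm_def, Pi.norm_def]
  congr 2

theorem norm_sub_le_gradMap (v : W12def L m) (x : L.pts) {ρ : Eu d} (hρ : ρ ∈ L.range x) :
    ‖extend L.pts v.1 (x + ρ) - extend L.pts v.1 x‖ ^ 2 ≤ normSq (grad v.1 x) := by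
  have h := sq_norm_le_normSq (grad v.1 x) ⟨ρ, hρ⟩
  rwa [grad_eq] at h ⊢

theorem normSq_grad_le (v : W12def L m) (x : L.pts) : normSq (grad v.1 x) ≤ ‖gradMap L m v‖ ^ 2 := by
  rw [norm_sq_eq_tsum]
  exact (summable_normSq (gradMap L m v)).le_tsum x fun _ _ => normSq_nonneg _

theorem sum_normSq_grad_le (v : W12def L m) (s : Finset L.pts) :
    ∑ x ∈ s, normSq (grad v.1 x) ≤ ‖gradMap L m v‖ ^ 2 := by
  rw [norm_sq_eq_tsum]
  exact (summable_normSq (gradMap L m v)).sum_le_tsum s fun _ _ => normSq_nonneg _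

theorem edge_le_gradMap (v : W12def L m) (x y : L.pts) (h : ‖(y : Eu d) - x‖ < L.rcut) :
    ‖extend L.pts v.1 y - extend L.pts v.1 x‖ ≤ ‖gradMap L m v‖ := by
  have h1 := norm_sub_le_gradMap v x (ρ := y - x) (mem_range.mpr ⟨by simp, h⟩)
  rw [add_sub_cancel] at h1
  exact le_of_sq_le_sq (h1.trans (normSq_grad_le v x)) (norm_nonneg _)

/-- A displacement of the defective lattice in the integer coordinates of the host lattice, with
the value at a reference site `x₀` in the core. -/
def latFun (L : DefectLattice d) (x₀ : L.pts) (v : L.pts → Eu m) (z : Fin d → ℤ) : Eu m :=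
  if ‖latPt L z‖ < L.Rdef then v x₀ else extend L.pts v (latPt L z)

/-- The oscillation over a bounded region of a finite-energy displacement. -/
theorem exists_local_osc (x₀ : L.pts) (r : ℝ) : ∃ K : ℝ, 0 ≤ K ∧ ∀ (v : W12def L m) (y : L.pts),
    ‖(y : Eu d)‖ ≤ r → ‖extend L.pts v.1 y - extend L.pts v.1 x₀‖ ≤ K * ‖gradMap L m v‖ := by
  obtain ⟨Z, K, hK, h⟩ := exists_osc_bound (m := m) L.connected x₀
    (finite_sites_norm_le (L := L) r).toFinset
  refine ⟨K, hK, fun v y hy => h _ _ (norm_nonneg _) (fun x _ y hxy => ?_) y (by simpa using hy)⟩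
  exact edge_le_gradMap v x y hxy

/-- Translations along short bonds: away from the core the differences are among those of `v`, and
near the core the oscillation is bounded by the energy norm. -/
theorem exists_transBound_of_short (x₀ : L.pts) : ∃ K : ℝ, 0 ≤ K ∧ ∀ (v : W12def L m)
    (ζ : Fin d → ℤ), ‖latPt L ζ‖ < L.rcut →
      TransBound (latFun L x₀ v.1) ζ (K * ‖gradMap L m v‖) := by
  classical
  obtain ⟨K, hK, hosc⟩ := exists_local_osc (m := m) x₀ (L.Rdef + 2 * L.rcut)
  obtain ⟨C, hC, hA⟩ := exists_norm_inv_mulVec_le L.A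
  set k := ⌈C * (L.Rdef + L.rcut)⌉₊ with hk
  refine ⟨Real.sqrt (1 + (box d k).card * (2 * K) ^ 2), Real.sqrt_nonneg _, fun v ζ hζ Z => ?_⟩
  set f := latFun L x₀ v.1 with hf
  set M := ‖gradMap L m v‖ with hM
  have hM0 : 0 ≤ M := norm_nonneg _
  have hr := L.rcut_pos
  have hfosc : ∀ z, ‖latPt L z‖ ≤ L.Rdef + 2 * L.rcut → ‖f z - extend L.pts v.1 x₀‖ ≤ K * M := by
    intro z hz
    simp only [hf, latFun]
    split_ifs with h
    · simp only [extend_coe, sub_self, norm_zero]; positivity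
    · exact hosc v ⟨latPt L z, (mem_pts_iff (not_lt.mp h)).mpr (latPt_mem z)⟩ hz
  have hnear : ∀ z, ‖latPt L z‖ ≤ L.Rdef + L.rcut → ‖f (z + ζ) - f z‖ ^ 2 ≤ (2 * K * M) ^ 2 := by
    intro z hz
    refine pow_le_pow_left₀ (norm_nonneg _) ?_ 2
    have h1 := hfosc z (by linarith)
    have h2 := hfosc (z + ζ) (by
      rw [latPt_add]; refine (norm_add_le _ _).trans ?_; linarith)
    have h3 := norm_sub_le (f (z + ζ) - extend L.pts v.1 x₀) (f z - extend L.pts v.1 x₀)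
    rw [sub_sub_sub_cancel_right] at h3
    linarith
  rw [← Finset.sum_filter_add_sum_filter_not Z (fun z => ‖latPt L z‖ ≤ L.Rdef + L.rcut)]
  have h1 : ∑ z ∈ Z with ‖latPt L z‖ ≤ L.Rdef + L.rcut, ‖f (z + ζ) - f z‖ ^ 2 ≤
      ∑ z ∈ box d k, (2 * K * M) ^ 2 := by
    refine sum_le_sum_of_injOn _ _ id (fun z hz => ?_) Function.injective_id.injOn _ _
      (fun z hz => hnear z (Finset.mem_filter.mp hz).2) fun _ _ => sq_nonneg _
    rw [id, mem_box, ← norm_inv_latPt (L := L)]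
    refine (hA _).trans ((mul_le_mul_of_nonneg_left (Finset.mem_filter.mp hz).2 hC.le).trans ?_)
    exact Nat.le_ceil _
  let i : (Fin d → ℤ) → L.pts := fun z => if h : latPt L z ∈ L.pts then ⟨_, h⟩ else x₀
  have hi : ∀ z, ¬ ‖latPt L z‖ ≤ L.Rdef + L.rcut → (i z : Eu d) = latPt L z := by
    intro z hz
    have : latPt L z ∈ L.pts := (mem_pts_iff (by linarith [not_le.mp hz])).mpr (latPt_mem z)
    simp [i, this]
  have h2 : ∑ z ∈ Z with ¬ ‖latPt L z‖ ≤ L.Rdef + L.rcut, ‖f (z + ζ) - f z‖ ^ 2 ≤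
      ∑ x ∈ (Z.filter fun z => ¬ ‖latPt L z‖ ≤ L.Rdef + L.rcut).image i, normSq (grad v.1 x) := by
    refine sum_le_sum_of_injOn _ _ i (fun z hz => Finset.mem_image_of_mem _ hz) ?_ _ _
      (fun z hz => ?_) fun _ _ => normSq_nonneg _
    · intro a ha b hb hab
      have ea := hi a (Finset.mem_filter.mp ha).2
      have eb := hi b (Finset.mem_filter.mp hb).2
      rw [hab, eb] at ea
      exact (latPt_injective ea).symm
    · have hz' := (Finset.mem_filter.mp hz).2
      have e := hi z hz'
      have hfar := not_le.mp hz'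
      have hfar2 : L.Rdef < ‖latPt L z + latPt L ζ‖ := by
        have := norm_sub_le (latPt L z + latPt L ζ) (latPt L ζ)
        rw [add_sub_cancel_right] at this
        linarith
      have e1 : f z = extend L.pts v.1 (i z) := by
        simp only [hf, latFun]
        rw [if_neg (by linarith), e]
      have e2 : f (z + ζ) = extend L.pts v.1 (i z + latPt L ζ) := by
        simp only [hf, latFun, latPt_add]
        rw [if_neg (by linarith), e]
      rw [e1, e2]
      refine norm_sub_le_gradMap v (i z) (mem_range.mpr ⟨?_, hζ⟩)
      rw [e, mem_pts_iff hfar2.le, ← latPt_add]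
      exact latPt_mem _
  have h3 := h2.trans (sum_normSq_grad_le v _)
  rw [Finset.sum_const, nsmul_eq_mul] at h1
  have h4 : Real.sqrt (1 + (box d k).card * (2 * K) ^ 2) * M =
      Real.sqrt ((1 + (box d k).card * (2 * K) ^ 2) * M ^ 2) := by
    rw [Real.sqrt_mul (by positivity), Real.sqrt_sq hM0]
  rw [h4]
  refine Real.sqrt_le_sqrt ?_
  calc _ ≤ (box d k).card * (2 * K * M) ^ 2 + M ^ 2 := add_le_add h1 h3
    _ = _ := by ring

/-- All translations, composed of translations along bonds, which generate the host lattice by its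
connectedness. -/
theorem exists_transBound (x₀ : L.pts) : ∃ K : ℝ, 0 ≤ K ∧ ∀ (v : W12def L m) (h : Fin d → ℤ),
    TransBound (latFun L x₀ v.1) h (K * ‖gradMap L m v‖ * ‖h‖) := by
  obtain ⟨K₀, hK₀, hshort⟩ := exists_transBound_of_short (m := m) x₀
  have hone : ∀ y : L.hom, ∃ C : ℝ, 0 ≤ C ∧ ∀ z, latPt L z = y → ∀ v : W12def L m,
      TransBound (latFun L x₀ v.1) z (C * ‖gradMap L m v‖) := by
    refine connected_induction L.connected_hom ⟨0, zero_mem_latticePts _⟩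
      ⟨0, le_rfl, fun z hz v => ?_⟩ ?_
    · have : z = 0 := latPt_injective (L := L) (by rw [hz, latPt_zero])
      rw [this, zero_mul]; exact TransBound.zero _
    · rintro x y ⟨C, hC, hx⟩ hxy
      refine ⟨C + K₀, by positivity, fun z hz v => ?_⟩
      obtain ⟨w, hw⟩ := x.2
      have hw' : latPt L w = x := hw
      have h1 := hx w hw' v
      have h2 := hshort v (z - w) (by rw [latPt_sub, hz, hw']; exact hxy)
      have := h1.add h2
      rwa [add_sub_cancel, ← add_mul] at this
  choose C hC h using hone
  refine ⟨d * ∑ i : Fin d, C ⟨latPt L (Pi.single i 1), latPt_mem _⟩,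
    mul_nonneg (Nat.cast_nonneg _) (Finset.sum_nonneg fun i _ => hC _), fun v z => ?_⟩
  have := TransBound.of_single (f := latFun L x₀ v.1)
    (K := (∑ i : Fin d, C ⟨latPt L (Pi.single i 1), latPt_mem _⟩) * ‖gradMap L m v‖) (fun i => by
      refine (h ⟨latPt L (Pi.single i 1), latPt_mem _⟩ _ rfl v).mono ?_
      refine mul_le_mul_of_nonneg_right ?_ (norm_nonneg _)
      exact Finset.single_le_sum (f := fun i => C ⟨latPt L (Pi.single i 1), latPt_mem _⟩)
        (fun i _ => hC _) (Finset.mem_univ i)) z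
  rwa [← mul_assoc] at this

/-- Displacements that vanish away from a bounded set. -/
def compactSupp (L : DefectLattice d) (m : ℕ) : Submodule ℝ (W12def L m) where
  carrier := {v | ∃ r : ℝ, ∀ x : L.pts, r < ‖(x : Eu d)‖ → v.1 x = 0}
  zero_mem' := ⟨0, fun _ _ => rfl⟩
  add_mem' := by
    rintro v w ⟨r, hr⟩ ⟨s, hs⟩
    refine ⟨max r s, fun x hx => ?_⟩
    simp [hr x ((le_max_left _ _).trans_lt hx), hs x ((le_max_right _ _).trans_lt hx)]
  smul_mem' := by
    rintro c v ⟨r, hr⟩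
    exact ⟨r, fun x hx => by simp [hr x hx]⟩

theorem grad_eq_zero {v : L.pts → Eu m} {r : ℝ} (hv : ∀ x : L.pts, r < ‖(x : Eu d)‖ → v x = 0)
    {x : L.pts} (hx : r + L.rcut < ‖(x : Eu d)‖) : grad v x = 0 := by
  rw [grad_eq]
  funext ρ
  have hρ := mem_range.mp ρ.2
  have h1 : r < ‖(x : Eu d) + ρ‖ := by
    have := norm_sub_le ((x : Eu d) + ρ) ρ
    rw [add_sub_cancel_right] at this
    linarith
  simp [extend_coe, extend_of_mem v hρ.1, hv ⟨_, hρ.1⟩ h1, hv x (by linarith [L.rcut_pos])]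

/-- Functions that vanish away from a bounded set have finite energy. -/
theorem mem_W12def_of_bounded {v : L.pts → Eu m} {r : ℝ}
    (hv : ∀ x : L.pts, r < ‖(x : Eu d)‖ → v x = 0) : v ∈ W12def L m := by
  refine summable_of_hasFiniteSupport ((finite_sites_norm_le (L := L) (r + L.rcut)).subset ?_)
  intro x hx
  by_contra hcon
  exact hx (by
    have := grad_eq_zero hv (not_le.mp hcon)
    rw [grad] at this
    simp [this, normSq])

/-- The radial cut-off at scale `k`, in the coordinates of the host lattice. -/
def radialCutoff (L : DefectLattice d) (k : ℝ) (x : Eu d) : ℝ :=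
  max 0 (min 1 (2 - ‖L.A⁻¹ *ᵥ x.ofLp‖ / k))

/-- The discrete product rule. -/
theorem grad_smul_sub (v : L.pts → Eu m) (χ : Eu d → ℝ) (a : Eu m) (x : L.pts) (ρ : L.range x) :
    grad (fun y : L.pts => χ y • (v y - a)) x ρ =
      χ (x + ρ) • grad v x ρ + (χ (x + ρ) - χ x) • (v x - a) := by
  have hρ := (mem_range.mp ρ.2).1
  simp only [grad_eq, extend_coe, extend_of_mem _ hρ]
  module

theorem norm_sq_smul_add_le (b e : ℝ) (hb : |b| ≤ 1) (p q : Eu m) :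
    ‖b • p + e • q‖ ^ 2 ≤ 2 * ‖p‖ ^ 2 + 2 * (e ^ 2 * ‖q‖ ^ 2) := by
  have h1 := norm_add_le (b • p) (e • q)
  rw [norm_smul, norm_smul, Real.norm_eq_abs, Real.norm_eq_abs] at h1
  have h2 : |b| * ‖p‖ ≤ ‖p‖ := mul_le_of_le_one_left (norm_nonneg _) hb
  have h3 : ‖b • p + e • q‖ ^ 2 ≤ (‖p‖ + |e| * ‖q‖) ^ 2 :=
    pow_le_pow_left₀ (norm_nonneg _) (by linarith) 2
  have h4 : (|e| * ‖q‖) ^ 2 = e ^ 2 * ‖q‖ ^ 2 := by rw [mul_pow, sq_abs]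
  nlinarith [sq_nonneg (‖p‖ - |e| * ‖q‖)]

/-- Cutting off at scale `k` is bounded in energy, uniformly in `k`. -/
theorem exists_cutoff_bound (L : DefectLattice d) (m : ℕ) : ∃ (K c : ℝ) (k₀ : ℕ), 0 ≤ K ∧
    ∀ (v : W12def L m) (k : ℕ), k₀ ≤ k →
      ∃ p ∈ (compactSupp L m).map (gradMap L m), ‖p‖ ≤ K * ‖gradMap L m v‖ ∧
        ∀ x : L.pts, c * (‖(x : Eu d)‖ + L.rcut) ≤ k → p x = gradMap L m v x := by
  classical
  obtain ⟨x₀⟩ := L.connected.nonempty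
  obtain ⟨T, hT, htrans⟩ := exists_transBound (m := m) x₀
  obtain ⟨C, hC, hA⟩ := exists_norm_inv_mulVec_le L.A
  have hr := L.rcut_pos
  have hR := L.Rdef_pos
  set c := C * L.rcut with hc
  have hcp : 0 < c := by positivity
  obtain ⟨k₀, hk₀⟩ := exists_nat_gt (C * (L.rcut + L.Rdef) + 2 * c)
  set n : ℝ := (L.rangeHom.card : ℝ) with hn
  refine ⟨Real.sqrt (2 + 2 * (n * c ^ 2) * (2 ^ d * (T * 6) ^ 2)), C, k₀, Real.sqrt_nonneg _,
    fun v k hk => ?_⟩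
  set M := ‖gradMap L m v‖ with hM
  have hM0 : 0 ≤ M := norm_nonneg _
  have hk' : C * (L.rcut + L.Rdef) + 2 * c < k := hk₀.trans_le (by exact_mod_cast hk)
  have hk0 : (0 : ℝ) < k := lt_of_le_of_lt (by positivity) hk'
  have hck : c < k := by
    have : 0 < C * (L.rcut + L.Rdef) := by positivity
    linarith
  set N : Eu d → ℝ := fun x => ‖L.A⁻¹ *ᵥ x.ofLp‖ with hN
  have hNsub : ∀ x y : Eu d, |N x - N y| ≤ C * ‖x - y‖ := by
    intro x y
    refine (abs_norm_sub_norm_le _ _).trans ?_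
    rw [← Matrix.mulVec_sub]
    exact hA (x - y)
  set χ := radialCutoff L k with hχ
  have hχ01 : ∀ x, |χ x| ≤ 1 := by
    intro x
    rw [abs_le]
    have h0 : 0 ≤ χ x := le_max_left _ _
    exact ⟨by linarith, max_le zero_le_one (min_le_left _ _)⟩
  have hχ1 : ∀ x, N x ≤ k → χ x = 1 := by
    intro x hx
    have : N x / k ≤ 1 := (div_le_one hk0).mpr hx
    simp only [hχ, radialCutoff]
    rw [min_eq_left (by simp only [hN] at this; linarith), max_eq_right zero_le_one]
  have hχ0 : ∀ x, 2 * k ≤ N x → χ x = 0 := by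
    intro x hx
    have : 2 ≤ N x / k := (le_div_iff₀ hk0).mpr hx
    simp only [hχ, radialCutoff]
    refine max_eq_left ((min_le_right _ _).trans ?_)
    simp only [hN] at this; linarith
  have hχL : ∀ x y, |χ x - χ y| ≤ C * ‖x - y‖ / k := by
    intro x y
    have h1 : |χ x - χ y| ≤ |N x - N y| / k := by
      have e1 := abs_max_sub_max_le_abs (min 1 (2 - N x / k)) (min 1 (2 - N y / k)) 0
      have e2 := abs_min_sub_min_le_max 1 (2 - N x / k) 1 (2 - N y / k)
      rw [max_comm _ (0 : ℝ), max_comm _ (0 : ℝ)] at e1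
      have e3 : |(2 - N x / k) - (2 - N y / k)| = |N x - N y| / k := by
        rw [show (2 - N x / k) - (2 - N y / k) = (N y - N x) / k by ring, abs_div, abs_sub_comm,
          abs_of_pos hk0]
      rw [sub_self, abs_zero, e3, max_eq_right (by positivity)] at e2
      exact e1.trans e2
    exact h1.trans (div_le_div_of_nonneg_right (hNsub x y) hk0.le)
  obtain ⟨a, ha⟩ := exists_mean_bound (fun h => htrans v h) (3 * k)
  set p₀ : L.pts → Eu m := fun y => χ y • (v.1 y - a) with hp₀
  obtain ⟨C', hC', hA'⟩ := exists_norm_mulE_le L.A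
  have hsupp : ∀ x : L.pts, C' * (2 * k) < ‖(x : Eu d)‖ → p₀ x = 0 := by
    intro x hx
    have h1 := hA' (L.A⁻¹ *ᵥ (x : Eu d).ofLp)
    rw [mulE_inv L.det_ne_zero] at h1
    have h2 : 2 * k ≤ N x := by
      by_contra hcon
      have := mul_lt_mul_of_pos_left (not_le.mp hcon) hC'
      simp only [hN] at this
      linarith
    simp [hp₀, hχ0 _ h2]
  have hp₀W := mem_W12def_of_bounded hsupp
  -- the region in which the cut-off varies
  let reg : L.pts → Prop := fun x => L.rcut + L.Rdef < ‖(x : Eu d)‖ ∧ N x ≤ 3 * k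
  have hreg : ∀ (x : L.pts) (ρ : L.range x), ¬ reg x → χ (x + ρ) - χ x = 0 := by
    intro x ρ hx
    have hρ := (mem_range.mp ρ.2).2
    have h1 := hNsub ((x : Eu d) + ρ) x
    rw [add_sub_cancel_left] at h1
    have h2 : C * ‖(ρ : Eu d)‖ ≤ c := mul_le_mul_of_nonneg_left hρ.le hC.le
    have h3 := abs_le.mp (h1.trans h2)
    by_cases hn : N x ≤ 3 * k
    · have h4 : ‖(x : Eu d)‖ ≤ L.rcut + L.Rdef := by
        by_contra hcon
        exact hx ⟨not_le.mp hcon, hn⟩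
      have h5 := (hA x).trans (mul_le_mul_of_nonneg_left h4 hC.le)
      have h6 : N x ≤ C * (L.rcut + L.Rdef) := h5
      rw [hχ1 _ (by linarith : N x ≤ k), hχ1 _ (by linarith : N (x + ρ) ≤ k), sub_self]
    · have := not_le.mp hn
      rw [hχ0 _ (by linarith : 2 * k ≤ N x), hχ0 _ (by linarith : 2 * k ≤ N (x + ρ)), sub_self]
  have hlocal : ∀ x : L.pts, normSq (grad p₀ x) ≤ 2 * normSq (grad v.1 x) +
      if reg x then 2 * (n * (c / k) ^ 2) * ‖v.1 x - a‖ ^ 2 else 0 := by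
    intro x
    have h1 : ∀ ρ : L.range x, ‖grad p₀ x ρ‖ ^ 2 ≤ 2 * ‖grad v.1 x ρ‖ ^ 2 +
        2 * ((χ (x + ρ) - χ x) ^ 2 * ‖v.1 x - a‖ ^ 2) := by
      intro ρ
      rw [hp₀, grad_smul_sub]
      exact norm_sq_smul_add_le _ _ (hχ01 _) _ _
    split_ifs with hx
    · have h2 : ∀ ρ : L.range x, ‖grad p₀ x ρ‖ ^ 2 ≤ 2 * ‖grad v.1 x ρ‖ ^ 2 +
          2 * ((c / k) ^ 2 * ‖v.1 x - a‖ ^ 2) := by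
        intro ρ
        refine (h1 ρ).trans ?_
        have hρ := (mem_range.mp ρ.2).2
        have h3 := hχL ((x : Eu d) + ρ) x
        rw [add_sub_cancel_left] at h3
        have h4 : |χ (x + ρ) - χ x| ≤ c / k :=
          h3.trans (div_le_div_of_nonneg_right (mul_le_mul_of_nonneg_left hρ.le hC.le) hk0.le)
        have h5 : (χ (x + ρ) - χ x) ^ 2 ≤ (c / k) ^ 2 := by
          rw [← sq_abs]; exact pow_le_pow_left₀ (abs_nonneg _) h4 2
        have := mul_le_mul_of_nonneg_right h5 (sq_nonneg ‖v.1 x - a‖)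
        linarith
      have h3 : normSq (grad p₀ x) ≤ ∑ ρ : L.range x, (2 * ‖grad v.1 x ρ‖ ^ 2 +
          2 * ((c / k) ^ 2 * ‖v.1 x - a‖ ^ 2)) := Finset.sum_le_sum fun ρ _ => h2 ρ
      rw [Finset.sum_add_distrib, ← Finset.mul_sum, Finset.sum_const, Finset.card_univ,
        Fintype.card_coe, nsmul_eq_mul] at h3
      have hcard : ((L.range x).card : ℝ) = n := by rw [range_eq_rangeHom x.2 hx.1]
      rw [hcard] at h3
      refine h3.trans (le_of_eq ?_)
      rw [normSq]
      ring
    · have h3 : normSq (grad p₀ x) ≤ ∑ ρ : L.range x, 2 * ‖grad v.1 x ρ‖ ^ 2 :=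
        Finset.sum_le_sum fun ρ _ => by
          have := h1 ρ
          rw [hreg x ρ hx] at this
          simpa using this
      rw [← Finset.mul_sum] at h3
      simpa [normSq] using h3
  have hann : ∀ s : Finset L.pts, ∑ x ∈ s with reg x, ‖v.1 x - a‖ ^ 2 ≤
      2 ^ d * (T * M * (2 * (3 * k : ℕ))) ^ 2 := by
    intro s
    refine le_trans ?_ ha
    have hcoord : ∀ x : L.pts, reg x → ∃ z, latPt L z = x := fun x hx =>
      (mem_pts_iff (by linarith [hx.1])).mp x.2
    choose! i hi using hcoord
    refine sum_le_sum_of_injOn _ _ i (fun x hx => ?_) (fun x hx y hy hxy => ?_) _ _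
      (fun x hx => le_of_eq ?_) fun _ _ => sq_nonneg _
    · have hx' := (Finset.mem_filter.mp hx).2
      rw [mem_box, ← norm_inv_latPt (L := L), hi x hx']
      push_cast
      exact hx'.2
    · have e1 := hi x (Finset.mem_filter.mp hx).2
      have e2 := hi y (Finset.mem_filter.mp hy).2
      rw [hxy, e2] at e1
      exact Subtype.ext e1.symm
    · have hx' := (Finset.mem_filter.mp hx).2
      rw [latFun, hi x hx', if_neg (by linarith [hx'.1]), extend_coe]
  refine ⟨gradMap L m ⟨p₀, hp₀W⟩, Submodule.mem_map_of_mem ⟨_, hsupp⟩, ?_, fun x hx => ?_⟩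
  · refine le_of_sq_le_sq ?_ (by positivity)
    rw [mul_pow, Real.sq_sqrt (by positivity), norm_sq_eq_tsum]
    refine Real.tsum_le_of_sum_le (fun x => normSq_nonneg _) fun s => ?_
    calc ∑ x ∈ s, normSq (grad p₀ x)
        ≤ ∑ x ∈ s, (2 * normSq (grad v.1 x) +
            if reg x then 2 * (n * (c / k) ^ 2) * ‖v.1 x - a‖ ^ 2 else 0) :=
          Finset.sum_le_sum fun x _ => hlocal x
      _ = 2 * ∑ x ∈ s, normSq (grad v.1 x) +
            2 * (n * (c / k) ^ 2) * ∑ x ∈ s with reg x, ‖v.1 x - a‖ ^ 2 := by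
          rw [Finset.sum_add_distrib, ← Finset.mul_sum, ← Finset.sum_filter, ← Finset.mul_sum]
      _ ≤ 2 * M ^ 2 + 2 * (n * (c / k) ^ 2) * (2 ^ d * (T * M * (2 * (3 * k : ℕ))) ^ 2) := by
          refine add_le_add ?_ ?_
          · exact mul_le_mul_of_nonneg_left (sum_normSq_grad_le v s) (by norm_num)
          · exact mul_le_mul_of_nonneg_left (hann s) (by positivity)
      _ = _ := by
          push_cast
          field_simp
          ring
  · have hx1 : ∀ y : Eu d, ‖y‖ ≤ ‖(x : Eu d)‖ + L.rcut → χ y = 1 := fun y hy =>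
      hχ1 y ((hA y).trans ((mul_le_mul_of_nonneg_left hy hC.le).trans hx))
    have : grad p₀ x = grad v.1 x := by
      funext ρ
      rw [hp₀, grad_smul_sub, hx1 x (by linarith), hx1 (x + ρ), sub_self, zero_smul, one_smul,
        add_zero]
      have := (mem_range.mp ρ.2).2
      exact (norm_add_le _ _).trans (by linarith)
    rw [gradMap_apply, gradMap_apply, this]

/-- Compactly supported displacements are dense in the energy space: a gradient field orthogonal to
all of them is the weak limit of its own cut-offs, hence orthogonal to itself. -/
theorem dense_compactSupp (g : StencilSpace L m) (hg : g ∈ LinearMap.range (gradMap L m)) :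
    g ∈ closure (((compactSupp L m).map (gradMap L m) : Submodule ℝ (StencilSpace L m)) :
      Set (StencilSpace L m)) := by
  set D := (compactSupp L m).map (gradMap L m) with hD
  have : CompleteSpace D.topologicalClosure := D.isClosed_topologicalClosure.completeSpace_coe
  obtain ⟨p, hp, h, hh, rfl⟩ := D.topologicalClosure.exists_add_mem_mem_orthogonal g
  have hDle : D.topologicalClosure ≤ LinearMap.range (gradMap L m) := by
    refine D.topologicalClosure_minimal ?_ isClosed_range_gradMap
    rintro _ ⟨v, -, rfl⟩
    exact ⟨v, rfl⟩
  have hhr : h ∈ LinearMap.range (gradMap L m) := by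
    have := Submodule.sub_mem _ hg (hDle hp)
    rwa [add_sub_cancel_left] at this
  obtain ⟨v, rfl⟩ := hhr
  obtain ⟨K, c, k₀, hK, hcut⟩ := exists_cutoff_bound L m
  choose! q hqD hqn hqx using hcut v
  obtain ⟨w, hw⟩ := exists_weak_limit (hyperfilter ℕ) q (K * ‖gradMap L m v‖)
    (Nat.hyperfilter_le_atTop ((eventually_ge_atTop k₀).mono hqn))
  have hwv : w = gradMap L m v := by
    ext x : 2
    refine WithLp.ofLp_injective 2 (funext fun ρ => ?_)
    refine tendsto_nhds_unique (tendsto_coord hw x ρ) (tendsto_const_nhds.congr' ?_)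
    obtain ⟨k₁, hk₁⟩ := exists_nat_ge (c * (‖(x : Eu d)‖ + L.rcut))
    refine Nat.hyperfilter_le_atTop ?_
    filter_upwards [eventually_ge_atTop k₀, eventually_ge_atTop k₁] with k h0 h1
    rw [hqx k h0 x (hk₁.trans (by exact_mod_cast h1))]
  have h0 : inner ℝ (gradMap L m v) w = 0 := by
    refine tendsto_nhds_unique (hw (innerSL ℝ (gradMap L m v))) (tendsto_const_nhds.congr' ?_)
    refine Nat.hyperfilter_le_atTop ((eventually_ge_atTop k₀).mono fun k hk => ?_)
    have := hh _ (D.le_topologicalClosure (hqD k hk))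
    rw [real_inner_comm] at this
    exact this.symm
  rw [hwv, inner_self_eq_zero] at h0
  rw [h0, add_zero]
  exact hp

end Density

/-! ### Growth of displacements and geometry of supercells -/

section Growth

variable {d m : ℕ} {L : DefectLattice d}

/-- Translation by `h` changes a displacement by at most `O(‖h‖)` in `ℓ²`, hence at each site. -/
theorem exists_linear_growth (x₀ : L.pts) : ∃ K : ℝ, 0 ≤ K ∧ ∀ (v : W12def L m) (x : L.pts),
    ‖v.1 x - v.1 x₀‖ ≤ K * (1 + ‖(x : Eu d)‖) * ‖gradMap L m v‖ := by
  obtain ⟨T, hT, htrans⟩ := exists_transBound (m := m) x₀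
  obtain ⟨K, hK, hosc⟩ := exists_local_osc (m := m) x₀ L.Rdef
  obtain ⟨C, hC, hA⟩ := exists_norm_inv_mulVec_le L.A
  refine ⟨K + T * C, by positivity, fun v x => ?_⟩
  have hM := norm_nonneg (gradMap L m v)
  have hx0 := norm_nonneg (x : Eu d)
  have hTC : 0 ≤ T * C := by positivity
  have hKx : 0 ≤ K * ‖(x : Eu d)‖ := by positivity
  by_cases hx : ‖(x : Eu d)‖ < L.Rdef
  · have h1 := hosc v x hx.le
    rw [extend_coe, extend_coe] at h1
    refine h1.trans (mul_le_mul_of_nonneg_right ?_ hM)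
    nlinarith [mul_nonneg hTC hx0]
  · obtain ⟨h, hh⟩ := (mem_pts_iff (not_lt.mp hx)).mp x.2
    have hh' : latPt L h = x := hh
    have h1 := (htrans v h).sum_le {0}
    have e1 : latFun L x₀ v.1 h = v.1 x := by
      rw [latFun, hh', if_neg hx, extend_coe]
    have e2 : latFun L x₀ v.1 0 = v.1 x₀ := by
      rw [latFun, latPt_zero, norm_zero, if_pos L.Rdef_pos]
    rw [Finset.sum_singleton, zero_add, e1, e2] at h1
    have h2 := le_of_sq_le_sq h1 (htrans v h).nonneg
    have h3 : ‖h‖ ≤ C * ‖(x : Eu d)‖ := by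
      rw [← norm_inv_latPt (L := L), hh']; exact hA x
    calc _ ≤ T * ‖gradMap L m v‖ * ‖h‖ := h2
      _ ≤ T * ‖gradMap L m v‖ * (C * ‖(x : Eu d)‖) := mul_le_mul_of_nonneg_left h3 (by positivity)
      _ = T * C * ‖(x : Eu d)‖ * ‖gradMap L m v‖ := by ring
      _ ≤ _ := by
        refine mul_le_mul_of_nonneg_right ?_ hM
        nlinarith

/-- Finite-energy displacements grow sublinearly: linear growth with a constant proportional to
the energy norm, improved by subtracting a compactly supported approximation. -/
theorem exists_sublinear_growth (x₀ : L.pts) (u : W12def L m) {ε : ℝ} (hε : 0 < ε) :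
    ∃ K : ℝ, 0 ≤ K ∧ ∀ x : L.pts, ‖u.1 x - u.1 x₀‖ ≤ ε * ‖(x : Eu d)‖ + K := by
  obtain ⟨T, hT, hlin⟩ := exists_linear_growth (m := m) x₀
  obtain ⟨_, ⟨φ, ⟨r, hφ⟩, rfl⟩, hd⟩ := Metric.mem_closure_iff.mp
    (dense_compactSupp (gradMap L m u) ⟨u, rfl⟩) (ε / (T + 1)) (by positivity)
  rw [dist_eq_norm, ← map_sub] at hd
  obtain ⟨b, hb⟩ := ((finite_sites_norm_le (L := L) r).image fun x => ‖φ.1 x - φ.1 x₀‖).bddAbove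
  refine ⟨ε + (max b 0 + ‖φ.1 x₀‖), by positivity, fun x => ?_⟩
  have h1 := hlin (u - φ) x
  have h2 : T * (1 + ‖(x : Eu d)‖) * ‖gradMap L m (u - φ)‖ ≤ ε * (1 + ‖(x : Eu d)‖) := by
    calc _ ≤ T * (1 + ‖(x : Eu d)‖) * (ε / (T + 1)) :=
          mul_le_mul_of_nonneg_left hd.le (by positivity)
      _ = ε * (1 + ‖(x : Eu d)‖) * (T / (T + 1)) := by ring
      _ ≤ _ := by
        refine mul_le_of_le_one_right (by positivity) ?_
        rw [div_le_one (by positivity)]; linarith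
  have h3 : ‖φ.1 x - φ.1 x₀‖ ≤ max b 0 + ‖φ.1 x₀‖ := by
    by_cases hx : ‖(x : Eu d)‖ ≤ r
    · have := hb ⟨x, hx, rfl⟩
      have e : ‖φ.1 x - φ.1 x₀‖ ≤ b := this
      linarith [le_max_left b 0, norm_nonneg (φ.1 x₀)]
    · rw [hφ x (not_le.mp hx), zero_sub, norm_neg]
      linarith [le_max_right b 0]
  have h4 := norm_add_le ((u - φ).1 x - (u - φ).1 x₀) (φ.1 x - φ.1 x₀)
  have e : (u - φ).1 x - (u - φ).1 x₀ + (φ.1 x - φ.1 x₀) = u.1 x - u.1 x₀ := by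
    simp only [Submodule.coe_sub, Pi.sub_apply]; abel
  rw [e] at h4
  linarith

end Growth

section Cells

variable {d m : ℕ} {L : DefectLattice d} (C : Supercell L)

theorem mem_cell_iff {n : ℕ} {x : Eu d} :
    x ∈ cell C n ↔ ∀ i, (C.B⁻¹ *ᵥ x.ofLp) i ∈ Set.Ioc (-(n : ℝ)) n := by
  constructor
  · rintro ⟨y, hy, rfl⟩
    rwa [inv_mulVec_mulE C.det_ne_zero]
  · intro h
    exact ⟨_, h, mulE_inv C.det_ne_zero x⟩

theorem cell_mono {n k : ℕ} (h : n ≤ k) : cell C n ⊆ cell C k := by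
  intro x hx
  rw [mem_cell_iff] at hx ⊢
  have : (n : ℝ) ≤ k := by exact_mod_cast h
  exact fun i => ⟨by linarith [(hx i).1], by linarith [(hx i).2]⟩

theorem inv_mulVec_shift (N : ℕ) (z : Fin d → ℤ) :
    C.B⁻¹ *ᵥ (shift C N z).ofLp = fun i => 2 * (N : ℝ) * z i :=
  inv_mulVec_mulE C.det_ne_zero _

theorem shift_eq_zero {N : ℕ} (hN : 0 < N) {z : Fin d → ℤ} (h : shift C N z = 0) : z = 0 := by
  have h1 := inv_mulVec_shift C N z
  rw [h] at h1
  ext i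
  have h2 := congrFun h1 i
  have hN' : (N : ℝ) ≠ 0 := by exact_mod_cast hN.ne'
  simpa [hN'] using h2.symm

theorem shift_zero (N : ℕ) : shift C N 0 = 0 := by
  have := shift_add C N 0 0
  rwa [add_zero, left_eq_add] at this

theorem shift_neg (N : ℕ) (z : Fin d → ℤ) : shift C N (-z) = -shift C N z := by
  have := shift_add C N (-z) z
  rw [neg_add_cancel, shift_zero] at this
  exact eq_neg_of_add_eq_zero_left this.symm

/-- Periods are vectors of the host lattice. -/
theorem shift_mem_hom (N : ℕ) (z : Fin d → ℤ) : shift C N z ∈ L.hom := by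
  have hcol := C.col_mem
  choose k hk using hcol
  refine ⟨fun i => ∑ j, k j i * (2 * (N : ℤ) * z j), ?_⟩
  have hB : ∀ i j, C.B i j = ∑ l, L.A i l * (k j l : ℝ) := by
    intro i j
    have := congrArg (fun w : Eu d => w i) (hk j)
    simp only [mulE, Matrix.mulVec, dotProduct] at this
    exact this.symm
  refine congrArg (WithLp.toLp 2) (funext fun i => ?_)
  simp only [Matrix.mulVec, dotProduct, hB]
  push_cast
  simp only [Finset.mul_sum, Finset.sum_mul]
  rw [Finset.sum_comm]
  exact Finset.sum_congr rfl fun j _ => Finset.sum_congr rfl fun l _ => by ring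

/-- The index `z` of the translate `Q_N + shift N z` that contains a given point. The ceiling is used
because cells are half-open, of the form `(-N, N]^d`. -/
def cellIdx (N : ℕ) (x : Eu d) (i : Fin d) : ℤ :=
  ⌈(C.B⁻¹ *ᵥ x.ofLp) i / (2 * N) - 1 / 2⌉

/-- The point of the cell `Q_N` equivalent to a given point modulo periods. -/
def cellPart (N : ℕ) (x : Eu d) : Eu d := x - shift C N (cellIdx C N x)

theorem cellPart_mem {N : ℕ} (hN : 0 < N) (x : Eu d) : cellPart C N x ∈ cell C N := by
  rw [mem_cell_iff]
  intro i
  have hN' : (0 : ℝ) < 2 * N := by positivity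
  have e : (C.B⁻¹ *ᵥ (cellPart C N x).ofLp) i =
      (C.B⁻¹ *ᵥ x.ofLp) i - 2 * N * cellIdx C N x i := by
    rw [cellPart, WithLp.ofLp_sub, Matrix.mulVec_sub, Pi.sub_apply, inv_mulVec_shift]
  set t := (C.B⁻¹ *ᵥ x.ofLp) i with ht
  have h1 : t / (2 * N) - 1 / 2 ≤ cellIdx C N x i := Int.le_ceil _
  have h2 : (cellIdx C N x i : ℝ) < t / (2 * N) - 1 / 2 + 1 := Int.ceil_lt_add_one _
  have h3 : t = t / (2 * N) * (2 * N) := by field_simp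
  rw [e]
  constructor <;> nlinarith

theorem cellPart_eq_of_mem {N : ℕ} {x y : Eu d} {z : Fin d → ℤ} (hN : 0 < N)
    (hy : y ∈ cell C N) (h : x = y + shift C N z) : cellPart C N x = y ∧ cellIdx C N x = z := by
  have h1 : cellPart C N x = y := by
    refine cell_unique C (z := z - cellIdx C N x) hy (cellPart_mem C hN x) ?_
    rw [sub_eq_add_neg z, shift_add, shift_neg, cellPart, ← sub_eq_add_neg]
    nth_rewrite 1 [h]
    abel
  refine ⟨h1, ?_⟩
  have h2 : shift C N (cellIdx C N x + -z) = 0 := by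
    rw [shift_add, shift_neg]
    rw [cellPart, h] at h1
    rw [h, ← sub_eq_add_neg]
    have h3 : y + shift C N z - shift C N (cellIdx C N (y + shift C N z)) - y = 0 :=
      sub_eq_zero.mpr h1
    have h4 : shift C N (cellIdx C N (y + shift C N z)) - shift C N z =
        -(y + shift C N z - shift C N (cellIdx C N (y + shift C N z)) - y) := by abel
    rw [h4, h3, neg_zero]
  have := shift_eq_zero C hN h2
  exact add_neg_eq_zero.mp this

theorem cellPart_of_mem {N : ℕ} {x : Eu d} (hN : 0 < N) (hx : x ∈ cell C N) :
    cellPart C N x = x :=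
  (cellPart_eq_of_mem C (z := 0) hN hx (by rw [shift_zero, add_zero])).1

theorem cellPart_add (N : ℕ) (x : Eu d) : cellPart C N x + shift C N (cellIdx C N x) = x := by
  rw [cellPart, sub_add_cancel]

theorem mem_perPts_iff {N : ℕ} (hN : 0 < N) {x : Eu d} :
    x ∈ perPts C N ↔ cellPart C N x ∈ L.pts := by
  constructor
  · rintro ⟨y, hy, z, h⟩
    rw [mem_cellPts] at hy
    rw [(cellPart_eq_of_mem C hN hy.2 (by rw [h, add_comm])).1]
    exact hy.1
  · intro h
    exact ⟨_, (mem_cellPts C).mpr ⟨h, cellPart_mem C hN x⟩, _, by rw [add_comm, cellPart_add]⟩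

theorem cellRep_eq {N : ℕ} (hN : 0 < N) (x : perPts C N) :
    (cellRep C x : Eu d) = cellPart C N x := by
  have h1 := x.2.choose_spec.1
  obtain ⟨z, hz⟩ := x.2.choose_spec.2
  exact ((cellPart_eq_of_mem C hN ((mem_cellPts C).mp h1).2 (hz.trans (add_comm _ _))).1).symm

/-- A bound for the coordinates with respect to the cell vectors. -/
theorem exists_coord_bound : ∃ β : ℝ, 0 < β ∧ ∀ (x : Eu d) i, |(C.B⁻¹ *ᵥ x.ofLp) i| ≤ β * ‖x‖ := by
  obtain ⟨β, hβ, h⟩ := exists_norm_inv_mulVec_le C.B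
  exact ⟨β, hβ, fun x i => (norm_le_pi_norm (C.B⁻¹ *ᵥ x.ofLp) i).trans (h x)⟩

variable {C}

theorem mem_cell_of_norm_lt {β : ℝ} (hβ : ∀ (x : Eu d) i, |(C.B⁻¹ *ᵥ x.ofLp) i| ≤ β * ‖x‖) {n : ℕ}
    {x : Eu d} (hx : β * ‖x‖ < n) : x ∈ cell C n := by
  rw [mem_cell_iff]
  intro i
  have := abs_le.mp (hβ x i)
  exact ⟨by linarith, by linarith⟩

theorem add_mem_cell {β : ℝ} (hβ : ∀ (x : Eu d) i, |(C.B⁻¹ *ᵥ x.ofLp) i| ≤ β * ‖x‖) {n N : ℕ}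
    {x ρ : Eu d} (hx : x ∈ cell C n) (hρ : n + β * ‖ρ‖ ≤ N) : x + ρ ∈ cell C N := by
  rw [mem_cell_iff] at hx ⊢
  intro i
  have h1 := abs_le.mp (hβ ρ i)
  have h2 := hx i
  rw [WithLp.ofLp_add, Matrix.mulVec_add, Pi.add_apply]
  exact ⟨by linarith [h2.1], by linarith [h2.2]⟩

/-- Periodic wrapping around the cell boundary happens only near the boundary. -/
theorem cellPart_add_or {β : ℝ} (hβ0 : 0 < β)
    (hβ : ∀ (x : Eu d) i, |(C.B⁻¹ *ᵥ x.ofLp) i| ≤ β * ‖x‖) {n N : ℕ} {r : ℝ} (hN : 0 < N)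
    (hnN : n + β * r ≤ N) {x ρ : Eu d} (hx : x ∈ cell C N) (hρ : ‖ρ‖ < r) :
    (x + ρ ∈ cell C N ∧ cellPart C N (x + ρ) = x + ρ) ∨
      (x ∉ cell C n ∧ cellPart C N (x + ρ) ∉ cell C n ∧ x + ρ ∉ cell C n) := by
  have hρ' : (n : ℝ) + β * ‖ρ‖ ≤ N := by nlinarith
  have hle : n ≤ N := by
    have : (n : ℝ) ≤ N := by nlinarith [norm_nonneg ρ]
    exact_mod_cast this
  by_cases hmem : x + ρ ∈ cell C N
  · exact Or.inl ⟨hmem, cellPart_of_mem C hN hmem⟩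
  refine Or.inr ⟨fun h => hmem (add_mem_cell hβ h hρ'), fun h => ?_,
    fun h => hmem (cell_mono C hle h)⟩
  have h1 : cellPart C N (x + ρ) + -ρ ∈ cell C N := add_mem_cell hβ h (by rwa [norm_neg])
  have h2 : cellPart C N (x + ρ) + -ρ = x := by
    refine cell_unique C (z := -cellIdx C N (x + ρ)) hx h1 ?_
    rw [shift_neg, cellPart]; abel
  have h3 : cellPart C N (x + ρ) = x + ρ := add_neg_eq_iff_eq_add.mp h2
  exact hmem (h3 ▸ cellPart_mem C hN (x + ρ))

theorem norm_ge_of_notMem_cell {β : ℝ} (hβ0 : 0 < β)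
    (hβ : ∀ (x : Eu d) i, |(C.B⁻¹ *ᵥ x.ofLp) i| ≤ β * ‖x‖) {n : ℕ} {R : ℝ} (hn : β * R ≤ n)
    {x : Eu d} (hx : x ∉ cell C n) : R ≤ ‖x‖ := by
  by_contra hcon
  exact hx (mem_cell_of_norm_lt hβ (by nlinarith [not_le.mp hcon]))

/-- For a large cell, the wrapped neighbour of a site of the cell is either the neighbour itself or
far from the origin, together with the site. -/
theorem eventually_wrap (C : Supercell L) (R : ℝ) : ∀ᶠ N in atTop, 0 < N ∧
    ∀ x ∈ cell C N, ∀ ρ : Eu d, ‖ρ‖ < L.rcut →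
      (x + ρ ∈ cell C N ∧ cellPart C N (x + ρ) = x + ρ) ∨
      (R ≤ ‖x‖ ∧ R ≤ ‖cellPart C N (x + ρ)‖ ∧ R ≤ ‖x + ρ‖) := by
  obtain ⟨β, hβ0, hβ⟩ := exists_coord_bound C
  obtain ⟨n, hn⟩ := exists_nat_ge (β * R)
  obtain ⟨k, hk⟩ := exists_nat_ge (n + β * L.rcut)
  filter_upwards [eventually_ge_atTop k, eventually_gt_atTop 0] with N hN hN0
  refine ⟨hN0, fun x hx ρ hρ => ?_⟩
  have hkN : (k : ℝ) ≤ N := by exact_mod_cast hN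
  rcases cellPart_add_or hβ0 hβ hN0 (hk.trans hkN) hx hρ with h | ⟨h1, h2, h3⟩
  · exact Or.inl h
  · exact Or.inr ⟨norm_ge_of_notMem_cell hβ0 hβ hn h1, norm_ge_of_notMem_cell hβ0 hβ hn h2,
      norm_ge_of_notMem_cell hβ0 hβ hn h3⟩

theorem eventually_mem_cell (C : Supercell L) (R : ℝ) : ∀ᶠ N in atTop, ∀ x : Eu d, ‖x‖ ≤ R →
    x ∈ cell C N := by
  obtain ⟨β, hβ0, hβ⟩ := exists_coord_bound C
  obtain ⟨n, hn⟩ := exists_nat_gt (β * R)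
  filter_upwards [eventually_ge_atTop n] with N hN x hx
  have hkN : (n : ℝ) ≤ N := by exact_mod_cast hN
  exact mem_cell_of_norm_lt hβ (by nlinarith)

/-- In a large cell, the neighbours of the sites of the cell are sites of the periodic lattice. -/
theorem eventually_add_mem_perPts (C : Supercell L) : ∀ᶠ N in atTop, ∀ x : cellPts C N,
    ∀ ρ ∈ L.range x, (x : Eu d) + ρ ∈ perPts C N := by
  filter_upwards [eventually_wrap C L.Rdef] with N hN x ρ hρ
  obtain ⟨hN0, hwrap⟩ := hN
  have hx := (mem_cellPts C).mp x.2
  have hρ' := mem_range.mp hρ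
  rw [mem_perPts_iff C hN0]
  rcases hwrap x hx.2 ρ hρ'.2 with h | ⟨h1, h2, h3⟩
  · rw [h.2]; exact hρ'.1
  · rw [mem_pts_iff h2, cellPart]
    exact sub_mem_latticePts ((mem_pts_iff h3).mp hρ'.1) (shift_mem_hom C N _)

theorem gradPer_eq {N : ℕ} (h : ∀ x : cellPts C N, ∀ ρ ∈ L.range x, (x : Eu d) + ρ ∈ perPts C N)
    (v : perPts C N → Eu m) (x : cellPts C N) :
    gradPer C v x = fun ρ : L.range (toSite C x) =>
      extend (perPts C N) v (x + ρ) - extend (perPts C N) v x :=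
  stencil_eq_extend _ _ _ _ fun ρ hρ => h x ρ hρ

theorem extend_perPts_cellPart {N : ℕ} (hN : 0 < N) (v : Wper C m N) (x : Eu d) :
    extend (perPts C N) v.1 (cellPart C N x) = extend (perPts C N) v.1 x := by
  have e : cellPart C N (cellPart C N x) = cellPart C N x :=
    cellPart_of_mem C hN (cellPart_mem C hN x)
  by_cases hx : x ∈ perPts C N
  · have hx' : cellPart C N x ∈ perPts C N := by
      rw [mem_perPts_iff C hN, e]; exact (mem_perPts_iff C hN).mp hx
    rw [extend_of_mem _ hx, extend_of_mem _ hx']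
    exact (v.2 ⟨_, hx'⟩ ⟨_, hx⟩ (cellIdx C N x) (cellPart_add C N x).symm).symm
  · have hx' : cellPart C N x ∉ perPts C N := by
      rw [mem_perPts_iff C hN, e]; exact fun h => hx ((mem_perPts_iff C hN).mpr h)
    simp [extend, hx, hx']

end Cells

/-! ### Phonon stability for periodic displacements of the host lattice -/

section PeriodicPhonon

variable {d m : ℕ} {L : DefectLattice d} (C : Supercell L)

/-- The sites of the host lattice in the cell `Q_N`. -/
def homCell (N : ℕ) : Finset (Eu d) :=
  (finite_latticePts_inter L.det_ne_zero (isBounded_cell C N)).toFinset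

theorem mem_homCell {N : ℕ} {x : Eu d} : x ∈ homCell C N ↔ x ∈ L.hom ∧ x ∈ cell C N := by
  simp [homCell]

/-- The excess of the density of the homogeneous second variation at zero strain over `c₀` times the
energy density, at the site `x`. -/
def excess (P : SiteEnergies L m) (c₀ : ℝ) (w : Eu d → Eu m) (x : Eu d) : ℝ :=
  hessian P.Vhom 0 (fun ρ => w (x + ρ) - w x) (fun ρ => w (x + ρ) - w x) -
    c₀ * normSq fun ρ : L.rangeHom => w (x + ρ) - w x

theorem excess_congr (P : SiteEnergies L m) (c₀ : ℝ) {w w' : Eu d → Eu m} {x x' : Eu d}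
    (h : ∀ ρ ∈ L.rangeHom, w (x + ρ) - w x = w' (x' + ρ) - w' x') :
    excess P c₀ w x = excess P c₀ w' x' := by
  have : (fun ρ : L.rangeHom => w (x + ρ) - w x) = fun ρ : L.rangeHom => w' (x' + ρ) - w' x' :=
    funext fun ρ => h ρ ρ.2
  rw [excess, excess, this]

theorem abs_hessian_le {R : Finset (Eu d)} (V : (R → Eu m) → ℝ) (g h : R → Eu m) :
    |hessian V g h h| ≤ ‖fderiv ℝ (fderiv ℝ V) g‖ * normSq h := by
  have h1 := (fderiv ℝ (fderiv ℝ V) g).le_opNorm₂ h h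
  rw [Real.norm_eq_abs, mul_assoc, ← sq] at h1
  exact h1.trans (mul_le_mul_of_nonneg_left (sq_norm_le_normSq' h)
    (ContinuousLinearMap.opNorm_nonneg _))

theorem normSq_le_of_le {R : Finset (Eu d)} (g : R → Eu m) {b : ℝ} (hb : ∀ ρ, ‖g ρ‖ ≤ b) :
    normSq g ≤ R.card * b ^ 2 := by
  have h : normSq g ≤ ∑ _ρ : R, b ^ 2 :=
    Finset.sum_le_sum fun ρ _ => pow_le_pow_left₀ (norm_nonneg _) (hb ρ) 2
  simpa using h

theorem excess_zero_of_eq (P : SiteEnergies L m) (c₀ : ℝ) {w : Eu d → Eu m} {x : Eu d}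
    (h : ∀ ρ ∈ L.rangeHom, w (x + ρ) - w x = 0) : excess P c₀ w x = 0 := by
  have : (fun ρ : L.rangeHom => w (x + ρ) - w x) = 0 := funext fun ρ => h ρ ρ.2
  rw [excess, this]
  simp [hessian, normSq]

theorem abs_excess_le (P : SiteEnergies L m) {c₀ : ℝ} (hc₀ : 0 ≤ c₀) {w : Eu d → Eu m}
    {x : Eu d} {b : ℝ} (hb : ∀ ρ ∈ L.rangeHom, ‖w (x + ρ) - w x‖ ≤ b) :
    |excess P c₀ w x| ≤
      (‖fderiv ℝ (fderiv ℝ P.Vhom) 0‖ + c₀) * (L.rangeHom.card * b ^ 2) := by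
  set h : L.rangeHom → Eu m := fun ρ => w (x + ρ) - w x
  have h1 := abs_hessian_le P.Vhom 0 h
  have h2 := normSq_le_of_le h fun ρ => hb ρ ρ.2
  have h3 := normSq_nonneg h
  have h4 : |excess P c₀ w x| ≤ |hessian P.Vhom 0 h h| + |c₀ * normSq h| := abs_sub _ _
  rw [abs_of_nonneg (mul_nonneg hc₀ h3)] at h4
  have h5 : (‖fderiv ℝ (fderiv ℝ P.Vhom) 0‖ + c₀) * normSq h ≤
      (‖fderiv ℝ (fderiv ℝ P.Vhom) 0‖ + c₀) * (L.rangeHom.card * b ^ 2) :=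
    mul_le_mul_of_nonneg_left h2 (add_nonneg (ContinuousLinearMap.opNorm_nonneg _) hc₀)
  linarith

/-- Phonon stability for a displacement whose differences vanish at all but finitely many sites. -/
theorem excess_sum_nonneg_of_finite {P : SiteEnergies L m} {c₀ : ℝ} (hP : PhononStable P c₀)
    (w : Eu d → Eu m)
    (hfin : {x : L.hom | ¬ ∀ ρ ∈ L.rangeHom, w (x + ρ) - w x = 0}.Finite) :
    0 ≤ ∑' x : L.hom, excess P c₀ w x := by
  set v : L.hom → Eu m := fun x => w x
  have hg : ∀ x, gradHom v x = fun ρ : L.rangeHom => w (x + ρ) - w x := by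
    intro x
    rw [gradHom_eq]
    funext ρ
    rw [extend_of_mem v (add_mem_latticePts x.2 (mem_rangeHom.mp ρ.2).1), extend_coe]
  have hz : ∀ x, x ∉ {x : L.hom | ¬ ∀ ρ ∈ L.rangeHom, w (x + ρ) - w x = 0} → gradHom v x = 0 := by
    intro x hx
    rw [hg]
    funext ρ
    exact not_not.mp hx ρ ρ.2
  have hs1 : Summable fun x => normSq (gradHom v x) := by
    refine summable_of_hasFiniteSupport (hfin.subset fun x hx => ?_)
    by_contra hcon
    exact hx (by simp [hz x hcon, normSq])
  have hs2 : Summable fun x => hessian P.Vhom 0 (gradHom v x) (gradHom v x) := by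
    refine summable_of_hasFiniteSupport (hfin.subset fun x hx => ?_)
    by_contra hcon
    exact hx (by simp [hz x hcon, hessian])
  have h := hP v hs1
  rw [← tsum_mul_left] at h
  have h2 := (hs2.tsum_sub (hs1.mul_left c₀))
  have h3 : ∀ x : L.hom, excess P c₀ w x =
      hessian P.Vhom 0 (gradHom v x) (gradHom v x) - c₀ * normSq (gradHom v x) := by
    intro x; rw [hg, excess]
  rw [tsum_congr h3, h2]
  linarith

/-- Decomposition of the host lattice into periods and sites of the cell. -/
def homEquiv {N : ℕ} (hN : 0 < N) : L.hom ≃ (Fin d → ℤ) × homCell C N where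
  toFun x := (cellIdx C N x, ⟨cellPart C N x, (mem_homCell C).mpr
    ⟨sub_mem_latticePts x.2 (shift_mem_hom C N _), cellPart_mem C hN x⟩⟩)
  invFun p := ⟨p.2 + shift C N p.1,
    add_mem_latticePts ((mem_homCell C).mp p.2.2).1 (shift_mem_hom C N _)⟩
  left_inv x := Subtype.ext (cellPart_add C N x)
  right_inv p := by
    obtain ⟨h1, h2⟩ := cellPart_eq_of_mem C (z := p.1) hN ((mem_homCell C).mp p.2.2).2 rfl
    exact Prod.ext h2 (Subtype.ext h1)

/-- Neighbours lie in cells whose indices differ by a bounded amount. -/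
theorem exists_cellIdx_jump (N : ℕ) : ∃ k : ℕ, ∀ x ρ : Eu d, ‖ρ‖ < L.rcut →
    ‖cellIdx C N (x + ρ) - cellIdx C N x‖ ≤ k := by
  obtain ⟨β, hβ0, hβ⟩ := exists_coord_bound C
  obtain ⟨k, hk⟩ := exists_nat_ge (β * L.rcut / (2 * N) + 1)
  refine ⟨k, fun x ρ hρ => ?_⟩
  refine (pi_norm_le_iff_of_nonneg (Nat.cast_nonneg _)).mpr fun i => ?_
  refine le_trans ?_ hk
  rw [Pi.sub_apply, Int.norm_eq_abs]
  push_cast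
  simp only [cellIdx]
  rw [WithLp.ofLp_add, Matrix.mulVec_add, Pi.add_apply]
  set a := (C.B⁻¹ *ᵥ x.ofLp) i
  set b := (C.B⁻¹ *ᵥ ρ.ofLp) i
  have hb : |b / (2 * N)| ≤ β * L.rcut / (2 * N) := by
    rw [abs_div, abs_of_nonneg (by positivity : (0 : ℝ) ≤ 2 * N)]
    refine div_le_div_of_nonneg_right ((hβ ρ i).trans ?_) (by positivity)
    exact mul_le_mul_of_nonneg_left hρ.le hβ0.le
  have hb' := abs_le.mp hb
  have e : (a + b) / (2 * N) = a / (2 * N) + b / (2 * N) := add_div _ _ _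
  rw [e]
  have h1 := Int.le_ceil (a / (2 * N) + b / (2 * N) - 1 / 2)
  have h2 := Int.ceil_lt_add_one (a / (2 * N) + b / (2 * N) - 1 / 2)
  have h3 := Int.le_ceil (a / (2 * N) - 1 / 2)
  have h4 := Int.ceil_lt_add_one (a / (2 * N) - 1 / 2)
  rw [abs_le]
  constructor <;> linarith

/-- A sum over larger and larger boxes of periods, with a bounded error per period near the
boundary of the box, has nonnegative mean. -/
theorem nonneg_of_box_bound {S b : ℝ} {k : ℕ}
    (h : ∀ j : ℕ, 0 ≤ ((box d j).card : ℝ) * S +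
      (((box d (j + 2 * k)).card : ℝ) - (box d j).card) * b) : 0 ≤ S := by
  have hlim : Tendsto (fun j : ℕ => S + ((1 + 4 * (k : ℝ) / (2 * j + 1)) ^ d - 1) * b) atTop
      (𝓝 (S + ((1 + 0) ^ d - 1) * b)) := by
    have h1 : Tendsto (fun j : ℕ => 4 * (k : ℝ) / (2 * j + 1)) atTop (𝓝 0) := by
      refine Tendsto.div_atTop tendsto_const_nhds ?_
      exact tendsto_atTop_add_const_right _ _
        (tendsto_natCast_atTop_atTop.const_mul_atTop (by norm_num))
    exact ((((h1.const_add 1).pow d).sub_const 1).mul_const b).const_add S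
  have h0 : S + ((1 + 0) ^ d - 1) * b = S := by simp
  rw [h0] at hlim
  refine ge_of_tendsto' hlim fun j => ?_
  have hj := h j
  rw [card_box, card_box] at hj
  push_cast at hj
  have hp : (0 : ℝ) < 2 * j + 1 := by positivity
  have e1 : (2 * ((j : ℝ) + 2 * k) + 1) = (2 * j + 1) * (1 + 4 * (k : ℝ) / (2 * j + 1)) := by
    field_simp; ring
  rw [e1, mul_pow] at hj
  have e2 : ((2 : ℝ) * j + 1) ^ d * S + (((2 : ℝ) * j + 1) ^ d * (1 + 4 * (k : ℝ) / (2 * j + 1)) ^ d -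
      (2 * j + 1) ^ d) * b =
      (2 * j + 1) ^ d * (S + ((1 + 4 * (k : ℝ) / (2 * j + 1)) ^ d - 1) * b) := by ring
  rw [e2] at hj
  exact nonneg_of_mul_nonneg_right hj (by positivity)

/-- Phonon stability for periodic displacements of the host lattice, with the same constant:
restrict a periodic displacement to many periods and compare bulk and boundary. -/
theorem excess_sum_nonneg_of_periodic {P : SiteEnergies L m} {c₀ : ℝ} (hc₀ : 0 ≤ c₀)
    (hP : PhononStable P c₀) {N : ℕ} (hN : 0 < N) (f : Eu d → Eu m)
    (hf : ∀ x z, f (x + shift C N z) = f x) : 0 ≤ ∑ x ∈ homCell C N, excess P c₀ f x := by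
  classical
  obtain ⟨k, hk⟩ := exists_cellIdx_jump C N
  obtain ⟨b, hb⟩ := ((homCell C N).finite_toSet.image fun x => ‖f x‖).bddAbove
  have hfb : ∀ x ∈ L.hom, ‖f x‖ ≤ max b 0 := by
    intro x hx
    have h1 : f x = f (cellPart C N x) := by
      conv_lhs => rw [← cellPart_add C N x, hf]
    rw [h1]
    refine (hb ⟨cellPart C N x, ?_, rfl⟩).trans (le_max_left _ _)
    exact (mem_homCell C).mpr ⟨sub_mem_latticePts hx (shift_mem_hom C N _), cellPart_mem C hN x⟩
  set c := (‖fderiv ℝ (fderiv ℝ P.Vhom) 0‖ + c₀) * (L.rangeHom.card * (2 * max b 0) ^ 2) with hc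
  have hc0 : 0 ≤ c := mul_nonneg (add_nonneg (ContinuousLinearMap.opNorm_nonneg _) hc₀)
    (by positivity)
  refine nonneg_of_box_bound (d := d) (k := k) (b := (homCell C N).card * c) fun j => ?_
  -- the displacement restricted to the periods in a box
  set w : Eu d → Eu m := fun x => if ‖cellIdx C N x‖ ≤ (j + k : ℕ) then f x else 0 with hw
  have hwb : ∀ x ∈ L.hom, ‖w x‖ ≤ max b 0 := by
    intro x hx
    simp only [hw]
    split_ifs
    · exact hfb x hx
    · simp
  have hin : ∀ x, ‖cellIdx C N x‖ ≤ j → ∀ ρ ∈ L.rangeHom, w (x + ρ) - w x = f (x + ρ) - f x := by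
    intro x hx ρ hρ
    have h1 := hk x ρ (mem_rangeHom.mp hρ).2
    have h2 := norm_le_norm_add_norm_sub' (cellIdx C N (x + ρ)) (cellIdx C N x)
    simp only [hw]
    rw [if_pos, if_pos]
    · push_cast; linarith [(Nat.cast_nonneg k : (0 : ℝ) ≤ k)]
    · push_cast; linarith
  have hout : ∀ x, ¬ ‖cellIdx C N x‖ ≤ (j + 2 * k : ℕ) → ∀ ρ ∈ L.rangeHom, w (x + ρ) - w x = 0 := by
    intro x hx ρ hρ
    have h1 := hk x ρ (mem_rangeHom.mp hρ).2
    rw [norm_sub_rev] at h1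
    have h2 := norm_le_norm_add_norm_sub' (cellIdx C N x) (cellIdx C N (x + ρ))
    have h3 := not_le.mp hx
    push_cast at h3
    simp only [hw]
    rw [if_neg, if_neg, sub_self]
    · push_cast; linarith [(Nat.cast_nonneg k : (0 : ℝ) ≤ k)]
    · push_cast; linarith
  set e := homEquiv C hN
  have hidx : ∀ (z : Fin d → ℤ) (y : homCell C N), cellIdx C N (y + shift C N z) = z := fun z y =>
    (cellPart_eq_of_mem C hN ((mem_homCell C).mp y.2).2 rfl).2
  have hsupp : ∀ x : L.hom, (e x).1 ∉ box d (j + 2 * k) →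
      ∀ ρ ∈ L.rangeHom, w (x + ρ) - w x = 0 := by
    intro x hx
    rw [mem_box] at hx
    exact hout x hx
  have hfin : {x : L.hom | ¬ ∀ ρ ∈ L.rangeHom, w (x + ρ) - w x = 0}.Finite := by
    refine Set.Finite.of_finite_image (f := e) ?_ e.injective.injOn
    refine ((box d (j + 2 * k)) ×ˢ (Finset.univ : Finset (homCell C N))).finite_toSet.subset ?_
    rintro _ ⟨x, hx, rfl⟩
    rw [Finset.mem_coe, Finset.mem_product]
    refine ⟨?_, Finset.mem_univ _⟩
    by_contra hcon
    exact hx (hsupp x hcon)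
  have h0 := excess_sum_nonneg_of_finite hP w hfin
  rw [← e.symm.tsum_eq, tsum_eq_sum (s := (box d (j + 2 * k)) ×ˢ Finset.univ) (fun p hp => by
    refine excess_zero_of_eq P c₀ (hsupp _ ?_)
    rw [Equiv.apply_symm_apply]
    intro h
    exact hp (Finset.mem_product.mpr ⟨h, Finset.mem_univ _⟩)), Finset.sum_product] at h0
  have hsub : box d j ⊆ box d (j + 2 * k) := by
    intro z hz
    rw [mem_box] at hz ⊢
    push_cast
    linarith [(Nat.cast_nonneg k : (0 : ℝ) ≤ k)]
  rw [← Finset.sum_sdiff hsub] at h0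
  -- the bulk periods contribute the periodic sum each, the boundary periods a bounded error
  have h1 : ∑ z ∈ box d j, ∑ y : homCell C N, excess P c₀ w (e.symm (z, y)) =
      (box d j).card * ∑ x ∈ homCell C N, excess P c₀ f x := by
    rw [← nsmul_eq_mul, ← Finset.sum_const]
    refine Finset.sum_congr rfl fun z hz => ?_
    rw [← Finset.sum_coe_sort (homCell C N) fun x => excess P c₀ f x]
    refine Finset.sum_congr rfl fun y _ => ?_
    refine excess_congr P c₀ fun ρ hρ => ?_
    have e1 : ((e.symm (z, y) : L.hom) : Eu d) = y + shift C N z := rfl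
    have h2 : (y : Eu d) + shift C N z + ρ = y + ρ + shift C N z := by abel
    rw [e1, hin _ (by rw [hidx]; exact mem_box.mp hz) ρ hρ, hf, h2, hf]
  have h2 : ∑ z ∈ box d (j + 2 * k) \ box d j, ∑ y : homCell C N, excess P c₀ w (e.symm (z, y)) ≤
      (((box d (j + 2 * k)).card : ℝ) - (box d j).card) * ((homCell C N).card * c) := by
    have h3 : ∀ z ∈ box d (j + 2 * k) \ box d j,
        ∑ y : homCell C N, excess P c₀ w (e.symm (z, y)) ≤ (homCell C N).card * c := by
      intro z _
      have h4 : ∑ y : homCell C N, excess P c₀ w (e.symm (z, y)) ≤ ∑ _y : homCell C N, c := by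
        refine Finset.sum_le_sum fun y _ => (le_abs_self _).trans ?_
        refine abs_excess_le P hc₀ fun ρ hρ => ?_
        have hx := (e.symm (z, y)).2
        have hxρ := add_mem_latticePts hx (mem_rangeHom.mp hρ).1
        refine (norm_sub_le _ _).trans ?_
        linarith [hwb _ hx, hwb _ hxρ]
      simpa using h4
    refine (Finset.sum_le_sum h3).trans (le_of_eq ?_)
    rw [Finset.sum_const, nsmul_eq_mul, Finset.card_sdiff_of_subset hsub,
      Nat.cast_sub (Finset.card_le_card hsub)]
  linarith

end PeriodicPhonon

/-! ### Periodic gradients and the Gårding inequality -/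

section PeriodicGradient

variable {d m : ℕ} {L : DefectLattice d} (C : Supercell L)

/-- The gradient of a displacement of the periodic lattice on `Λ_N`, extended by zero to `Λ`. -/
def perStencil {N : ℕ} (v : perPts C N → Eu m) (x : L.pts) : L.range x → Eu m := by
  classical
  exact if h : (x : Eu d) ∈ cellPts C N then
    stencil (perPts C N) v ⟨x, cellPts_subset_perPts C ⟨x, h⟩⟩ (L.range x) else 0

theorem perStencil_toSite {N : ℕ} (v : perPts C N → Eu m) (x : cellPts C N) :
    perStencil C v (toSite C x) = gradPer C v x := by
  have h : ((toSite C x : L.pts) : Eu d) ∈ cellPts C N := x.2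
  rw [perStencil, dif_pos h]
  rfl

theorem perStencil_of_notMem {N : ℕ} (v : perPts C N → Eu m) {x : L.pts}
    (hx : (x : Eu d) ∉ cellPts C N) : perStencil C v x = 0 := by
  rw [perStencil, dif_neg hx]

theorem perStencil_add {N : ℕ} (v w : perPts C N → Eu m) (x : L.pts) :
    perStencil C (v + w) x = perStencil C v x + perStencil C w x := by
  by_cases h : (x : Eu d) ∈ cellPts C N
  · simp only [perStencil, dif_pos h]; exact stencil_add _ _ _ _ _
  · simp only [perStencil, dif_neg h, add_zero]

theorem perStencil_smul {N : ℕ} (c : ℝ) (v : perPts C N → Eu m) (x : L.pts) :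
    perStencil C (c • v) x = c • perStencil C v x := by
  by_cases h : (x : Eu d) ∈ cellPts C N
  · simp only [perStencil, dif_pos h]; exact stencil_smul _ _ _ _ _
  · simp only [perStencil, dif_neg h, smul_zero]

theorem hasSum_cellPts {N : ℕ} (F : L.pts → ℝ)
    (hF : ∀ x : L.pts, (x : Eu d) ∉ cellPts C N → F x = 0) :
    HasSum F (∑ x : cellPts C N, F (toSite C x)) := by
  classical
  have hinj : Function.Injective (toSite C (N := N)) := fun x y h => by
    have := congrArg (fun z : L.pts => (z : Eu d)) h
    exact Subtype.ext this
  have h : HasSum F (∑ x ∈ Finset.univ.map ⟨toSite C, hinj⟩, F x) :=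
    hasSum_sum_of_ne_finset_zero fun x hx => hF x fun hmem =>
      hx (Finset.mem_map.mpr ⟨⟨x, hmem⟩, Finset.mem_univ _, rfl⟩)
  rwa [Finset.sum_map] at h

theorem summable_perStencil {N : ℕ} (v : perPts C N → Eu m) :
    Summable fun x => normSq (perStencil C v x) :=
  (hasSum_cellPts C (N := N) _ fun x hx => by
    rw [perStencil_of_notMem C v hx]; simp [normSq]).summable

/-- The gradient on `Λ_N` as a linear map into the stencil space. -/
def perGradMap (m N : ℕ) : Wper C m N →ₗ[ℝ] StencilSpace L m where
  toFun v := ofSummable (perStencil C v.1) (summable_perStencil C v.1)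
  map_add' v w := by
    refine Subtype.ext (funext fun x => ?_)
    exact congrArg (WithLp.toLp 2) (perStencil_add C _ _ x)
  map_smul' c v := by
    refine Subtype.ext (funext fun x => ?_)
    exact congrArg (WithLp.toLp 2) (perStencil_smul C _ _ x)

variable {C}

theorem perGradMap_apply {N : ℕ} (v : Wper C m N) (x : L.pts) :
    (perGradMap C m N v x).ofLp = perStencil C v.1 x := rfl

theorem norm_perGradMap_sq {N : ℕ} (v : Wper C m N) :
    ‖perGradMap C m N v‖ ^ 2 = ∑ x : cellPts C N, normSq (gradPer C v.1 x) := by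
  rw [norm_sq_eq_tsum]
  have h := hasSum_cellPts C (N := N) (fun x => normSq (perStencil C v.1 x)) fun x hx => by
    rw [perStencil_of_notMem C v.1 hx]; simp [normSq]
  refine h.tsum_eq.trans (Finset.sum_congr rfl fun x _ => ?_)
  rw [perStencil_toSite]

theorem energyNormPer_eq {N : ℕ} (v : Wper C m N) :
    energyNormPer C v.1 = ‖perGradMap C m N v‖ := by
  rw [energyNormPer, ← norm_perGradMap_sq, Real.sqrt_sq (norm_nonneg _)]

theorem form_perGradMap {N : ℕ} {B : StencilSpace L m →L[ℝ] StencilSpace L m →L[ℝ] ℝ}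
    {b : ∀ x : L.pts, (L.range x → Eu m) →L[ℝ] (L.range x → Eu m) →L[ℝ] ℝ}
    (hB : ∀ g h, HasSum (fun x => b x (g x).ofLp (h x).ofLp) (B g h)) (v w : Wper C m N) :
    B (perGradMap C m N v) (perGradMap C m N w) =
      ∑ x : cellPts C N, b (toSite C x) (gradPer C v.1 x) (gradPer C w.1 x) := by
  have h := hasSum_cellPts C (N := N)
    (fun x => b x (perStencil C v.1 x) (perStencil C w.1 x)) fun x hx => by
      rw [perStencil_of_notMem C v.1 hx, map_zero, zero_apply]
  have h2 : HasSum (fun x => b x (perStencil C v.1 x) (perStencil C w.1 x)) _ :=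
    hB (perGradMap C m N v) (perGradMap C m N w)
  rw [h2.unique h]
  refine Finset.sum_congr rfl fun x _ => ?_
  rw [perStencil_toSite, perStencil_toSite]

theorem perGradMap_apply_of_mem {N : ℕ} (hper : ∀ x : cellPts C N, ∀ ρ ∈ L.range (toSite C x),
      (x : Eu d) + ρ ∈ perPts C N) (v : Wper C m N) {x : L.pts} (hx : (x : Eu d) ∈ cell C N) :
    (perGradMap C m N v x).ofLp =
      fun ρ : L.range x => extend _ v.1 (x + ρ) - extend _ v.1 x := by
  have hx' : (x : Eu d) ∈ cellPts C N := (mem_cellPts C).mpr ⟨x.2, hx⟩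
  rw [perGradMap_apply]
  exact (perStencil_toSite C v.1 ⟨x, hx'⟩).trans (gradPer_eq hper v.1 ⟨x, hx'⟩)

/-- Weak limits of periodic gradients on growing cells are gradients of finite-energy
displacements. -/
theorem mem_range_of_weak_limit (C : Supercell L) (U : Ultrafilter ℕ) (hU : (U : Filter ℕ) ≤ atTop)
    (g : ℕ → StencilSpace L m) (q : StencilSpace L m)
    (hg : ∀ᶠ n in (U : Filter ℕ), g n ∈ LinearMap.range (perGradMap C m n))
    (hq : ∀ l : StencilSpace L m →L[ℝ] ℝ, Tendsto (fun n => l (g n)) U (𝓝 (l q))) :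
    q ∈ LinearMap.range (gradMap L m) := by
  obtain ⟨w, hw⟩ := Eventually.choice (r := fun n (w : Eu d → Eu m) =>
      ∀ x : L.pts, (x : Eu d) ∈ cell C n →
        (g n x).ofLp = fun ρ : L.range x => w (x + ρ) - w x) (l := (U : Filter ℕ)) (by
    filter_upwards [hg, hU (eventually_add_mem_perPts C)] with n hn hper
    obtain ⟨v, hv⟩ := hn
    refine ⟨extend _ v.1, fun x hx => ?_⟩
    rw [← hv]
    exact perGradMap_apply_of_mem hper v hx)
  obtain ⟨f, hf⟩ := exists_potential (l := (U : Filter ℕ)) (fun x => (q x).ofLp) w (fun x ρ => by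
    refine (tendsto_coord hq x ρ).congr' ?_
    filter_upwards [hw, hU (eventually_mem_cell C ‖(x : Eu d)‖)] with n hn hmem
    rw [hn x (hmem x le_rfl)])
  obtain ⟨hf', he⟩ := mem_W12def_of_grad_eq hf
  exact ⟨_, he⟩

/-- Gradients of compactly supported displacements are periodic gradients on large cells. -/
theorem eventually_mem_range_perGradMap (C : Supercell L) (p : StencilSpace L m)
    (hp : p ∈ (compactSupp L m).map (gradMap L m)) :
    ∀ᶠ N in atTop, p ∈ LinearMap.range (perGradMap C m N) := by
  obtain ⟨φ, ⟨r, hr⟩, rfl⟩ := hp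
  filter_upwards [eventually_wrap C (r + L.rcut + 1), eventually_mem_cell C (r + L.rcut),
    eventually_add_mem_perPts C] with N hwrap hcell hper
  obtain ⟨hN, hwrap⟩ := hwrap
  have hrc := L.rcut_pos
  let v : Wper C m N := ⟨fun x => φ.1 (cellRep C x), fun x y z h =>
    congrArg φ.1 (cellRep_periodic C x y z h)⟩
  refine ⟨v, ?_⟩
  have hv : ∀ y, y ∈ perPts C N → extend (perPts C N) v.1 y = extend L.pts φ.1 (cellPart C N y) := by
    intro y hy
    have hy' := (mem_perPts_iff C hN).mp hy
    rw [extend_of_mem _ hy, extend_of_mem _ hy']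
    refine congrArg φ.1 (Subtype.ext ?_)
    exact cellRep_eq C hN ⟨y, hy⟩
  have hφ0 : ∀ y : Eu d, r < ‖y‖ → extend L.pts φ.1 y = 0 := by
    intro y hy
    by_cases h : y ∈ L.pts
    · rw [extend_of_mem _ h]; exact hr ⟨y, h⟩ hy
    · simp [extend, h]
  ext x : 2
  refine WithLp.ofLp_injective 2 ?_
  rw [perGradMap_apply, gradMap_apply]
  by_cases hx : (x : Eu d) ∈ cellPts C N
  · rw [← perGradMap_apply, perGradMap_apply_of_mem hper v ((mem_cellPts C).mp hx).2, grad_eq]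
    funext ρ
    have hρ := mem_range.mp ρ.2
    have hx' := ((mem_cellPts C).mp hx).2
    have e1 := hv x (cellPts_subset_perPts C ⟨x, hx⟩)
    rw [cellPart_of_mem C hN hx'] at e1
    have e2 := hv (x + ρ) (hper ⟨x, hx⟩ ρ ρ.2)
    change extend (perPts C N) v.1 (x + ρ) - extend (perPts C N) v.1 x =
      extend L.pts φ.1 (x + ρ) - extend L.pts φ.1 x
    rw [e1, e2]
    rcases hwrap x hx' ρ hρ.2 with h | ⟨h1, h2, h3⟩
    · rw [h.2]
    · rw [hφ0 _ (by linarith : r < ‖cellPart C N (x + ρ)‖),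
        hφ0 _ (by linarith : r < ‖(x : Eu d) + ρ‖)]
  · rw [perStencil_of_notMem C v.1 hx]
    refine (grad_eq_zero hr ?_).symm
    by_contra hcon
    exact hx ((mem_cellPts C).mpr ⟨x.2, hcell x (not_lt.mp hcon)⟩)

end PeriodicGradient

section Garding

variable {d m : ℕ} {L : DefectLattice d}

/-- Coercivity up to finitely many sites of the second variation on periodic gradients. Outside the
core a periodic displacement is turned into one of the host lattice, to which periodic phonon
stability applies; the change in the core is controlled by finitely many differences. -/
theorem eventually_coercive_up_to_finite (P : SiteEnergies L m) (C : Supercell L) {c₀ : ℝ}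
    (hc₀ : 0 ≤ c₀) (hP : PhononStable P c₀) (g₀ : StencilSpace L m) {ε : ℝ} (hε : 0 < ε) :
    ∃ (Z : Finset L.pts) (K : ℝ), 0 ≤ K ∧ ∀ᶠ N in atTop, ∀ v : Wper C m N,
      (c₀ - ε) * ‖perGradMap C m N v‖ ^ 2 -
          K * ∑ x ∈ Z, normSq (perGradMap C m N v x).ofLp ≤
        ∑ x : cellPts C N, hessian (P.V (toSite C x)) (g₀ (toSite C x)).ofLp
          (gradPer C v.1 x) (gradPer C v.1 x) := by
  classical
  have hrc := L.rcut_pos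
  have hRd := L.Rdef_pos
  obtain ⟨x₀⟩ := L.connected.nonempty
  obtain ⟨δ, hδ, hmod⟩ := exists_hessian_modulus P hε
  obtain ⟨S, hS⟩ := exists_norm_le_of_far g₀ hδ
  obtain ⟨M, hM⟩ := exists_hessian_bound P g₀
  obtain ⟨M₀, hM₀, hzero⟩ := exists_hessian_zero_bound P
  obtain ⟨Z₁, K₁, hK₁, hosc⟩ := exists_osc_bound (m := m) L.connected x₀
    (finite_sites_norm_le (L := L) (L.Rdef + 2 * L.rcut)).toFinset
  -- `Z₁` controls the oscillation of a displacement in the core; the other sites of `Z` are those at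
  -- which the second derivative at `g₀` is not close to that of the host lattice at zero
  set Z := Z₁ ∪ (finite_sites_norm_le (L := L) (max S (L.rcut + L.Rdef))).toFinset with hZ
  set n₁ := ((finite_latticePts_inter L.det_ne_zero (Metric.isBounded_closedBall (x := (0 : Eu d))
    (r := L.rcut + L.Rdef))).toFinset.card : ℝ) with hn₁
  set H := ‖fderiv ℝ (fderiv ℝ P.Vhom) 0‖ with hH
  have hH0 : 0 ≤ H := ContinuousLinearMap.opNorm_nonneg _
  have hM0 : 0 ≤ M := (ContinuousLinearMap.opNorm_nonneg _).trans (hM x₀)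
  set K₂ := H * (L.rangeHom.card * (2 * K₁) ^ 2) with hK₂
  obtain ⟨r, hr⟩ := (Z.finite_toSet.image fun x : L.pts => ‖(x : Eu d)‖).bddAbove
  refine ⟨Z, n₁ * K₂ + (M + M₀ + c₀), by positivity, ?_⟩
  filter_upwards [eventually_wrap C L.Rdef, eventually_mem_cell C r,
    eventually_mem_cell C (L.Rdef + 2 * L.rcut), eventually_add_mem_perPts C]
    with N hwrap hcellZ hcell hper v
  obtain ⟨hN, hwrap⟩ := hwrap
  set w := extend (perPts C N) v.1 with hw
  set g := perGradMap C m N v with hg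
  have hgx : ∀ x : cellPts C N, gradPer C v.1 x =
      fun ρ : L.range (toSite C x) => w (x + ρ) - w x := fun x => gradPer_eq hper v.1 x
  have hgZ : ∀ x : L.pts, (x : Eu d) ∈ cell C N →
      (g x).ofLp = fun ρ : L.range x => w (x + ρ) - w x := fun x hx =>
    perGradMap_apply_of_mem hper v hx
  set E := ∑ x ∈ Z, normSq (g x).ofLp with hE
  have hE0 : 0 ≤ E := Finset.sum_nonneg fun _ _ => normSq_nonneg _
  have hZcell : ∀ x ∈ Z, (x : Eu d) ∈ cell C N := fun x hx => hcellZ x (hr ⟨x, hx, rfl⟩)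
  have hwosc : ∀ y : L.pts, ‖(y : Eu d)‖ ≤ L.Rdef + 2 * L.rcut → ‖w y - w x₀‖ ≤ K₁ * √E := by
    intro y hy
    refine hosc w _ (Real.sqrt_nonneg _) (fun x hx y hxy => ?_) y (by simpa using hy)
    have hxZ : x ∈ Z := Finset.mem_union_left _ hx
    refine Real.le_sqrt_of_sq_le ?_
    have h1 := sq_norm_le_normSq (g x).ofLp ⟨y - x, mem_range.mpr ⟨by simp, hxy⟩⟩
    rw [hgZ x (hZcell x hxZ)] at h1
    simp only [add_sub_cancel] at h1
    refine h1.trans ?_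
    rw [← hgZ x (hZcell x hxZ)]
    exact Finset.single_le_sum (f := fun x => normSq (g x).ofLp) (fun _ _ => normSq_nonneg _) hxZ
  -- the associated periodic displacement of the host lattice
  set f : Eu d → Eu m := fun y => if ‖cellPart C N y‖ < L.Rdef then w x₀ else w y with hf
  have hfper : ∀ x z, f (x + shift C N z) = f x := by
    intro x z
    have e : cellPart C N (x + shift C N z) = cellPart C N x := by
      refine (cellPart_eq_of_mem C (z := cellIdx C N x + z) hN (cellPart_mem C hN x) ?_).1
      rw [shift_add, ← add_assoc, cellPart_add]
    have e2 : w (x + shift C N z) = w x := by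
      rw [hw, ← extend_perPts_cellPart hN, e, extend_perPts_cellPart hN]
    simp only [hf, e, e2]
  have hexc := excess_sum_nonneg_of_periodic C hc₀ hP hN f hfper
  rw [← Finset.sum_filter_add_sum_filter_not _ (fun x => ‖x‖ ≤ L.rcut + L.Rdef)] at hexc
  have hfosc : ∀ y ∈ L.hom, ‖y‖ ≤ L.Rdef + 2 * L.rcut → ‖f y - w x₀‖ ≤ K₁ * √E := by
    intro y hyl hy
    have hp : 0 ≤ K₁ * √E := by positivity
    simp only [hf, cellPart_of_mem C hN (hcell y hy)]
    split_ifs with h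
    · simpa using hp
    · exact hwosc ⟨y, (mem_pts_iff (not_lt.mp h)).mpr hyl⟩ hy
  -- near the core, the differences of `f` are controlled by those of `w` on `Z`
  have hnear : ∑ x ∈ homCell C N with ‖x‖ ≤ L.rcut + L.Rdef, excess P c₀ f x ≤
      n₁ * (K₂ * E) := by
    have h1 : ∀ x ∈ (homCell C N).filter (fun x => ‖x‖ ≤ L.rcut + L.Rdef),
        excess P c₀ f x ≤ K₂ * E := by
      intro x hx
      obtain ⟨hx1, hx2⟩ := Finset.mem_filter.mp hx
      have hxl := ((mem_homCell C).mp hx1).1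
      have hd : ∀ ρ : L.rangeHom, ‖f (x + ρ) - f x‖ ≤ 2 * K₁ * √E := by
        intro ρ
        have hρ := mem_rangeHom.mp ρ.2
        have e1 := hfosc x hxl (by linarith)
        have e2 := hfosc (x + ρ) (add_mem_latticePts hxl hρ.1)
          ((norm_add_le _ _).trans (by linarith [hρ.2]))
        have e3 := norm_sub_le (f (x + ρ) - w x₀) (f x - w x₀)
        rw [sub_sub_sub_cancel_right] at e3
        linarith
      have h2 := normSq_le_of_le _ hd
      have h3 := (abs_le.mp (abs_hessian_le P.Vhom 0 fun ρ : L.rangeHom => f (x + ρ) - f x)).2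
      have h4 := mul_le_mul_of_nonneg_left h2 hH0
      have h5 := mul_nonneg hc₀ (normSq_nonneg fun ρ : L.rangeHom => f (x + ρ) - f x)
      have h6 : H * (L.rangeHom.card * (2 * K₁ * √E) ^ 2) = K₂ * E := by
        rw [mul_pow _ (√E), Real.sq_sqrt hE0, hK₂]; ring
      rw [excess]
      linarith
    refine (Finset.sum_le_sum h1).trans ?_
    rw [Finset.sum_const, nsmul_eq_mul]
    refine mul_le_mul_of_nonneg_right ?_ (by positivity)
    rw [hn₁]
    refine Nat.cast_le.mpr (Finset.card_le_card fun x hx => ?_)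
    obtain ⟨hx1, hx2⟩ := Finset.mem_filter.mp hx
    simpa using ⟨((mem_homCell C).mp hx1).1, hx2⟩
  -- away from the core, `f` and `w` have the same differences
  have hfar : ∑ x ∈ homCell C N with ¬ ‖x‖ ≤ L.rcut + L.Rdef, excess P c₀ f x =
      ∑ x : cellPts C N, if ¬ ‖(x : Eu d)‖ ≤ L.rcut + L.Rdef then excess P c₀ w x else 0 := by
    have hsets : (homCell C N).filter (fun x => ¬ ‖x‖ ≤ L.rcut + L.Rdef) =
        (cellPts C N).filter fun x => ¬ ‖x‖ ≤ L.rcut + L.Rdef := by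
      ext x
      rw [Finset.mem_filter, Finset.mem_filter, mem_homCell, mem_cellPts]
      refine and_congr_left fun h => and_congr_left fun _ => ?_
      exact (mem_pts_iff (by linarith [not_le.mp h])).symm
    rw [Finset.sum_coe_sort (cellPts C N)
      (fun x => if ¬ ‖x‖ ≤ L.rcut + L.Rdef then excess P c₀ w x else 0), ← Finset.sum_filter, hsets]
    refine Finset.sum_congr rfl fun x hx => excess_congr P c₀ fun ρ hρ => ?_
    obtain ⟨hx1, hx2⟩ := Finset.mem_filter.mp hx
    have hx3 := ((mem_cellPts C).mp hx1).2
    have hx4 := not_le.mp hx2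
    have hρ' := (mem_rangeHom.mp hρ).2
    have e1 : f x = w x := by
      simp only [hf, cellPart_of_mem C hN hx3]
      rw [if_neg (by linarith)]
    have e2 : f (x + ρ) = w (x + ρ) := by
      simp only [hf]
      refine if_neg (not_lt.mpr ?_)
      rcases hwrap x hx3 ρ hρ' with h | h
      · rw [h.2]
        have := norm_sub_le (x + ρ) ρ
        rw [add_sub_cancel_right] at this
        linarith
      · exact h.2.1
    rw [e1, e2]
  -- comparison at each site
  have hsite : ∀ x : cellPts C N, (c₀ - ε) * normSq (gradPer C v.1 x) +
      (if ¬ ‖(x : Eu d)‖ ≤ L.rcut + L.Rdef then excess P c₀ w x else 0) -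
      (if toSite C x ∈ Z then (M + M₀ + c₀) * normSq (gradPer C v.1 x) else 0) ≤
      hessian (P.V (toSite C x)) (g₀ (toSite C x)).ofLp (gradPer C v.1 x) (gradPer C v.1 x) := by
    intro x
    set G := gradPer C v.1 x with hG
    have hG0 := normSq_nonneg G
    have h1 := abs_le.mp ((abs_hessian_le (P.V (toSite C x)) (g₀ (toSite C x)).ofLp G).trans
      (mul_le_mul_of_nonneg_right (hM (toSite C x)) hG0))
    have hεG := mul_nonneg hε.le hG0
    have hcG := mul_nonneg hc₀ hG0
    have hMG := mul_nonneg hM₀ hG0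
    by_cases hx1 : ‖(x : Eu d)‖ ≤ L.rcut + L.Rdef
    · have hxZ : toSite C x ∈ Z := by
        refine Finset.mem_union_right _ ?_
        rw [Set.Finite.mem_toFinset]
        exact hx1.trans (le_max_right _ _)
      rw [if_neg (not_not.mpr hx1), if_pos hxZ]
      linarith [h1.1]
    · have hx2 : L.rcut + L.Rdef < ‖((toSite C x : L.pts) : Eu d)‖ := not_le.mp hx1
      have hR := range_eq_rangeHom (toSite C x).2 hx2
      have h2 : excess P c₀ w x = hessian (P.V (toSite C x)) 0 G G - c₀ * normSq G := by
        rw [excess, hG, hgx x]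
        have e1 := hessian_congr hR (P.homogeneous (toSite C x) hx2) (fun _ => 0)
          (fun ρ => w (x + ρ) - w x) (fun ρ => w (x + ρ) - w x)
        have e2 := normSq_congr hR (fun ρ => w (x + ρ) - w x)
        rw [← e2]
        exact congrArg (· - _) e1.symm
      rw [if_pos hx1, h2]
      by_cases hxZ : toSite C x ∈ Z
      · rw [if_pos hxZ]
        have h3 := abs_le.mp ((abs_hessian_le (P.V (toSite C x)) 0 G).trans
          (mul_le_mul_of_nonneg_right (hzero (toSite C x) hx2) hG0))
        linarith [h1.1, h3.2]
      · rw [if_neg hxZ]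
        have hfarS : S < ‖((toSite C x : L.pts) : Eu d)‖ := by
          by_contra hcon
          refine hxZ (Finset.mem_union_right _ ?_)
          rw [Set.Finite.mem_toFinset]
          exact (not_lt.mp hcon).trans (le_max_left _ _)
        have h3 := hmod (toSite C x) hx2 _ (hS (toSite C x) hfarS)
        have h4 : |hessian (P.V (toSite C x)) (g₀ (toSite C x)).ofLp G G -
            hessian (P.V (toSite C x)) 0 G G| ≤ ε * normSq G := by
          have h5 := (fderiv ℝ (fderiv ℝ (P.V (toSite C x))) (g₀ (toSite C x)).ofLp -
            fderiv ℝ (fderiv ℝ (P.V (toSite C x))) 0).le_opNorm₂ G G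
          rw [Real.norm_eq_abs, mul_assoc, ← sq] at h5
          refine h5.trans (mul_le_mul h3 (sq_norm_le_normSq' G) (sq_nonneg _) hε.le)
        linarith [(abs_le.mp h4).1]
  have hsum := Finset.sum_le_sum fun x (_ : x ∈ Finset.univ) => hsite x
  rw [Finset.sum_sub_distrib, Finset.sum_add_distrib, ← Finset.mul_sum, ← norm_perGradMap_sq,
    ← hfar, ← Finset.sum_filter, ← Finset.mul_sum] at hsum
  have hZsum : ∑ x : cellPts C N with toSite C x ∈ Z, normSq (gradPer C v.1 x) ≤ E := by
    refine sum_le_sum_of_injOn _ _ (toSite C) (fun x hx => (Finset.mem_filter.mp hx).2)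
      (fun x _ y _ h => Subtype.ext (congrArg (fun z : L.pts => (z : Eu d)) h)) _ _
      (fun x _ => le_of_eq ?_) fun _ _ => normSq_nonneg _
    rw [hg, perGradMap_apply, perStencil_toSite]
  have h7 := mul_le_mul_of_nonneg_left hZsum (by positivity : 0 ≤ M + M₀ + c₀)
  have h8 : (n₁ * K₂ + (M + M₀ + c₀)) * E = n₁ * (K₂ * E) + (M + M₀ + c₀) * E := by ring
  rw [h8]
  linarith

end Garding

/-! ### The truncated displacement -/

section Truncation

variable {d m : ℕ} {L : DefectLattice d} (C : Supercell L)

theorem exists_norm_le_of_mem_cell :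
    ∃ γ : ℝ, 0 < γ ∧ ∀ (n : ℕ) (x : Eu d), x ∈ cell C n → ‖x‖ ≤ γ * n := by
  obtain ⟨γ, hγ, h⟩ := exists_norm_mulE_le C.B
  refine ⟨γ, hγ, ?_⟩
  rintro n _ ⟨y, hy, rfl⟩
  refine (h y).trans (mul_le_mul_of_nonneg_left ?_ hγ.le)
  refine (pi_norm_le_iff_of_nonneg n.cast_nonneg).mpr fun i => ?_
  exact abs_le.mpr ⟨(hy i).1.le, (hy i).2⟩

theorem extend_perTrunc (η : ℕ → Eu d → ℝ) {N : ℕ} (hN : 0 < N) (u : L.pts → Eu m) {y : Eu d}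
    (hy : y ∈ perPts C N) :
    extend (perPts C N) (perTrunc C η N u).1 y =
      η N (cellPart C N y) • (extend L.pts u (cellPart C N y) - annulusMean C N u) := by
  have hrep := cellRep_eq C hN ⟨y, hy⟩
  have hmem : ((cellRep C (⟨y, hy⟩ : perPts C N) : L.pts) : Eu d) ∈ cellPts C N :=
    (Exists.choose_spec hy).1
  rw [extend_of_mem _ hy]
  change trunc C η N u (cellRep C ⟨y, hy⟩) = _
  rw [trunc, if_pos hmem, ← hrep, extend_coe]

/-- The term `‖b‖` on the right covers an empty annulus, for which the mean is zero. -/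
theorem norm_annulusMean_sub_le (N : ℕ) (u : L.pts → Eu m) (b : Eu m) {M : ℝ} (hM : 0 ≤ M)
    (h : ∀ x : L.pts, (x : Eu d) ∈ cellR C (5 * (N : ℝ) / 6 + L.rcut) → ‖u x - b‖ ≤ M) :
    ‖annulusMean C N u - b‖ ≤ M + ‖b‖ := by
  rcases (annulus C N).eq_empty_or_nonempty with he | hne
  · have : annulusMean C N u = 0 := by
      rw [annulusMean, Finset.card_eq_zero.mpr he, Nat.cast_zero, inv_zero, zero_smul]
    rw [this, zero_sub, norm_neg]
    linarith
  have hc : (0 : ℝ) < (annulus C N).card := by exact_mod_cast hne.card_pos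
  have e : annulusMean C N u - b = ((annulus C N).card : ℝ)⁻¹ •
      ∑ x : annulus C N, (u ⟨x, ((finite_annulus C N).mem_toFinset.mp x.2).1⟩ - b) := by
    rw [Finset.sum_sub_distrib, smul_sub, annulusMean]
    simp only [Finset.sum_const, Finset.card_univ, Fintype.card_coe]
    rw [← Nat.cast_smul_eq_nsmul ℝ, smul_smul, inv_mul_cancel₀ hc.ne', one_smul]
  have h1 : ‖∑ x : annulus C N, (u ⟨x, ((finite_annulus C N).mem_toFinset.mp x.2).1⟩ - b)‖ ≤
      (annulus C N).card * M := by
    refine (norm_sum_le_of_le (Finset.univ : Finset (annulus C N)) fun x _ => h _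
      ((finite_annulus C N).mem_toFinset.mp x.2).2.1).trans ?_
    simp
  rw [e, norm_smul, norm_inv, Real.norm_of_nonneg hc.le]
  calc ((annulus C N).card : ℝ)⁻¹ * _ ≤ ((annulus C N).card : ℝ)⁻¹ * ((annulus C N).card * M) :=
        mul_le_mul_of_nonneg_left h1 (by positivity)
    _ = M := by field_simp
    _ ≤ M + ‖b‖ := le_add_of_nonneg_right (norm_nonneg _)

variable {C} {η : ℕ → Eu d → ℝ}

/-- Near the defect the truncation differs from the displacement by a constant. -/
theorem eventually_gradPer_perTrunc_eq (hη : IsCutoffFamily C η) (u : L.pts → Eu m) (S : ℝ) :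
    ∀ᶠ N in atTop, ∀ x : cellPts C N, ‖(x : Eu d)‖ ≤ S →
      gradPer C (perTrunc C η N u).1 x = grad u (toSite C x) := by
  obtain ⟨K, R₀, hη⟩ := hη
  have hceil : Tendsto (fun N : ℕ => ⌈4 * (N : ℝ) / 6⌉₊) atTop atTop :=
    tendsto_nat_ceil_atTop.comp
      ((tendsto_natCast_atTop_atTop.const_mul_atTop (by norm_num)).atTop_div_const (by norm_num))
  filter_upwards [eventually_ge_atTop R₀, eventually_gt_atTop 0,
    eventually_mem_cell C (S + L.rcut), hceil.eventually (eventually_mem_cell C (S + L.rcut)),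
    eventually_add_mem_perPts C] with N hR hN hcell hcell' hper x hx
  obtain ⟨-, -, hone, -, -⟩ := hη N hR
  have hrc := L.rcut_pos
  have key : ∀ y : Eu d, y ∈ perPts C N → ‖y‖ ≤ S + L.rcut →
      extend (perPts C N) (perTrunc C η N u).1 y = extend L.pts u y - annulusMean C N u := by
    intro y hy hyS
    rw [extend_perTrunc C η hN u hy, cellPart_of_mem C hN (hcell y hyS), hone y (hcell' y hyS),
      one_smul]
  rw [gradPer_eq hper, grad_eq]
  funext ρ
  have hρ := (mem_range.mp ρ.2).2
  change extend (perPts C N) _ ((x : Eu d) + ρ) - extend (perPts C N) _ (x : Eu d) =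
    extend L.pts u ((x : Eu d) + ρ) - extend L.pts u (x : Eu d)
  rw [key _ (hper x ρ ρ.2) ((norm_add_le _ _).trans (by linarith)),
    key _ (cellPts_subset_perPts C x) (by linarith)]
  abel

/-- Far from the defect the gradient of the truncation is small: the product rule leaves the
gradient of the displacement, and the oscillation of the displacement on `Q_N`, which is `o(N)`,
times the slope `O(1/N)` of the cut-off function. -/
theorem exists_norm_gradPer_perTrunc_le (hη : IsCutoffFamily C η) (u : W12def L m) {δ : ℝ}
    (hδ : 0 < δ) : ∃ S : ℝ, ∀ᶠ N in atTop, ∀ x : cellPts C N, S < ‖(x : Eu d)‖ →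
      ‖gradPer C (perTrunc C η N u.1).1 x‖ ≤ δ := by
  obtain ⟨x₀⟩ := L.connected.nonempty
  obtain ⟨K, R₀, hη⟩ := hη
  have hrc := L.rcut_pos
  obtain ⟨S, hS⟩ := exists_norm_le_of_far (gradMap L m u) (half_pos hδ)
  obtain ⟨γ, hγ, hcellnorm⟩ := exists_norm_le_of_mem_cell C
  obtain ⟨β, hβ0, hβ⟩ := exists_coord_bound C
  set T := (|K| + 1) * L.rcut with hT
  have hT0 : 0 < T := by positivity
  obtain ⟨K', hK', hsub⟩ := exists_sublinear_growth x₀ u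
    (show 0 < δ / (8 * T * γ) by positivity)
  refine ⟨S, ?_⟩
  have hlarge : ∀ t : ℝ, ∀ᶠ N : ℕ in atTop, t ≤ N := fun t =>
    tendsto_natCast_atTop_atTop.eventually (eventually_ge_atTop t)
  filter_upwards [eventually_ge_atTop R₀, eventually_gt_atTop 0, eventually_add_mem_perPts C,
    hlarge (6 * (β * L.rcut + 1)), hlarge (6 * (L.rcut + 1)),
    hlarge (4 * T * (2 * K' + ‖u.1 x₀‖) / δ)] with N hR hN hper hN1 hN2 hN3 x hx
  obtain ⟨hsmooth, hIcc, -, hzero, hder⟩ := hη N hR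
  have hNr : (0 : ℝ) < N := by exact_mod_cast hN
  set n := ⌈5 * (N : ℝ) / 6⌉₊ with hn
  have hn' : (n : ℝ) < 5 * (N : ℝ) / 6 + 1 := Nat.ceil_lt_add_one (by positivity)
  have hxc := ((mem_cellPts C).mp x.2).2
  set M := δ / (8 * T * γ) * (γ * N) + K' with hM
  have hM0 : 0 ≤ M := by positivity
  have hosc : ∀ y : L.pts, (y : Eu d) ∈ cell C N → ‖u.1 y - u.1 x₀‖ ≤ M := fun y hy =>
    (hsub y).trans (add_le_add
      (mul_le_mul_of_nonneg_left (hcellnorm N y hy) (by positivity)) le_rfl)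
  have hmean := norm_annulusMean_sub_le C N u.1 (u.1 x₀) hM0 fun y hy => hosc y (by
    refine cell_mono C ?_ hy
    exact Nat.ceil_le.mpr (by linarith))
  set a := annulusMean C N u.1 with ha
  have hslope : ∀ y z : Eu d, |η N y - η N z| ≤ |K| * (N : ℝ)⁻¹ * ‖y - z‖ := by
    intro y z
    have hb : ∀ w ∈ (Set.univ : Set (Eu d)), ‖fderiv ℝ (η N) w‖ ≤ |K| * (N : ℝ)⁻¹ := by
      intro w _
      have := hder 1 (by simp) w
      rw [norm_iteratedFDeriv_one, pow_one] at this
      exact this.trans (mul_le_mul_of_nonneg_right (le_abs_self K) (by positivity))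
    exact convex_univ.norm_image_sub_le_of_norm_fderiv_le
      (fun w _ => hsmooth.differentiable (by norm_num) w) hb (Set.mem_univ z) (Set.mem_univ y)
  refine (pi_norm_le_iff_of_nonneg hδ.le).mpr fun ρ => ?_
  rw [gradPer_eq hper]
  have hρ := mem_range.mp ρ.2
  change ‖extend (perPts C N) _ ((x : Eu d) + ρ) - extend (perPts C N) _ (x : Eu d)‖ ≤ δ
  rw [extend_perTrunc C η hN _ (hper x ρ ρ.2),
    extend_perTrunc C η hN _ (cellPts_subset_perPts C x), cellPart_of_mem C hN hxc, ← ha]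
  -- either the bond does not cross the cell boundary, or both ends are outside the support of `η N`
  rcases cellPart_add_or (C := C) hβ0 hβ (n := n) hN (by linarith) hxc hρ.2 with
    ⟨-, h2⟩ | ⟨h1, h2, -⟩
  · rw [h2]
    have hxs : extend L.pts u.1 (x : Eu d) = u.1 (toSite C x) := extend_coe _ _ (toSite C x)
    have hg : ‖extend L.pts u.1 ((x : Eu d) + ρ) - extend L.pts u.1 (x : Eu d)‖ ≤ δ / 2 := by
      have h3 := (norm_le_pi_norm _ ρ).trans (hS (toSite C x) hx)
      rw [gradMap_apply] at h3
      simp only [grad_eq] at h3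
      exact h3
    have hua : ‖extend L.pts u.1 (x : Eu d) - a‖ ≤ 2 * M + ‖u.1 x₀‖ := by
      rw [hxs]
      have h4 := hosc (toSite C x) hxc
      have h5 := norm_sub_le (u.1 (toSite C x) - u.1 x₀) (a - u.1 x₀)
      rw [sub_sub_sub_cancel_right] at h5
      linarith
    have e : η N (x + ρ) • (extend L.pts u.1 (x + ρ) - a) - η N x • (extend L.pts u.1 x - a) =
        η N (x + ρ) • (extend L.pts u.1 (x + ρ) - extend L.pts u.1 x) +
          (η N (x + ρ) - η N x) • (extend L.pts u.1 x - a) := by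
      module
    rw [e]
    have hs : |η N (x + ρ) - η N x| ≤ T * (N : ℝ)⁻¹ := by
      refine (hslope _ _).trans ?_
      rw [add_sub_cancel_left, hT]
      have : |K| * ‖(ρ : Eu d)‖ ≤ (|K| + 1) * L.rcut := by
        have := hρ.2.le
        gcongr
        linarith
      calc |K| * (N : ℝ)⁻¹ * ‖(ρ : Eu d)‖ = |K| * ‖(ρ : Eu d)‖ * (N : ℝ)⁻¹ := by ring
        _ ≤ _ := mul_le_mul_of_nonneg_right this (by positivity)
    have hη1 : |η N (x + ρ)| ≤ 1 := by
      rw [abs_of_nonneg (hIcc _).1]; exact (hIcc _).2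
    have hsecond : T * (N : ℝ)⁻¹ * (2 * M + ‖u.1 x₀‖) ≤ δ / 2 := by
      rw [div_le_iff₀ hδ] at hN3
      have : T * (N : ℝ)⁻¹ * (2 * M + ‖u.1 x₀‖) =
          δ / 4 + T * (2 * K' + ‖u.1 x₀‖) / N := by
        rw [hM]; field_simp; ring
      rw [this]
      have : T * (2 * K' + ‖u.1 x₀‖) / N ≤ δ / 4 := by
        rw [div_le_iff₀ hNr]; linarith
      linarith
    calc _ ≤ ‖η N (x + ρ) • (extend L.pts u.1 (x + ρ) - extend L.pts u.1 x)‖ +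
          ‖(η N (x + ρ) - η N x) • (extend L.pts u.1 x - a)‖ := norm_add_le _ _
      _ ≤ 1 * (δ / 2) + T * (N : ℝ)⁻¹ * (2 * M + ‖u.1 x₀‖) := by
          rw [norm_smul, norm_smul]
          exact add_le_add (mul_le_mul hη1 hg (norm_nonneg _) zero_le_one)
            (mul_le_mul hs hua (norm_nonneg _) (by positivity))
      _ ≤ δ := by linarith
  · rw [hzero _ h1, hzero _ h2]
    simpa using hδ.le

/-- The second derivatives of the site energies at the truncation converge, uniformly over the
sites, to those at the displacement. -/
theorem eventually_norm_hessian_perTrunc_sub_le (P : SiteEnergies L m) (hη : IsCutoffFamily C η)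
    (u : W12def L m) {ε : ℝ} (hε : 0 < ε) : ∀ᶠ N in atTop, ∀ x : cellPts C N,
      ‖fderiv ℝ (fderiv ℝ (P.V (toSite C x))) (gradPer C (perTrunc C η N u.1).1 x) -
        fderiv ℝ (fderiv ℝ (P.V (toSite C x))) (grad u.1 (toSite C x))‖ ≤ ε := by
  obtain ⟨δ, hδ, hmod⟩ := exists_hessian_modulus P (half_pos hε)
  obtain ⟨S₁, h1⟩ := exists_norm_gradPer_perTrunc_le hη u hδ
  obtain ⟨S₂, h2⟩ := exists_norm_le_of_far (gradMap L m u) hδ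
  filter_upwards [h1, eventually_gradPer_perTrunc_eq hη u.1
    (max (max S₁ S₂) (L.rcut + L.Rdef))] with N hfar hnear x
  by_cases hx : ‖(x : Eu d)‖ ≤ max (max S₁ S₂) (L.rcut + L.Rdef)
  · rw [hnear x hx]
    refine le_of_eq_of_le ?_ hε.le
    exact (congrArg norm (sub_self (G := (L.range (toSite C x) → Eu m) →L[ℝ]
      (L.range (toSite C x) → Eu m) →L[ℝ] ℝ) _)).trans ContinuousLinearMap.opNorm_zero
  · obtain ⟨h3, h4⟩ := max_lt_iff.mp (not_le.mp hx)
    obtain ⟨h5, h6⟩ := max_lt_iff.mp h3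
    have e1 := hmod (toSite C x) h4 _ (hfar x h5)
    have e2 := hmod (toSite C x) h4 _ (h2 (toSite C x) h6)
    have e3 := norm_sub_le_norm_sub_add_norm_sub
      (fderiv ℝ (fderiv ℝ (P.V (toSite C x))) (gradPer C (perTrunc C η N u.1).1 x))
      (fderiv ℝ (fderiv ℝ (P.V (toSite C x))) 0)
      (fderiv ℝ (fderiv ℝ (P.V (toSite C x))) (grad u.1 (toSite C x)))
    rw [norm_sub_rev (fderiv ℝ (fderiv ℝ (P.V (toSite C x))) 0)] at e3
    refine e3.trans ?_
    have e2' : ‖fderiv ℝ (fderiv ℝ (P.V (toSite C x))) (grad u.1 (toSite C x)) -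
      fderiv ℝ (fderiv ℝ (P.V (toSite C x))) 0‖ ≤ ε / 2 := e2
    linarith

end Truncation

/-! ### The second variation as a bounded form -/

section Constants

variable {d m : ℕ} {L : DefectLattice d}

theorem ker_gradMap : LinearMap.ker (gradMap L m) = constants L m := by
  ext v
  rw [LinearMap.mem_ker]
  constructor
  · intro h
    obtain ⟨x₀⟩ := L.connected.nonempty
    refine ⟨v.1 x₀, connected_induction L.connected x₀ rfl fun x y hx hxy => ?_⟩
    have h1 : grad v.1 x = 0 := by
      rw [← WithLp.ofLp_toLp 2 (grad v.1 x), ← gradMap_apply, h]; rfl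
    have h2 := congrFun h1 ⟨(y : Eu d) - x, mem_range.mpr ⟨by simp, hxy⟩⟩
    rw [grad_eq] at h2
    simp only [add_sub_cancel, extend_coe, Pi.zero_apply] at h2
    rw [sub_eq_zero.mp h2, hx]
  · rintro ⟨a, ha⟩
    ext x : 2
    rw [gradMap_apply]
    have : grad v.1 x = 0 := by
      funext ρ
      simp [grad, stencil, ha]
    rw [this]; rfl

theorem fg_constants : (constants L m).FG := by
  let f : Eu m →ₗ[ℝ] W12def L m :=
    { toFun := fun a => ⟨fun _ => a, by
        change Summable _
        simp [stencil, normSq, summable_zero]⟩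
      map_add' := fun _ _ => rfl
      map_smul' := fun _ _ => rfl }
  have : constants L m = LinearMap.range f := by
    ext v
    exact ⟨fun ⟨a, ha⟩ => ⟨a, Subtype.ext (funext fun x => (ha x).symm)⟩,
      fun ⟨a, ha⟩ => ⟨a, fun x => by rw [← ha]; rfl⟩⟩
  rw [this, LinearMap.range_eq_map]
  exact Module.Finite.fg_top.map f

end Constants

section SecondVariation

variable {d m : ℕ} {L : DefectLattice d}

/-- `B` represents the second variation at `u` on the stencil space. -/
def IsHessForm (P : SiteEnergies L m) (u : W12def L m)
    (B : StencilSpace L m →L[ℝ] StencilSpace L m →L[ℝ] ℝ) : Prop :=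
  ∀ g h, HasSum (fun x => fderiv ℝ (fderiv ℝ (P.V x)) (grad u.1 x) (g x).ofLp (h x).ofLp) (B g h)

variable {P : SiteEnergies L m} {u : W12def L m}
  {B : StencilSpace L m →L[ℝ] StencilSpace L m →L[ℝ] ℝ}

theorem exists_isHessForm (P : SiteEnergies L m) (u : W12def L m) : ∃ B, IsHessForm P u B := by
  obtain ⟨M, hM⟩ := exists_hessian_bound P (gradMap L m u)
  exact exists_blockForm (fun x => fderiv ℝ (fderiv ℝ (P.V x)) (grad u.1 x)) hM

theorem IsHessForm.symm (hB : IsHessForm P u B) (g h : StencilSpace L m) : B g h = B h g := by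
  refine (hB g h).unique ((hB h g).congr_fun ?_)
  exact fun x => hessian_symm P x _ _ _

theorem IsHessForm.hess_eq (hB : IsHessForm P u B) (v w : W12def L m) :
    hess P u.1 v.1 w.1 = B (gradMap L m v) (gradMap L m w) :=
  (hB (gradMap L m v) (gradMap L m w)).tsum_eq

theorem abs_sum_form_le {C : Supercell L} {N : ℕ}
    (b : ∀ x : cellPts C N, (L.range (toSite C x) → Eu m) →L[ℝ]
      (L.range (toSite C x) → Eu m) →L[ℝ] ℝ) {ε : ℝ} (hε : 0 ≤ ε) (hb : ∀ x, ‖b x‖ ≤ ε)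
    (v w : Wper C m N) :
    |∑ x : cellPts C N, b x (gradPer C v.1 x) (gradPer C w.1 x)| ≤
      ε * ‖perGradMap C m N v‖ * ‖perGradMap C m N w‖ := by
  have h1 : ∀ v : Wper C m N, √(∑ x : cellPts C N, ‖gradPer C v.1 x‖ ^ 2) ≤
      ‖perGradMap C m N v‖ := fun v => by
    rw [← energyNormPer_eq]
    exact Real.sqrt_le_sqrt (Finset.sum_le_sum fun x _ => sq_norm_le_normSq' _)
  calc |∑ x : cellPts C N, b x (gradPer C v.1 x) (gradPer C w.1 x)|
      ≤ ∑ x : cellPts C N, |b x (gradPer C v.1 x) (gradPer C w.1 x)| :=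
        Finset.abs_sum_le_sum_abs _ _
    _ ≤ ∑ x : cellPts C N, ε * (‖gradPer C v.1 x‖ * ‖gradPer C w.1 x‖) := by
        refine Finset.sum_le_sum fun x _ => ?_
        refine ((b x).le_opNorm₂ _ _).trans ?_
        rw [mul_assoc]
        exact mul_le_mul_of_nonneg_right (hb x) (by positivity)
    _ = ε * ∑ x : cellPts C N, ‖gradPer C v.1 x‖ * ‖gradPer C w.1 x‖ := by
        rw [Finset.mul_sum]
    _ ≤ ε * (‖perGradMap C m N v‖ * ‖perGradMap C m N w‖) := by
        refine mul_le_mul_of_nonneg_left ((Real.sum_mul_le_sqrt_mul_sqrt _ _ _).trans ?_) hε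
        exact mul_le_mul (h1 v) (h1 w) (Real.sqrt_nonneg _) (norm_nonneg _)
    _ = _ := (mul_assoc _ _ _).symm

/-- The supercell second variation at the truncation is close to the second variation at `u`. -/
theorem IsHessForm.eventually_abs_hessPer_sub_le (hB : IsHessForm P u B) {C : Supercell L}
    {η : ℕ → Eu d → ℝ} (hη : IsCutoffFamily C η) {ε : ℝ} (hε : 0 < ε) :
    ∀ᶠ N in atTop, ∀ v w : Wper C m N,
      |hessPer C P (perTrunc C η N u.1).1 v.1 w.1 - B (perGradMap C m N v) (perGradMap C m N w)| ≤
        ε * ‖perGradMap C m N v‖ * ‖perGradMap C m N w‖ := by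
  filter_upwards [eventually_norm_hessian_perTrunc_sub_le P hη u hε] with N hN v w
  refine le_of_eq_of_le ?_ (abs_sum_form_le _ hε.le hN v w)
  rw [form_perGradMap hB, hessPer, ← Finset.sum_sub_distrib]
  rfl

/-- A weighted sum of squares of finitely many stencils is a sum of squares of functionals. -/
theorem exists_functionals (Z : Finset L.pts) {K : ℝ} (hK : 0 ≤ K) :
    ∃ (ι : Type) (_ : Fintype ι) (l : ι → StencilSpace L m →L[ℝ] ℝ),
      ∀ g : StencilSpace L m, ∑ i, l i g ^ 2 = K * ∑ x ∈ Z, normSq (g x).ofLp := by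
  classical
  let E : L.pts → Type := fun x => PiLp 2 fun _ : L.range x => Eu m
  refine ⟨Σ x : Z, L.range (x : L.pts) × Fin m, inferInstance, fun i =>
    √K • ((EuclideanSpace.proj i.2.2 : Eu m →L[ℝ] ℝ) ∘L
      (PiLp.proj 2 (fun _ : L.range (i.1 : L.pts) => Eu m) i.2.1 : _ →L[ℝ] Eu m) ∘L
      lp.evalCLM ℝ E 2 (i.1 : L.pts)), fun g => ?_⟩
  rw [Fintype.sum_sigma, Finset.mul_sum, ← Finset.sum_coe_sort Z]
  refine Finset.sum_congr rfl fun x _ => ?_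
  rw [Fintype.sum_prod_type, normSq, Finset.mul_sum]
  refine Finset.sum_congr rfl fun ρ _ => ?_
  rw [EuclideanSpace.norm_sq_eq, Finset.mul_sum]
  refine Finset.sum_congr rfl fun j _ => ?_
  change (√K * ((g x).ofLp ρ).ofLp j) ^ 2 = _
  rw [mul_pow, Real.sq_sqrt hK, Real.norm_eq_abs, sq_abs]

/-- Gårding inequality on periodic gradients: the second variation is coercive up to a finite-rank
form, uniformly in the size of the supercell. -/
theorem IsHessForm.exists_garding_per (hB : IsHessForm P u B) (C : Supercell L) {c₀ : ℝ}
    (hc₀ : 0 < c₀) (hP : PhononStable P c₀) :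
    ∃ (ι : Type) (_ : Fintype ι) (l : ι → StencilSpace L m →L[ℝ] ℝ), ∀ᶠ N in atTop,
      ∀ g ∈ LinearMap.range (perGradMap C m N), 3 / 4 * c₀ * ‖g‖ ^ 2 - ∑ i, l i g ^ 2 ≤ B g g := by
  obtain ⟨Z, K, hK, h⟩ := eventually_coercive_up_to_finite P C hc₀.le hP (gradMap L m u)
    (show 0 < c₀ / 4 by positivity)
  obtain ⟨ι, hι, l, hl⟩ := exists_functionals (m := m) Z hK
  refine ⟨ι, hι, l, ?_⟩
  filter_upwards [h] with N hN
  rintro _ ⟨v, rfl⟩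
  rw [hl, form_perGradMap hB]
  have := hN v
  rw [show c₀ - c₀ / 4 = 3 / 4 * c₀ by ring] at this
  exact this

/-- The Gårding inequality passes to the gradients of finite-energy displacements by density. -/
theorem garding_of_garding_per {C : Supercell L} {a : ℝ} {ι : Type*} [Fintype ι]
    {l : ι → StencilSpace L m →L[ℝ] ℝ} (h : ∀ᶠ N in atTop,
      ∀ g ∈ LinearMap.range (perGradMap C m N), a * ‖g‖ ^ 2 - ∑ i, l i g ^ 2 ≤ B g g) :
    ∀ g ∈ LinearMap.range (gradMap L m), a * ‖g‖ ^ 2 - ∑ i, l i g ^ 2 ≤ B g g := by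
  intro g hg
  have hcl : IsClosed {g : StencilSpace L m | a * ‖g‖ ^ 2 - ∑ i, l i g ^ 2 ≤ B g g} := by
    refine isClosed_le (by fun_prop) ?_
    exact B.continuous.clm_apply continuous_id
  refine closure_minimal ?_ hcl (dense_compactSupp g hg)
  intro p hp
  obtain ⟨N, h1, h2⟩ := (h.and (eventually_mem_range_perGradMap C p hp)).exists
  exact h1 p h2

/-- Inf-sup stability in terms of the representing form, with an explicit constant. -/
theorem IsHessForm.exists_infSup (hB : IsHessForm P u B) (hstab : InfSupStable P u.1) :
    ∃ c : ℝ, 0 < c ∧ ∀ g ∈ LinearMap.range (gradMap L m), ∃ h ∈ LinearMap.range (gradMap L m),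
      ‖h‖ ≤ 1 ∧ c * ‖g‖ ≤ B g h := by
  obtain ⟨c, hc0, hc⟩ := EReal.lt_iff_exists_real_btwn.mp hstab
  refine ⟨c, by exact_mod_cast hc0, ?_⟩
  rintro _ ⟨v, rfl⟩
  rcases eq_or_ne (gradMap L m v) 0 with h0 | h0
  · exact ⟨0, Submodule.zero_mem _, by simp, by simp [h0]⟩
  have hn : 0 < ‖gradMap L m v‖ := norm_pos_iff.mpr h0
  have h1 : energyNorm (‖gradMap L m v‖⁻¹ • v).1 = 1 := by
    rw [energyNorm_eq, map_smul, norm_smul, norm_inv, norm_norm, inv_mul_cancel₀ hn.ne']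
  have h2 := hc.trans_le (iInf_le _ ⟨‖gradMap L m v‖⁻¹ • v, h1⟩)
  obtain ⟨⟨w, hw⟩, h3⟩ := lt_iSup_iff.mp h2
  have h4 : c < hess P u.1 (‖gradMap L m v‖⁻¹ • v).1 w.1 := EReal.coe_lt_coe_iff.mp h3
  rw [hB.hess_eq, map_smul, map_smul, smul_apply, smul_eq_mul, ← div_eq_inv_mul,
    lt_div_iff₀ hn] at h4
  refine ⟨_, ⟨w, rfl⟩, ?_, h4.le⟩
  rw [← energyNorm_eq, hw]

/-- The negative spectral subspace on gradients and its complement pull back to a splitting. -/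
theorem exists_isSplittingConstant (C : Supercell L) {c₀ : ℝ}
    (hc₀ : 0 < c₀) (hP : PhononStable P c₀) (hstab : InfSupStable P u.1) :
    ∃ c₁ : ℝ, IsSplittingConstant P u.1 c₁ := by
  obtain ⟨B, hB⟩ := exists_isHessForm P u
  obtain ⟨ι, _, l, hl⟩ := hB.exists_garding_per C hc₀ hP
  have hG := garding_of_garding_per hl
  obtain ⟨c, hc, hinf⟩ := hB.exists_infSup hstab
  set S := LinearMap.range (gradMap L m) with hS
  have : CompleteSpace S := isClosed_range_gradMap.completeSpace_coe
  obtain ⟨c₁, hc₁, W, hW, hneg, hpos⟩ := exists_splitting (B.bilinearComp S.subtypeL S.subtypeL)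
    (fun v w => hB.symm v w) (fun i => (l i).comp S.subtypeL)
    (show 0 < 3 / 4 * c₀ by positivity) (fun v => hG v v.2) hc
    (fun v => by
      obtain ⟨h, hh, h1, h2⟩ := hinf v v.2
      exact ⟨⟨h, hh⟩, h1, h2⟩)
  have hneg' : ∀ p ∈ W, c₁ * ‖(p : StencilSpace L m)‖ ^ 2 ≤ -B p p := fun p hp => hneg p hp
  have hpos' : ∀ p ∈ Wᗮ, c₁ * ‖(p : StencilSpace L m)‖ ^ 2 ≤ B p p := fun p hp => hpos p hp
  set G : W12def L m →ₗ[ℝ] S := (gradMap L m).rangeRestrict with hG'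
  have hGsurj : Function.Surjective G := LinearMap.surjective_rangeRestrict _
  have hker : LinearMap.ker G = constants L m := by
    rw [hG', LinearMap.ker_rangeRestrict, ker_gradMap]
  refine ⟨c₁, hc₁, W.comap G, Wᗮ.comap G, ?_, ?_, ?_, ?_, ?_, ?_⟩
  · rw [← Submodule.comap_inf, Submodule.inf_orthogonal_eq_bot, Submodule.comap_bot, hker]
  · refine eq_top_iff.mpr fun v _ => ?_
    obtain ⟨p, hp, q, hq, h⟩ := W.exists_add_mem_mem_orthogonal (G v)
    obtain ⟨a, rfl⟩ := hGsurj p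
    refine Submodule.mem_sup.mpr ⟨a, hp, v - a, ?_, add_sub_cancel _ _⟩
    rw [Submodule.mem_comap, map_sub, h, add_sub_cancel_left]
    exact hq
  · refine Module.Finite.iff_fg.mpr (Submodule.fg_of_fg_map_of_fg_inf_ker G ?_ ?_)
    · rw [Submodule.map_comap_eq_of_surjective hGsurj]
      exact Module.Finite.iff_fg.mp hW
    · have : W.comap G ⊓ LinearMap.ker G = LinearMap.ker G :=
        inf_eq_right.mpr (LinearMap.ker_le_comap G)
      rw [this, hker]
      exact fg_constants
  · intro v hv w hw
    rw [energyInner_eq]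
    exact hw (G v) hv
  · intro v hv
    rw [energyNorm_eq, hB.hess_eq]
    exact hneg' (G v) hv
  · intro v hv
    rw [energyNorm_eq, hB.hess_eq]
    exact hpos' (G v) hv

/-- Stability of the supercell problems, before passing to suprema and infima. -/
theorem IsSplittingConstant.eventually_exists_le_hessPer (C : Supercell L) {c₀ c₁ : ℝ}
    (hc₀ : 0 < c₀) (hP : PhononStable P c₀) {η : ℕ → Eu d → ℝ} (hη : IsCutoffFamily C η)
    (hc₁ : IsSplittingConstant P u.1 c₁) :
    ∀ᶠ N in atTop, ∀ v : Wper C m N, energyNormPer C v.1 = 1 →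
      ∃ w : Wper C m N, energyNormPer C w.1 = 1 ∧
        min (c₀ / 8) (c₁ / 4) ≤ hessPer C P (perTrunc C η N u.1).1 v.1 w.1 := by
  obtain ⟨B, hB⟩ := exists_isHessForm P u
  obtain ⟨ι, _, l, hl⟩ := hB.exists_garding_per C hc₀ hP
  obtain ⟨hc₁, Wneg, Wpos, -, hsup, hfin, horth, hneg, hpos⟩ := hc₁
  have key := eventually_infSup B hB.symm (LinearMap.range (gradMap L m))
    ((compactSupp L m).map (gradMap L m)) (Wneg.map (gradMap L m)) (Wpos.map (gradMap L m))
    (fun N => LinearMap.range (perGradMap C m N)) dense_compactSupp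
    (eventually_mem_range_perGradMap C) (mem_range_of_weak_limit C) hc₀ hc₁ l hl
    (by rw [← Submodule.map_sup, hsup, LinearMap.range_eq_map]) inferInstance
    (by
      rintro _ ⟨v, hv, rfl⟩ _ ⟨w, hw, rfl⟩
      rw [← energyInner_eq]; exact horth v hv w hw)
    (by
      rintro _ ⟨v, hv, rfl⟩
      rw [← energyNorm_eq, ← hB.hess_eq]; exact hneg v hv)
    (by
      rintro _ ⟨v, hv, rfl⟩
      rw [← energyNorm_eq, ← hB.hess_eq]; exact hpos v hv)
  have hm : 0 < min c₀ c₁ := lt_min hc₀ hc₁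
  filter_upwards [key, hB.eventually_abs_hessPer_sub_le hη
    (show 0 < min c₀ c₁ / 8 by positivity)] with N hkey hper v hv
  rw [energyNormPer_eq] at hv
  obtain ⟨_, ⟨w, rfl⟩, hw, h1⟩ := hkey _ ⟨v, rfl⟩
  rw [hv] at hw h1
  refine ⟨w, by rw [energyNormPer_eq, hw], ?_⟩
  have h2 := (abs_le.mp (hper v w)).1
  rw [hv, hw] at h2
  have h3 : min (c₀ / 2) (c₁ / 2) = min c₀ c₁ / 2 := min_div_div_right zero_le_two _ _
  have h4 : min (c₀ / 8) (c₁ / 4) ≤ min c₀ c₁ / 4 := by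
    rw [← min_div_div_right (by norm_num : (0 : ℝ) ≤ 4)]
    exact min_le_min_right _ (by linarith)
  rw [h3] at h1
  linarith

end SecondVariation

end PointDefect

end

theorem mainTheorem4 {d m : ℕ} (hd : 2 ≤ d) (hm : 1 ≤ m)
    (L : PointDefect.DefectLattice d) (P : PointDefect.SiteEnergies L m)
    (c₀ : ℝ) (hc₀ : 0 < c₀) (hphonon : PointDefect.PhononStable P c₀)
    (C : PointDefect.Supercell L)
    (η : ℕ → PointDefect.Eu d → ℝ) (hη : PointDefect.IsCutoffFamily C η)
    (u : L.pts → PointDefect.Eu m) (hu : u ∈ PointDefect.W12def L m)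
    (hstab : PointDefect.InfSupStable P u) :
    (∃ c₁ : ℝ, PointDefect.IsSplittingConstant P u c₁) ∧
    ∀ c₁ : ℝ, PointDefect.IsSplittingConstant P u c₁ →
      ∃ N₀ : ℕ, ∀ N ≥ N₀,
        ((min (c₀ / 8) (c₁ / 4) : ℝ) : EReal) ≤
          ⨅ v : {v : PointDefect.Wper C m N // PointDefect.energyNormPer C v.1 = 1},
            ⨆ w : {w : PointDefect.Wper C m N // PointDefect.energyNormPer C w.1 = 1},
              ((PointDefect.hessPer C P (PointDefect.perTrunc C η N u).1 v.1.1 w.1.1 : ℝ) :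
                EReal) := by
  refine ⟨PointDefect.exists_isSplittingConstant (u := ⟨u, hu⟩) C hc₀ hphonon hstab,
    fun c₁ hc₁ => ?_⟩
  obtain ⟨N₀, h⟩ := Filter.eventually_atTop.mp
    (PointDefect.IsSplittingConstant.eventually_exists_le_hessPer (u := ⟨u, hu⟩) C hc₀ hphonon hη
      hc₁)
  refine ⟨N₀, fun N hN => le_iInf fun v => ?_⟩
  obtain ⟨w, hw, h1⟩ := h N hN v.1 v.2
  exact le_iSup_of_le ⟨w, hw⟩ (EReal.coe_le_coe_iff.mpr h1)
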